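/- **Setting.** Consider $x_{t+1}=Ax_t+Bu_t+w_t$, $y_t=Cx_t+v_t$ with $x_t\in\mathbb R^{n_x}$, $u_t\in\mathbb R^{n_u}$, $y_t\in\mathbb R^{n_y}$, independent i.i.d. noises $w_t\sim\mathcal N(0,W)$, $v_t\sim\mathcal N(0,V)$, and weights $Q$ (outputs) and $R$ (inputs), where $W\succeq0$, $V\succ0$, $Q\succeq0$, $R\succ0$; $(A,B)$ is controllable and $(A,C)$ is observable. Put $\tilde Q=C^\top QC$. Let $\mathtt{dare}(A,B,Q,R)$ denote the stabilizing positive semidefinite solution of $P=Q+A^\top PA-A^\top PB(R+B^\top PB)^{-1}B^\top PA$, and assume that $P=\mathtt{dare}(A,B,\tilde Q,R)$ and $\tilde\Sigma=\mathtt{dare}(A^\top,C^\top,W,V)$ exist. Put $$K^\star=-(R+B^\top PB)^{-1}B^\top PA,\quad L=\tilde\Sigma C^\top(C\tilde\Sigma C^\top+V)^{-1},\quad \tilde A=(I-LC)A,\quad \tilde B=(I-LC)B,\quad \Sigma_\nu=L(C\tilde\Sigma C^\top+V)L^\top .$$ For a history length $p\ge n_y$ put $\mathcal F_u=[\tilde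 B\ \tilde A\tilde B\cdots\tilde A^{p-1}\tilde B]$, $\mathcal F_y=[L\ \tilde AL\cdots\tilde A^{p-1}L]$, let $\mathcal O$ be the matrix with blocks $K^\star\tilde A^{p-1},\dots,K^\star\tilde A,K^\star$ stacked from top to bottom, and let $\mathcal T_u,\mathcal T_y$ be the strictly block upper triangular matrices whose $(k,l)$ blocks, $k<l$, are $K^\star\tilde A^{l-k-1}\tilde B$ and $K^\star\tilde A^{l-k-1}L$. The history representation is $$S^\star=\big[\mathcal F_u+\tilde A^p\mathcal O^\dagger(I-\mathcal T_u)\quad \mathcal F_y-\tilde A^p\mathcal O^\dagger\mathcal T_y\big],$$ where $\mathcal O^\dagger$ is the Moore–Penrose pseudoinverse; assume that $S^\star$ has full row rank $n_x$, and put $S^{\star\dagger}=S^{\star\top}(S^\star S^{\star\top})^{-1}$ and $\tilde K^\star=K^\star S^\star$. For $\tilde K\in\mathbb R^{n_u\times p(n_u+n_y)}$ let $M_{\tilde K}=A+B\tilde KS^{\star\dagger}$ and $\mathcal K=\{\tilde K:\rho(M_{\tilde K})<1\}$. For $\tilde K\in\mathcal K$ let $P_{\tilde K}$ and $\Sigma_{\tilde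 K}$ be the solutions of $$P_{\tilde K}=\tilde Q+S^{\star\dagger\top}\tilde K^\top R\tilde KS^{\star\dagger}+M_{\tilde K}^\top P_{\tilde K}M_{\tilde K},\qquad \Sigma_{\tilde K}=\Sigma_\nu+M_{\tilde K}\Sigma_{\tilde K}M_{\tilde K}^\top ,$$ and let the LQG cost be $J(\tilde K)=\operatorname{Tr}(P_{\tilde K}\Sigma_\nu)+\operatorname{Tr}(\tilde Q(I-LC)\tilde\Sigma)+\operatorname{Tr}(QV)$, with gradient $\nabla J$ for the Frobenius inner product. Write $\|\cdot\|$ for the spectral norm, $\|\cdot\|_F$ for the Frobenius norm and $\underline\sigma$ for the smallest singular value. A quotient with denominator $0$ below is read as $0$. **Statement.** Let $\tilde K_0\in\mathcal K$, $\alpha\ge1$, let $\mathcal K_\alpha=\{\tilde K\in\mathcal K: J(\tilde K)-J(\tilde K^\star)\le\alpha(J(\tilde K_0)-J(\tilde K^\star))\}$, and let $L_g\in[0,\infty]$ be the (smallest) Lipschitz constant of $\nabla J$ on $\mathcal K_\alpha$ in the Frobenius norm. Let $0<\eta\le 1/L_g$ (with $1/\infty=0$, so that $L_g$ has to be finite,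 and $1/0=\infty$) and $\tilde K_{n+1}=\tilde K_n-\eta\nabla J(\tilde K_n)$ for $n\ge0$. Then: 1. For every $n\ge0$, $\tilde K_n\in\mathcal K_\alpha$ and $$J(\tilde K_{n+1})-J(\tilde K^\star)\le\left(1-\frac{2\eta\,\underline\sigma^2(\Sigma_{\tilde K_n})\,\underline\sigma(R)}{\|\Sigma_{\tilde K^\star}\|\,\|S^\star\|^2}\right)\big(J(\tilde K_n)-J(\tilde K^\star)\big).$$ 2. If $m>0$ and $\underline\sigma(\Sigma_{\tilde K_n})\ge m$ for all $n$, then for every $N\ge0$ $$J(\tilde K_N)-J(\tilde K^\star)\le\left(1-\frac{2\eta\,m^2\,\underline\sigma(R)}{\|\Sigma_{\tilde K^\star}\|\,\|S^\star\|^2}\right)^{N}\big(J(\tilde K_0)-J(\tilde K^\star)\big),$$ and $\tilde K_n$ converges to an optimal lifted controller, that is, to some $\tilde K_\infty$ with $\tilde K_\infty S^{\star\dagger}=K^\star$. -/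

import Mathlib

open scoped ENNReal Topology
open Filter

namespace LQG

section MatrixNotions

/-- Spectral norm `‖M‖`: the operator norm with respect to Euclidean norms. -/
noncomputable def specNorm {m n : Type*} [Fintype m] [Fintype n] [DecidableEq n]
    (M : Matrix m n ℝ) : ℝ :=
  letI := Matrix.instL2OpNormedAddCommGroup (m := m) (n := n) (𝕜 := ℝ)
  ‖M‖

/-- Frobenius norm `‖M‖_F`. -/
noncomputable def frobNorm {m n : Type*} [Fintype m] [Fintype n] (M : Matrix m n ℝ) : ℝ :=
  √(∑ i, ∑ j, M i j ^ 2)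

/-- Minimum singular value of a square matrix. Mathlib lists the singular values in descending
order, starting at index `0`, so the smallest of the `n` singular values has index `n - 1`. -/
noncomputable def minSing {n : ℕ} (M : Matrix (Fin n) (Fin n) ℝ) : ℝ :=
  (Matrix.toEuclideanLin M).singularValues (n - 1)

/-- All complex eigenvalues lie in the open unit disc: `ρ(M) < 1`. -/
def IsSchurStable {n : ℕ} (M : Matrix (Fin n) (Fin n) ℝ) : Prop :=
  spectralRadius ℂ (M.map (algebraMap ℝ ℂ)) < 1

/-- The four Penrose equations: `X` is the Moore-Penrose pseudoinverse of `M`. -/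
structure IsMoorePenrose {m n : Type*} [Fintype m] [Fintype n]
    (M : Matrix m n ℝ) (X : Matrix n m ℝ) : Prop where
  mul_mul_self : M * X * M = M
  self_mul_mul : X * M * X = X
  symm_left : (M * X).transpose = M * X
  symm_right : (X * M).transpose = X * M

theorem exists_isMoorePenrose {m n : Type*} [Fintype m] [Fintype n] [DecidableEq n]
    (M : Matrix m n ℝ) : ∃ X, IsMoorePenrose M X := by
  have hH : (M.conjTranspose * M).IsHermitian := Matrix.isHermitian_conjTranspose_mul_self M
  obtain ⟨U, d, hU, hspec⟩ : ∃ (U : Matrix n n ℝ) (d : n → ℝ), U.conjTranspose * U = 1 ∧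
      M.conjTranspose * M = U * Matrix.diagonal d * U.conjTranspose := by
    refine ⟨hH.eigenvectorUnitary, hH.eigenvalues, ?_, ?_⟩
    · simpa [Matrix.star_eq_conjTranspose] using
        Unitary.coe_star_mul_self hH.eigenvectorUnitary
    · have := hH.spectral_theorem
      simpa [Unitary.conjStarAlgAut_apply, Matrix.star_eq_conjTranspose, Function.comp_def]
        using this
  simp only [Matrix.conjTranspose_eq_transpose_of_trivial] at hU hspec
  have key : ∀ a b : n → ℝ, (U * Matrix.diagonal a * U.transpose) *
      (U * Matrix.diagonal b * U.transpose) =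
      U * Matrix.diagonal (fun i => a i * b i) * U.transpose := by
    intro a b
    calc _ = U * Matrix.diagonal a * (U.transpose * U) * Matrix.diagonal b * U.transpose := by
          simp only [Matrix.mul_assoc]
      _ = _ := by rw [hU, Matrix.mul_one, Matrix.mul_assoc U, Matrix.diagonal_mul_diagonal]
  have ksym : ∀ a : n → ℝ, (U * Matrix.diagonal a * U.transpose).transpose =
      U * Matrix.diagonal a * U.transpose := by
    intro a
    simp [Matrix.transpose_mul, Matrix.mul_assoc]
  set G : Matrix n n ℝ := U * Matrix.diagonal (fun i => (d i)⁻¹) * U.transpose with hG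
  set H : Matrix n n ℝ := M.transpose * M with hHdef
  have hGs : G.transpose = G := ksym _
  have hHs : H.transpose = H := by rw [hspec]; exact ksym _
  have hGHs : (G * H).transpose = G * H := by rw [hspec, hG, key]; exact ksym _
  have hHGH : H * G * H = H := by
    rw [hspec, hG, key, key]
    congr 3; funext i
    by_cases h : d i = 0 <;> simp [h]
  have hGHG : G * H * G = G := by
    rw [hspec, hG, key, key]
    congr 3; funext i
    by_cases h : d i = 0 <;> simp [h]
  refine ⟨G * M.transpose, ?_, ?_, ?_, ?_⟩
  · have h0 : (M * (G * H) - M).conjTranspose * (M * (G * H) - M) = 0 := by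
      rw [Matrix.conjTranspose_eq_transpose_of_trivial, Matrix.transpose_sub,
        Matrix.transpose_mul, hGHs]
      calc _ = G * H * H * (G * H) - G * H * H - (H * G * H - H) := by
            simp only [Matrix.sub_mul, Matrix.mul_sub, Matrix.mul_assoc, hHdef]
            abel
        _ = 0 := by
            have h1 : G * H * H * (G * H) = G * H * H := by
              calc _ = G * H * (H * G * H) := by simp only [Matrix.mul_assoc]
                _ = _ := by rw [hHGH]
            rw [h1, hHGH]; simp
    have h1 := Matrix.conjTranspose_mul_self_eq_zero.mp h0
    have h2 := sub_eq_zero.mp h1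
    calc _ = M * (G * H) := by simp only [hHdef, Matrix.mul_assoc]
      _ = M := h2
  · calc _ = G * H * G * M.transpose := by simp only [hHdef, Matrix.mul_assoc]
      _ = _ := by rw [hGHG]
  · simp only [Matrix.transpose_mul, Matrix.transpose_transpose, hGs, Matrix.mul_assoc]
  · have : G * M.transpose * M = G * H := by simp only [hHdef, Matrix.mul_assoc]
    rw [this]; exact hGHs

/-- The Moore-Penrose pseudoinverse `M†`. -/
noncomputable def pinv {m n : Type*} [Fintype m] [Fintype n] [DecidableEq n]
    (M : Matrix m n ℝ) : Matrix n m ℝ :=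
  Classical.choose (exists_isMoorePenrose M)

/-- `(A, B)` is controllable: `[B  AB  ⋯  A^{n-1}B]` has rank `n`. -/
def IsControllable {n m : ℕ} (A : Matrix (Fin n) (Fin n) ℝ) (B : Matrix (Fin n) (Fin m) ℝ) :
    Prop :=
  (Matrix.of fun (i : Fin n) (kj : Fin n × Fin m) => (A ^ (kj.1 : ℕ) * B) i kj.2).rank = n

/-- `(A, C)` is observable: by duality, `(Aᵀ, Cᵀ)` is controllable. -/
def IsObservable {n m : ℕ} (A : Matrix (Fin n) (Fin n) ℝ) (C : Matrix (Fin m) (Fin n) ℝ) :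
    Prop :=
  IsControllable A.transpose C.transpose

open Classical in
/-- `dlyap M N`: the solution `X` of the discrete Lyapunov equation `X = N + Mᵀ X M`
(it exists and is unique when `M` is Schur stable). -/
noncomputable def dlyap {n : ℕ} (M N : Matrix (Fin n) (Fin n) ℝ) : Matrix (Fin n) (Fin n) ℝ :=
  if h : ∃! X : Matrix (Fin n) (Fin n) ℝ, X = N + M.transpose * X * M then
    Classical.choose h.exists
  else 0

/-- `P` is the stabilizing solution of the discrete algebraic Riccati equation
`P = Q + Aᵀ P A - Aᵀ P B (R + Bᵀ P B)⁻¹ Bᵀ P A`. -/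
structure IsStabilizingDARE {n m : ℕ} (A : Matrix (Fin n) (Fin n) ℝ)
    (B : Matrix (Fin n) (Fin m) ℝ) (Q : Matrix (Fin n) (Fin n) ℝ)
    (R : Matrix (Fin m) (Fin m) ℝ) (P : Matrix (Fin n) (Fin n) ℝ) : Prop where
  posSemidef : P.PosSemidef
  equation : P = Q + A.transpose * P * A -
    A.transpose * P * B * (R + B.transpose * P * B)⁻¹ * B.transpose * P * A
  stable : IsSchurStable (A - B * ((R + B.transpose * P * B)⁻¹ * B.transpose * P * A))

open Classical in
/-- `dare A B Q R`: the stabilizing solution of the discrete algebraic Riccati equation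
(it is unique when it exists). -/
noncomputable def dare {n m : ℕ} (A : Matrix (Fin n) (Fin n) ℝ)
    (B : Matrix (Fin n) (Fin m) ℝ) (Q : Matrix (Fin n) (Fin n) ℝ)
    (R : Matrix (Fin m) (Fin m) ℝ) : Matrix (Fin n) (Fin n) ℝ :=
  if h : ∃ P, IsStabilizingDARE A B Q R P then Classical.choose h else 0

end MatrixNotions

/-- Data of an LQG problem: the system `x⁺ = A x + B u + w`, `y = C x + v`, the weights `Q` on
outputs and `R` on inputs, and the covariances `W` of `w` and `V` of `v`. -/
structure System (nx nu ny : ℕ) where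
  A : Matrix (Fin nx) (Fin nx) ℝ
  B : Matrix (Fin nx) (Fin nu) ℝ
  C : Matrix (Fin ny) (Fin nx) ℝ
  Q : Matrix (Fin ny) (Fin ny) ℝ
  R : Matrix (Fin nu) (Fin nu) ℝ
  W : Matrix (Fin nx) (Fin nx) ℝ
  V : Matrix (Fin ny) (Fin ny) ℝ

/-- Index set of the input-output history
`z_{t,p} = (u_{t-1}, …, u_{t-p}, y_t, …, y_{t-p+1})`. -/
abbrev HistIdx (nu ny p : ℕ) : Type := (Fin p × Fin nu) ⊕ (Fin p × Fin ny)

/-- Lifted control gains: matrices of size `nu × p (nu + ny)`. -/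
abbrev Gain (nu ny p : ℕ) : Type := Matrix (Fin nu) (HistIdx nu ny p) ℝ

namespace System

variable {nx nu ny : ℕ} (sys : System nx nu ny)

/-- The cost matrix `Q̃ = Cᵀ Q C` on the state. -/
def Qt : Matrix (Fin nx) (Fin nx) ℝ := sys.C.transpose * sys.Q * sys.C

/-- The control Riccati solution. -/
noncomputable def Pstar : Matrix (Fin nx) (Fin nx) ℝ := dare sys.A sys.B sys.Qt sys.R

/-- The filtering Riccati solution `Σ̃`. -/
noncomputable def Sigt : Matrix (Fin nx) (Fin nx) ℝ :=
  dare sys.A.transpose sys.C.transpose sys.W sys.V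

/-- The optimal LQG gain `K⋆ = -(R + Bᵀ P B)⁻¹ Bᵀ P A`. -/
noncomputable def Kstar : Matrix (Fin nu) (Fin nx) ℝ :=
  -((sys.R + sys.B.transpose * sys.Pstar * sys.B)⁻¹ * sys.B.transpose * sys.Pstar * sys.A)

/-- The Kalman gain `L = Σ̃ Cᵀ (C Σ̃ Cᵀ + V)⁻¹`. -/
noncomputable def L : Matrix (Fin nx) (Fin ny) ℝ :=
  sys.Sigt * sys.C.transpose * (sys.C * sys.Sigt * sys.C.transpose + sys.V)⁻¹

/-- `Ã = (I - L C) A`. -/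
noncomputable def At : Matrix (Fin nx) (Fin nx) ℝ := (1 - sys.L * sys.C) * sys.A

/-- `B̃ = (I - L C) B`. -/
noncomputable def Bt : Matrix (Fin nx) (Fin nu) ℝ := (1 - sys.L * sys.C) * sys.B

/-- `Σ_ν = L (C Σ̃ Cᵀ + V) Lᵀ`. -/
noncomputable def SigNu : Matrix (Fin nx) (Fin nx) ℝ :=
  sys.L * (sys.C * sys.Sigt * sys.C.transpose + sys.V) * sys.L.transpose

/-- `F_{u,p} = [B̃  ÃB̃  ⋯  Ã^{p-1}B̃]`. -/
noncomputable def Fu (p : ℕ) : Matrix (Fin nx) (Fin p × Fin nu) ℝ :=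
  Matrix.of fun i kj => (sys.At ^ (kj.1 : ℕ) * sys.Bt) i kj.2

/-- `F_{y,p} = [L  ÃL  ⋯  Ã^{p-1}L]`. -/
noncomputable def Fy (p : ℕ) : Matrix (Fin nx) (Fin p × Fin ny) ℝ :=
  Matrix.of fun i kj => (sys.At ^ (kj.1 : ℕ) * sys.L) i kj.2

/-- `O_{x,p}`: the blocks `K⋆Ã^{p-1}, …, K⋆Ã, K⋆` stacked from top to bottom. -/
noncomputable def Ox (p : ℕ) : Matrix (Fin p × Fin nu) (Fin nx) ℝ :=
  Matrix.of fun ki j => (sys.Kstar * sys.At ^ (p - 1 - (ki.1 : ℕ))) ki.2 j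

/-- `T_{u,p}`: strictly block upper triangular, with block `(k, l)` equal to
`K⋆ Ã^{l-k-1} B̃` for `k < l`. -/
noncomputable def Tu (p : ℕ) : Matrix (Fin p × Fin nu) (Fin p × Fin nu) ℝ :=
  Matrix.of fun ki lj => if ki.1 < lj.1 then
    (sys.Kstar * sys.At ^ ((lj.1 : ℕ) - (ki.1 : ℕ) - 1) * sys.Bt) ki.2 lj.2 else 0

/-- `T_{y,p}`: strictly block upper triangular, with block `(k, l)` equal to
`K⋆ Ã^{l-k-1} L` for `k < l`. -/
noncomputable def Ty (p : ℕ) : Matrix (Fin p × Fin nu) (Fin p × Fin ny) ℝ :=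
  Matrix.of fun ki lj => if ki.1 < lj.1 then
    (sys.Kstar * sys.At ^ ((lj.1 : ℕ) - (ki.1 : ℕ) - 1) * sys.L) ki.2 lj.2 else 0

/-- The history representation
`S⋆ = [F_u + Ã^p O† (I - T_u)   F_y - Ã^p O† T_y]`. -/
noncomputable def Sstar (p : ℕ) : Matrix (Fin nx) (HistIdx nu ny p) ℝ :=
  Matrix.fromCols
    (sys.Fu p + sys.At ^ p * pinv (sys.Ox p) * (1 - sys.Tu p))
    (sys.Fy p - sys.At ^ p * pinv (sys.Ox p) * sys.Ty p)

/-- `S⋆† = S⋆ᵀ (S⋆ S⋆ᵀ)⁻¹`, the pseudoinverse of the full row rank matrix `S⋆`. -/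
noncomputable def Sdag (p : ℕ) : Matrix (HistIdx nu ny p) (Fin nx) ℝ :=
  (sys.Sstar p).transpose * (sys.Sstar p * (sys.Sstar p).transpose)⁻¹

/-- The optimal lifted gain `K̃⋆ = K⋆ S⋆`. -/
noncomputable def KtStar (p : ℕ) : Gain nu ny p := sys.Kstar * sys.Sstar p

/-- The closed-loop matrix `A + B K̃ S⋆†`. -/
noncomputable def closedLoop {p : ℕ} (K : Gain nu ny p) : Matrix (Fin nx) (Fin nx) ℝ :=
  sys.A + sys.B * K * sys.Sdag p

/-- The set `𝒦` of stabilizing lifted controllers. -/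
def stabilizing (p : ℕ) : Set (Gain nu ny p) := {K | IsSchurStable (sys.closedLoop K)}

/-- `P_K̃`, the solution of
`P = Q̃ + S⋆†ᵀ K̃ᵀ R K̃ S⋆† + (A + B K̃ S⋆†)ᵀ P (A + B K̃ S⋆†)`. -/
noncomputable def P {p : ℕ} (K : Gain nu ny p) : Matrix (Fin nx) (Fin nx) ℝ :=
  dlyap (sys.closedLoop K)
    (sys.Qt + (sys.Sdag p).transpose * K.transpose * sys.R * K * sys.Sdag p)

/-- The state covariance `Σ_K̃`, the solution of
`Σ = Σ_ν + (A + B K̃ S⋆†) Σ (A + B K̃ S⋆†)ᵀ`. -/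
noncomputable def Sig {p : ℕ} (K : Gain nu ny p) : Matrix (Fin nx) (Fin nx) ℝ :=
  dlyap (sys.closedLoop K).transpose sys.SigNu

/-- The LQG cost of a stabilizing lifted controller,
`J(K̃) = Tr(P_K̃ Σ_ν) + Tr(Q̃ (I - L C) Σ̃) + Tr(Q V)`. -/
noncomputable def J {p : ℕ} (K : Gain nu ny p) : ℝ :=
  (sys.P K * sys.SigNu).trace + (sys.Qt * (1 - sys.L * sys.C) * sys.Sigt).trace +
    (sys.Q * sys.V).trace

/-- The gradient `∇J(K̃)`: the matrix of the partial derivatives of `J` with respect to the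
entries of `K̃` (its gradient for the Frobenius inner product). -/
noncomputable def gradJ {p : ℕ} (K : Gain nu ny p) : Gain nu ny p :=
  Matrix.of fun i j => lineDeriv ℝ (fun X : Gain nu ny p => sys.J X) K (Matrix.single i j 1)

/-- The sublevel set `𝒦_{K̃', α}` of stabilizing controllers with
`J(K̃) - J(K̃⋆) ≤ α (J(K̃') - J(K̃⋆))`. -/
def sublevel {p : ℕ} (K' : Gain nu ny p) (α : ℝ) : Set (Gain nu ny p) :=
  {K | K ∈ sys.stabilizing p ∧
    sys.J K - sys.J (sys.KtStar p) ≤ α * (sys.J K' - sys.J (sys.KtStar p))}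

/-- The Lipschitz constant of `∇J` on a set `s` in the Frobenius norm: the smallest
`L ∈ [0, ∞]` with `‖∇J(X) - ∇J(Y)‖_F ≤ L ‖X - Y‖_F` for all `X, Y ∈ s`
(in `[0, ∞]` one has `0 / 0 = 0`). -/
noncomputable def gradLip {p : ℕ} (s : Set (Gain nu ny p)) : ℝ≥0∞ :=
  ⨆ X ∈ s, ⨆ Y ∈ s,
    ENNReal.ofReal (frobNorm (sys.gradJ X - sys.gradJ Y)) / ENNReal.ofReal (frobNorm (X - Y))

end System

end LQG

/-! Through the feedback F = K̃ S⋆† the cost is, up to constants, the LQR cost tr(P Σ_ν).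
Adjointness of the two Lyapunov equations gives an exact formula for the cost difference of two
stabilizing gains (`System.Regular.J_sub_J`). Its first-order part is the gradient 2 E Σ_K̃ S⋆†ᵀ,
where E is `System.natGrad`. Evaluated at the optimum, after completing a square, it gives gradient
domination: the gap is at most a constant times ‖∇J‖_F². A gradient step lowers J by at least
(η/2)‖∇J‖_F², so the gap contracts. Under a uniform bound m the steps are then geometrically small,
and the iterates converge.

The difficulty is to keep the segment of a gradient step inside the stabilizing set. Since Σ_ν may
be singular, J need not blow up at the boundary: an unexcited mode can become unstable at finite
cost. What excludes this is that L_g is finite (`System.Regular.not_tendsto_boundary`). Suppose the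
segment reaches the boundary with cost below the starting level by a fixed margin, and let b be a
nonzero column of Σ_ν. By controllability (Heymann's lemma), arbitrarily small changes of the gain
make b excite every mode. A nearly critical eigenvalue can then be pushed out of the open disc by a
small rank-one change of the closed loop, chosen so that every mode reaching the unit circle on the
way is excited by b (`exists_destabilizing`). The gradient is bounded near the boundary point, so
the cost stays below the level along this short path up to its first exit. Bounded cost bounds the
covariances (`System.Regular.exists_trace_Sig_le`), so a limit covariance solves the Lyapunov
equation at the exit point. Such an equation forces Σ_ν, and hence b, to be annihilated by every
mode on the circle (`vecMul_eq_zero_of_lyap`), a contradiction. -/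

namespace LQG

open Matrix

/-! ### Schur stability through left eigenvectors. -/

section Schur

variable {n : ℕ}

/-- The complexification of a real matrix. -/
noncomputable abbrev cmat {m n : Type*} (M : Matrix m n ℝ) : Matrix m n ℂ := M.map (algebraMap ℝ ℂ)

/-- `v` is a (complex) left eigenvector of `M` for the eigenvalue `μ`. -/
def IsLeftEigen (M : Matrix (Fin n) (Fin n) ℝ) (μ : ℂ) (v : Fin n → ℂ) : Prop :=
  v ≠ 0 ∧ v ᵥ* cmat M = μ • v

theorem det_smul_one_sub_eq_zero_iff (M : Matrix (Fin n) (Fin n) ℝ) (μ : ℂ) :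
    (scalar (Fin n) μ - cmat M).det = 0 ↔ ∃ v, IsLeftEigen M μ v := by
  rw [← exists_vecMul_eq_zero_iff]
  refine exists_congr fun v => and_congr_right fun _ => ?_
  rw [vecMul_sub, sub_eq_zero, eq_comm]
  have : v ᵥ* (scalar (Fin n)) μ = μ • v := by
    ext i; simp [scalar_apply, vecMul_diagonal, mul_comm]
  rw [this]

theorem mem_spectrum_iff_exists_isLeftEigen (M : Matrix (Fin n) (Fin n) ℝ) (μ : ℂ) :
    μ ∈ spectrum ℂ (cmat M) ↔ ∃ v, IsLeftEigen M μ v := by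
  rw [mem_spectrum_iff_isRoot_charpoly, Polynomial.IsRoot.def, eval_charpoly,
    det_smul_one_sub_eq_zero_iff]

theorem isSchurStable_iff (M : Matrix (Fin n) (Fin n) ℝ) :
    IsSchurStable M ↔ ∀ μ v, IsLeftEigen M μ v → ‖μ‖ < 1 := by
  let _ : NormedRing (Matrix (Fin n) (Fin n) ℂ) := Matrix.linftyOpNormedRing
  let _ : NormedAlgebra ℂ (Matrix (Fin n) (Fin n) ℂ) := Matrix.linftyOpNormedAlgebra
  constructor
  · intro h μ v hv
    have h1 : μ ∈ spectrum ℂ (cmat M) := (mem_spectrum_iff_exists_isLeftEigen M μ).2 ⟨v, hv⟩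
    have h2 : (‖μ‖₊ : ℝ≥0∞) ≤ spectralRadius ℂ (cmat M) := by
      rw [spectralRadius]
      exact le_iSup₂ (f := fun (k : ℂ) (_ : k ∈ spectrum ℂ (cmat M)) => (‖k‖₊ : ℝ≥0∞)) μ h1
    have h3 : (‖μ‖₊ : ℝ≥0∞) < 1 := lt_of_le_of_lt h2 h
    exact_mod_cast h3
  · intro h
    -- In dimension zero the spectrum is empty and the supremum is zero; otherwise the spectral
    -- radius is attained.
    rcases Nat.eq_zero_or_pos n with rfl | hn
    · have : spectralRadius ℂ (cmat M) = 0 := by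
        rw [spectralRadius]
        simp only [ENNReal.iSup_eq_zero]
        intro i hi
        obtain ⟨v, hv, -⟩ := (mem_spectrum_iff_exists_isLeftEigen M i).1 hi
        exact absurd (Subsingleton.elim v 0) hv
      rw [IsSchurStable, this]; exact one_pos
    · have : Nonempty (Fin n) := ⟨⟨0, hn⟩⟩
      have := spectrum.spectralRadius_lt_of_forall_lt (cmat M) (r := 1) (fun z hz => by
        obtain ⟨v, hv⟩ := (mem_spectrum_iff_exists_isLeftEigen M z).1 hz
        exact_mod_cast h z v hv)
      rw [IsSchurStable]; exact_mod_cast this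

theorem cmat_pow (M : Matrix (Fin n) (Fin n) ℝ) (k : ℕ) : cmat (M ^ k) = cmat M ^ k :=
  Matrix.map_pow M (algebraMap ℝ ℂ) k

/-- By Gelfand's formula ‖M^k‖^(1/k) is eventually below some r < 1, so ‖M^k‖ ≤ r^k. The norm is
auxiliary; the limit is entrywise. -/
theorem IsSchurStable.tendsto_pow {M : Matrix (Fin n) (Fin n) ℝ} (h : IsSchurStable M) :
    Tendsto (fun k : ℕ => M ^ k) atTop (𝓝 0) := by
  let _ : NormedRing (Matrix (Fin n) (Fin n) ℂ) := Matrix.linftyOpNormedRing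
  let _ : NormedAlgebra ℂ (Matrix (Fin n) (Fin n) ℂ) := Matrix.linftyOpNormedAlgebra
  have hg := spectrum.pow_nnnorm_pow_one_div_tendsto_nhds_spectralRadius (cmat M)
  obtain ⟨r, hr1, hr2⟩ := ENNReal.lt_iff_exists_nnreal_btwn.1 h
  have hr3 : (r : ℝ) < 1 := by exact_mod_cast hr2
  have hc : Tendsto (fun k : ℕ => cmat M ^ k) atTop (𝓝 0) := by
    refine tendsto_zero_iff_norm_tendsto_zero.2 ?_
    refine squeeze_zero' (Eventually.of_forall fun _ => norm_nonneg _) ?_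
      (tendsto_pow_atTop_nhds_zero_of_lt_one r.2 hr3)
    filter_upwards [hg.eventually_lt_const hr1, eventually_gt_atTop 0] with k hk hk0
    have h1 : ((‖cmat M ^ k‖₊ : ℝ≥0∞) ^ (1 / (k : ℝ))) ^ (k : ℝ) ≤ (r : ℝ≥0∞) ^ (k : ℝ) :=
      ENNReal.rpow_le_rpow hk.le (by positivity)
    have hk0' : (k : ℝ) ≠ 0 := by positivity
    rw [← ENNReal.rpow_mul, one_div, inv_mul_cancel₀ hk0', ENNReal.rpow_one,
      ENNReal.rpow_natCast] at h1
    exact_mod_cast h1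
  refine tendsto_pi_nhds.2 fun i => tendsto_pi_nhds.2 fun j => ?_
  have h1 : Tendsto (fun k : ℕ => (cmat M ^ k) i j) atTop (𝓝 0) :=
    (tendsto_pi_nhds.1 (tendsto_pi_nhds.1 hc i) j)
  have h2 := (Complex.continuous_re.tendsto _).comp h1
  simpa [Function.comp_def, ← cmat_pow] using h2

theorem isLeftEigen_pow {M : Matrix (Fin n) (Fin n) ℝ} {μ : ℂ} {v : Fin n → ℂ}
    (h : IsLeftEigen M μ v) (k : ℕ) : IsLeftEigen (M ^ k) (μ ^ k) v := by
  refine ⟨h.1, ?_⟩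
  induction k with
  | zero => simp
  | succ k ih =>
    have : cmat (M ^ (k + 1)) = cmat (M ^ k) * cmat M := by
      rw [pow_succ]; exact Matrix.map_mul
    rw [this, ← vecMul_vecMul, ih, smul_vecMul, h.2, smul_smul, pow_succ]

theorem IsLeftEigen.norm_le {M : Matrix (Fin n) (Fin n) ℝ} {μ : ℂ} {v : Fin n → ℂ}
    (h : IsLeftEigen M μ v) : ‖μ‖ ≤ ∑ i, ∑ j, |M i j| := by
  have hv : 0 < ‖v‖ := norm_pos_iff.2 h.1
  have h1 : ‖μ • v‖ ≤ (∑ i, ∑ j, |M i j|) * ‖v‖ := by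
    rw [← h.2]
    refine (pi_norm_le_iff_of_nonneg (by positivity)).2 fun j => ?_
    rw [vecMul, dotProduct]
    refine (norm_sum_le _ _).trans ?_
    rw [Finset.sum_mul]
    refine Finset.sum_le_sum fun i _ => ?_
    rw [norm_mul, mul_comm]
    have h2 : ‖cmat M i j‖ ≤ ∑ j, |M i j| := by
      simpa using Finset.single_le_sum (f := fun j => |M i j|) (fun _ _ => abs_nonneg _)
        (Finset.mem_univ j)
    exact mul_le_mul h2 (norm_le_pi_norm v i) (norm_nonneg _) (by positivity)
  rw [norm_smul] at h1
  exact le_of_mul_le_mul_right h1 hv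

/-- Some power M^k has entrywise sum below 1. This is an open condition on M, and it bounds |μ|^k
below 1 for every eigenvalue μ. -/
theorem isOpen_isSchurStable : IsOpen {M : Matrix (Fin n) (Fin n) ℝ | IsSchurStable M} := by
  rw [isOpen_iff_mem_nhds]
  intro M hM
  have hc : Continuous fun X : Matrix (Fin n) (Fin n) ℝ => ∑ i, ∑ j, |X i j| := by fun_prop
  have h0 := (hc.tendsto 0).comp hM.tendsto_pow
  simp only [Matrix.zero_apply, abs_zero, Finset.sum_const_zero] at h0
  obtain ⟨k, hk, hk0⟩ := ((h0.eventually_lt_const one_pos).and (eventually_gt_atTop 0)).exists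
  have hop : IsOpen {X : Matrix (Fin n) (Fin n) ℝ | ∑ i, ∑ j, |(X ^ k) i j| < 1} :=
    isOpen_lt (hc.comp (continuous_pow k)) continuous_const
  filter_upwards [hop.mem_nhds hk] with X hX
  refine (isSchurStable_iff X).2 fun μ v hv => ?_
  have h1 := (isLeftEigen_pow hv k).norm_le.trans_lt hX
  rw [norm_pow] at h1
  exact (pow_lt_one_iff_of_nonneg (norm_nonneg _) hk0.ne').1 h1

/-- The characteristic polynomial at μ is a product of n factors μ - z over the eigenvalues z, each
of modulus at least |μ| - r. -/
theorem pow_le_norm_det {M : Matrix (Fin n) (Fin n) ℝ} {r : ℝ}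
    (h : ∀ μ v, IsLeftEigen M μ v → ‖μ‖ ≤ r) {μ : ℂ} (hμ : r ≤ ‖μ‖) :
    (‖μ‖ - r) ^ n ≤ ‖(scalar (Fin n) μ - cmat M).det‖ := by
  have hs : (cmat M).charpoly.Splits := IsAlgClosed.splits _
  rw [← eval_charpoly, hs.eval_eq_prod_roots, (charpoly_monic _).leadingCoeff, one_mul]
  have hcard : Multiset.card (cmat M).charpoly.roots = n := by
    rw [← hs.natDegree_eq_card_roots, charpoly_natDegree_eq_dim, Fintype.card_fin]
  have key : ∀ s : Multiset ℂ, (∀ z ∈ s, ‖z‖ ≤ r) →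
      (‖μ‖ - r) ^ Multiset.card s ≤ ‖(s.map fun z => μ - z).prod‖ := by
    intro s
    induction s using Multiset.induction_on with
    | empty => simp
    | cons a s ih =>
      intro hs
      rw [Multiset.card_cons, Multiset.map_cons, Multiset.prod_cons, norm_mul, pow_succ, mul_comm]
      refine mul_le_mul ?_ (ih fun z hz => hs z (Multiset.mem_cons_of_mem hz))
        (pow_nonneg (by linarith) _) (norm_nonneg _)
      have h1 := hs a (Multiset.mem_cons_self a s)
      have h2 := norm_sub_norm_le μ a
      linarith
  have := key (cmat M).charpoly.roots fun z hz => by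
    have hz' := (Polynomial.mem_roots'.1 hz).2
    rw [Polynomial.IsRoot.def, eval_charpoly, det_smul_one_sub_eq_zero_iff] at hz'
    obtain ⟨v, hv⟩ := hz'
    exact h z v hv
  rwa [hcard] at this

theorem tendsto_det_scalar_sub {ι : Type*} {l : Filter ι} {M : ι → Matrix (Fin n) (Fin n) ℝ}
    {M' : Matrix (Fin n) (Fin n) ℝ} (hM : Tendsto M l (𝓝 M')) (μ : ℂ) :
    Tendsto (fun k => ‖(scalar (Fin n) μ - cmat (M k)).det‖) l
      (𝓝 ‖(scalar (Fin n) μ - cmat M').det‖) := by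
  have hc : Continuous fun X : Matrix (Fin n) (Fin n) ℝ => ‖(scalar (Fin n) μ - cmat X).det‖ := by
    have : Continuous fun X : Matrix (Fin n) (Fin n) ℝ => cmat X :=
      continuous_id.matrix_map (by exact Complex.continuous_ofReal)
    exact ((continuous_const.sub this).matrix_det).norm
  exact (hc.tendsto M').comp hM

/-- Lower semicontinuity of the spectral radius: eigenvalues of a limit are approached. -/
theorem eventually_exists_isLeftEigen {ι : Type*} {l : Filter ι}
    {M : ι → Matrix (Fin n) (Fin n) ℝ} {M' : Matrix (Fin n) (Fin n) ℝ}
    (hM : Tendsto M l (𝓝 M')) {μ : ℂ} {v : Fin n → ℂ} (hv : IsLeftEigen M' μ v) {r : ℝ}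
    (hr : r < ‖μ‖) : ∀ᶠ k in l, ∃ z w, IsLeftEigen (M k) z w ∧ r < ‖z‖ := by
  have h0 := tendsto_det_scalar_sub hM μ
  rw [(det_smul_one_sub_eq_zero_iff M' μ).2 ⟨v, hv⟩, norm_zero] at h0
  filter_upwards [h0.eventually_lt_const (pow_pos (sub_pos.2 hr) n)] with k hk
  -- If all eigenvalues of `M k` had modulus at most r, the determinant at μ would be at least (|μ|
  -- - r)^n, although it tends to 0.
  by_contra! hcon
  exact absurd hk (not_lt.2 (pow_le_norm_det hcon hr.le))

/-- Stability can only be lost through the unit circle. At a first exit point this pins the critical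
eigenvalue to modulus exactly 1. -/
theorem IsLeftEigen.norm_le_one_of_tendsto {ι : Type*} {l : Filter ι} [l.NeBot]
    {M : ι → Matrix (Fin n) (Fin n) ℝ} {M' : Matrix (Fin n) (Fin n) ℝ}
    (hM : Tendsto M l (𝓝 M')) (hs : ∀ᶠ k in l, IsSchurStable (M k)) {μ : ℂ} {v : Fin n → ℂ}
    (hv : IsLeftEigen M' μ v) : ‖μ‖ ≤ 1 := by
  by_contra! hcon
  obtain ⟨k, ⟨z, w, hz, hz1⟩, hk⟩ := ((eventually_exists_isLeftEigen hM hv hcon).and hs).exists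
  exact absurd ((isSchurStable_iff _).1 hk z w hz) (not_lt.2 hz1.le)

end Schur

end LQG

namespace LQG

open Matrix

/-! ### Discrete Lyapunov equations: solvability, positivity, continuity. -/

section Lyapunov

variable {n : ℕ}

theorem IsSchurStable.transpose {M : Matrix (Fin n) (Fin n) ℝ} (h : IsSchurStable M) :
    IsSchurStable Mᵀ := by
  refine (isSchurStable_iff _).2 fun μ v hv => ?_
  have h1 : μ ∈ spectrum ℂ (cmat Mᵀ) := (mem_spectrum_iff_exists_isLeftEigen _ μ).2 ⟨v, hv⟩
  have h2 : cmat Mᵀ = (cmat M)ᵀ := rfl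
  rw [mem_spectrum_iff_isRoot_charpoly, h2, charpoly_transpose, ← mem_spectrum_iff_isRoot_charpoly]
    at h1
  obtain ⟨w, hw⟩ := (mem_spectrum_iff_exists_isLeftEigen M μ).1 h1
  exact (isSchurStable_iff M).1 h μ w hw

theorem lyap_iterate {M N X : Matrix (Fin n) (Fin n) ℝ} (hX : X = N + Mᵀ * X * M) (k : ℕ) :
    X = ∑ i ∈ Finset.range k, (M ^ i)ᵀ * N * M ^ i + (M ^ k)ᵀ * X * M ^ k := by
  induction k with
  | zero => simp
  | succ k ih =>
    rw [Finset.sum_range_succ, add_assoc]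
    have : (M ^ k)ᵀ * N * M ^ k + (M ^ (k + 1))ᵀ * X * M ^ (k + 1) = (M ^ k)ᵀ * X * M ^ k := by
      conv_rhs => rw [hX]
      rw [pow_succ', transpose_mul]
      simp only [Matrix.mul_add, Matrix.add_mul, Matrix.mul_assoc]
    rw [this]; exact ih

theorem IsSchurStable.tendsto_conj {M : Matrix (Fin n) (Fin n) ℝ} (h : IsSchurStable M)
    (X : Matrix (Fin n) (Fin n) ℝ) : Tendsto (fun k => (M ^ k)ᵀ * X * M ^ k) atTop (𝓝 0) := by
  have hc : Continuous fun Y : Matrix (Fin n) (Fin n) ℝ => Yᵀ * X * Y := by fun_prop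
  have := (hc.tendsto 0).comp h.tendsto_pow
  simpa only [Matrix.mul_zero, Function.comp_def] using this

/-- The linear Lyapunov operator `X ↦ X - Mᵀ X M`. -/
def lyapMap (M : Matrix (Fin n) (Fin n) ℝ) :
    Matrix (Fin n) (Fin n) ℝ →ₗ[ℝ] Matrix (Fin n) (Fin n) ℝ where
  toFun X := X - Mᵀ * X * M
  map_add' X Y := by simp only [Matrix.mul_add, Matrix.add_mul]; abel
  map_smul' c X := by simp [smul_sub]

/-- A homogeneous solution equals (M^k)ᵀ X M^k for every k, which tends to 0. -/
theorem IsSchurStable.lyapMap_injective {M : Matrix (Fin n) (Fin n) ℝ} (h : IsSchurStable M) :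
    Function.Injective (lyapMap M) := by
  rw [← LinearMap.ker_eq_bot, LinearMap.ker_eq_bot']
  intro X hX
  have h1 : X = 0 + Mᵀ * X * M := by rw [zero_add]; exact sub_eq_zero.1 hX
  have h2 : ∀ k, X = (M ^ k)ᵀ * X * M ^ k := fun k => by
    simpa using lyap_iterate h1 k
  refine tendsto_nhds_unique (f := fun _ : ℕ => X) tendsto_const_nhds ?_ (l := atTop)
  rw [funext h2]
  exact h.tendsto_conj X

theorem eq_lyap_iff {M N X : Matrix (Fin n) (Fin n) ℝ} :
    X = N + Mᵀ * X * M ↔ lyapMap M X = N := by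
  change _ ↔ X - _ = N
  rw [sub_eq_iff_eq_add]

theorem IsSchurStable.existsUnique_lyap {M : Matrix (Fin n) (Fin n) ℝ} (h : IsSchurStable M)
    (N : Matrix (Fin n) (Fin n) ℝ) : ∃! X : Matrix (Fin n) (Fin n) ℝ, X = N + Mᵀ * X * M := by
  simp only [eq_lyap_iff]
  have hb : Function.Bijective (lyapMap M) :=
    ⟨h.lyapMap_injective, LinearMap.injective_iff_surjective.1 h.lyapMap_injective⟩
  exact hb.existsUnique N

theorem IsSchurStable.dlyap_eq {M : Matrix (Fin n) (Fin n) ℝ} (h : IsSchurStable M)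
    (N : Matrix (Fin n) (Fin n) ℝ) : dlyap M N = N + Mᵀ * dlyap M N * M := by
  have h1 := h.existsUnique_lyap N
  rw [dlyap, dif_pos h1]
  exact Classical.choose_spec h1.exists

theorem IsSchurStable.eq_dlyap {M N X : Matrix (Fin n) (Fin n) ℝ} (h : IsSchurStable M)
    (hX : X = N + Mᵀ * X * M) : X = dlyap M N :=
  (h.existsUnique_lyap N).unique hX (h.dlyap_eq N)

theorem posSemidef_of_tendsto {ι : Type*} {l : Filter ι} [l.NeBot]
    {X : ι → Matrix (Fin n) (Fin n) ℝ} {Y : Matrix (Fin n) (Fin n) ℝ}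
    (h : Tendsto X l (𝓝 Y)) (hX : ∀ᶠ k in l, (X k).PosSemidef) : Y.PosSemidef := by
  refine PosSemidef.of_dotProduct_mulVec_nonneg ?_ fun x => ?_
  · have hc : Continuous fun Z : Matrix (Fin n) (Fin n) ℝ => Zᴴ := by fun_prop
    refine tendsto_nhds_unique (((hc.tendsto Y).comp h).congr' ?_) h
    filter_upwards [hX] with k hk using hk.1
  · have hc : Continuous fun Z : Matrix (Fin n) (Fin n) ℝ => star x ⬝ᵥ Z *ᵥ x := by fun_prop
    refine ge_of_tendsto ((hc.tendsto Y).comp h) ?_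
    filter_upwards [hX] with k hk using hk.dotProduct_mulVec_nonneg x

theorem posSemidef_conj {m k : Type*} [Fintype m] [Fintype k] {X : Matrix m m ℝ}
    (hX : X.PosSemidef) (M : Matrix m k ℝ) : (Mᵀ * X * M).PosSemidef := by
  simpa using hX.conjTranspose_mul_mul_same M

/-- The solution is the limit of the partial sums of (M^i)ᵀ N M^i, each positive semidefinite. -/
theorem IsSchurStable.posSemidef_dlyap {M N : Matrix (Fin n) (Fin n) ℝ} (h : IsSchurStable M)
    (hN : N.PosSemidef) : (dlyap M N).PosSemidef := by
  set X := dlyap M N with hXd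
  have hX : X = N + Mᵀ * X * M := h.dlyap_eq N
  have h1 : Tendsto (fun k : ℕ => ∑ i ∈ Finset.range k, (M ^ i)ᵀ * N * M ^ i) atTop (𝓝 X) := by
    have h2 : Tendsto (fun k : ℕ => X - (M ^ k)ᵀ * X * M ^ k) atTop (𝓝 (X - 0)) :=
      tendsto_const_nhds.sub (h.tendsto_conj X)
    rw [sub_zero] at h2
    refine h2.congr fun k => ?_
    rw [sub_eq_iff_eq_add]
    exact lyap_iterate hX k
  refine posSemidef_of_tendsto h1 (Eventually.of_forall fun k => ?_)
  exact Matrix.posSemidef_sum _ fun i _ => posSemidef_conj hN _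

/-- The operator z ↦ z - a z b depends continuously on the parameter and is invertible, being
injective in finite dimension. F is its inverse applied to the constant N, and inversion is
continuous at units. -/
theorem continuousAt_of_sylvester {A X : Type*} [NormedRing A] [NormedAlgebra ℝ A]
    [FiniteDimensional ℝ A] [TopologicalSpace X] {a b F : X → A} {N : A} {x : X}
    (ha : ContinuousAt a x) (hb : ContinuousAt b x)
    (hinj : ∀ᶠ y in 𝓝 x, ∀ z, z - a y * z * b y = 0 → z = 0)
    (hF : ∀ᶠ y in 𝓝 x, F y - a y * F y * b y = N) : ContinuousAt F x := by
  have : CompleteSpace A := FiniteDimensional.complete ℝ A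
  let Φ : X → A →L[ℝ] A := fun y => 1 - ContinuousLinearMap.mulLeftRight ℝ A (a y) (b y)
  have hΦ : ∀ y z, Φ y z = z - a y * z * b y := fun y z => by
    simp [Φ, ContinuousLinearMap.mulLeftRight_apply]
  have hΦc : ContinuousAt Φ x := by
    have h2 : ContinuousAt (fun y => ContinuousLinearMap.mulLeftRight ℝ A (a y) (b y)) x :=
      ((ContinuousLinearMap.mulLeftRight ℝ A).continuous.continuousAt.comp ha).clm_apply hb
    exact continuousAt_const.sub h2
  have hunit : ∀ᶠ y in 𝓝 x, IsUnit (Φ y) := by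
    filter_upwards [hinj] with y hy
    have hy' : Function.Injective (Φ y).toLinearMap := by
      rw [← LinearMap.ker_eq_bot, LinearMap.ker_eq_bot']
      intro z hz
      exact hy z ((hΦ y z).symm.trans hz)
    let e := (LinearEquiv.ofInjectiveEndo _ hy').toContinuousLinearEquiv
    exact ⟨ContinuousLinearEquiv.toUnit e, by ext1 z; rfl⟩
  obtain ⟨u, hu⟩ := hunit.self_of_nhds
  have h1 : ContinuousAt (fun y => Ring.inverse (Φ y)) x := by
    refine ContinuousAt.comp (g := Ring.inverse) ?_ hΦc
    rw [← hu]
    exact NormedRing.inverse_continuousAt u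
  refine ContinuousAt.congr (h1.clm_apply (continuousAt_const (y := N))) ?_
  filter_upwards [hunit, hF] with y hy hy2
  rw [← hy2, ← hΦ]
  exact congrArg (fun T : A →L[ℝ] A => T (F y)) (Ring.inverse_mul_cancel _ hy)

theorem IsSchurStable.continuousAt_dlyap {M : Matrix (Fin n) (Fin n) ℝ} (h : IsSchurStable M)
    (N : Matrix (Fin n) (Fin n) ℝ) :
    ContinuousAt (fun M : Matrix (Fin n) (Fin n) ℝ => dlyap M N) M := by
  let _ : NormedRing (Matrix (Fin n) (Fin n) ℝ) := Matrix.linftyOpNormedRing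
  let _ : NormedAlgebra ℝ (Matrix (Fin n) (Fin n) ℝ) := Matrix.linftyOpNormedAlgebra
  have hT : Continuous fun M : Matrix (Fin n) (Fin n) ℝ => Mᵀ := continuous_id.matrix_transpose
  have hst : ∀ᶠ X : Matrix (Fin n) (Fin n) ℝ in 𝓝 M, IsSchurStable X :=
    isOpen_isSchurStable.mem_nhds h
  refine continuousAt_of_sylvester (A := Matrix (Fin n) (Fin n) ℝ) (N := N)
    (a := fun M => Mᵀ) (b := fun M => M) hT.continuousAt continuousAt_id ?_ ?_
  · filter_upwards [hst] with X hX z hz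
    exact hX.lyapMap_injective (hz.trans (map_zero _).symm)
  · filter_upwards [hst] with X hX
    exact eq_lyap_iff.1 (hX.dlyap_eq N)

end Lyapunov

end LQG

namespace LQG

open Matrix

/-! ### Trace, Frobenius and singular value inequalities. -/

section MatrixInequalities

variable {m n l : Type*} [Fintype m] [Fintype n] [Fintype l]

theorem posSemidef_transpose_eq {ι : Type*} {X : Matrix ι ι ℝ} (h : X.PosSemidef) : Xᵀ = X := by
  simpa using h.1.eq

theorem posSemidef_gram (M : Matrix m n ℝ) : (Mᵀ * M).PosSemidef := by
  simpa using posSemidef_conjTranspose_mul_self M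

theorem posSemidef_of_quadratic {X : Matrix n n ℝ} (hs : Xᵀ = X) (h : ∀ x, 0 ≤ x ⬝ᵥ X *ᵥ x) :
    X.PosSemidef :=
  PosSemidef.of_dotProduct_mulVec_nonneg (by simpa [IsHermitian] using hs) (by simpa using h)

theorem trace_mul_nonneg [DecidableEq n] {X Y : Matrix n n ℝ} (hX : X.PosSemidef)
    (hY : Y.PosSemidef) : 0 ≤ (X * Y).trace := by
  obtain ⟨Z, rfl⟩ : ∃ Z : Matrix n n ℝ, X = Zᵀ * Z := by
    open scoped MatrixOrder in
    obtain ⟨Z, hZ⟩ := CStarAlgebra.nonneg_iff_eq_star_mul_self.1 hX.nonneg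
    exact ⟨Z, by simpa [star_eq_conjTranspose] using hZ⟩
  rw [Matrix.mul_assoc, trace_mul_comm]
  have := (posSemidef_conj hY Zᵀ).trace_nonneg
  rwa [transpose_transpose] at this

theorem trace_mul_le_trace_mul [DecidableEq n] {X Y Z : Matrix n n ℝ} (h : (Y - X).PosSemidef)
    (hZ : Z.PosSemidef) : (X * Z).trace ≤ (Y * Z).trace := by
  have := trace_mul_nonneg h hZ
  rw [Matrix.sub_mul, trace_sub] at this
  linarith

/-- The Frobenius inner product. -/
def frobInner (X Y : Matrix m n ℝ) : ℝ := ∑ i, ∑ j, X i j * Y i j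

theorem trace_transpose_mul (X Y : Matrix m n ℝ) : (Xᵀ * Y).trace = frobInner X Y := by
  rw [frobInner, Finset.sum_comm]
  simp [trace, mul_apply]

theorem frobNorm_sq (X : Matrix m n ℝ) : frobNorm X ^ 2 = frobInner X X := by
  rw [frobNorm, Real.sq_sqrt (by positivity)]
  simp [frobInner, sq]

theorem frobNorm_nonneg (X : Matrix m n ℝ) : 0 ≤ frobNorm X := Real.sqrt_nonneg _

theorem frobInner_le (X Y : Matrix m n ℝ) : |frobInner X Y| ≤ frobNorm X * frobNorm Y := by
  refine abs_le_of_sq_le_sq ?_ (mul_nonneg (frobNorm_nonneg _) (frobNorm_nonneg _))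
  rw [mul_pow, frobNorm_sq, frobNorm_sq]
  have := Finset.sum_mul_sq_le_sq_mul_sq (Finset.univ : Finset (m × n))
    (fun a => X a.1 a.2) (fun a => Y a.1 a.2)
  simpa [frobInner, Fintype.sum_prod_type, sq] using this

theorem frobNorm_smul (c : ℝ) (X : Matrix m n ℝ) : frobNorm (c • X) = |c| * frobNorm X := by
  rw [frobNorm, frobNorm, ← Real.sqrt_sq_eq_abs, ← Real.sqrt_mul (sq_nonneg c)]
  simp [mul_pow, Finset.mul_sum]

theorem frobNorm_add_le (X Y : Matrix m n ℝ) : frobNorm (X + Y) ≤ frobNorm X + frobNorm Y := by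
  refine le_of_sq_le_sq ?_ (add_nonneg (frobNorm_nonneg _) (frobNorm_nonneg _))
  have h1 : frobInner (X + Y) (X + Y) = frobInner X X + 2 * frobInner X Y + frobInner Y Y := by
    simp only [frobInner, Finset.mul_sum, ← Finset.sum_add_distrib]
    refine Finset.sum_congr rfl fun i _ => Finset.sum_congr rfl fun j _ => ?_
    simp only [Matrix.add_apply]; ring
  have h2 := (abs_le.1 (frobInner_le X Y)).2
  rw [frobNorm_sq, h1, add_sq, frobNorm_sq, frobNorm_sq]
  linarith

theorem frobNorm_eq_zero {X : Matrix m n ℝ} (h : frobNorm X = 0) : X = 0 := by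
  have h1 := frobNorm_sq X
  rw [h, frobInner] at h1
  have h2 : ∑ i, ∑ j, X i j * X i j = 0 := by rw [← h1]; norm_num
  ext i j
  have h3 := (Finset.sum_eq_zero_iff_of_nonneg fun i _ =>
    Finset.sum_nonneg fun j _ => mul_self_nonneg (X i j)).1 h2 i (Finset.mem_univ i)
  have h4 := (Finset.sum_eq_zero_iff_of_nonneg fun j _ => mul_self_nonneg (X i j)).1 h3 j
    (Finset.mem_univ j)
  simpa using h4

theorem abs_entry_le_frobNorm (X : Matrix m n ℝ) (i : m) (j : n) : |X i j| ≤ frobNorm X := by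
  refine Real.abs_le_sqrt ?_
  exact (Finset.single_le_sum (f := fun j => X i j ^ 2) (fun _ _ => sq_nonneg _)
    (Finset.mem_univ j)).trans (Finset.single_le_sum (f := fun i => ∑ j, X i j ^ 2)
      (fun _ _ => Finset.sum_nonneg fun _ _ => sq_nonneg _) (Finset.mem_univ i))

theorem continuous_frobNorm : Continuous (frobNorm : Matrix m n ℝ → ℝ) := by
  unfold frobNorm
  fun_prop

theorem frobNorm_zero : frobNorm (0 : Matrix m n ℝ) = 0 := by simp [frobNorm]

theorem specNorm_nonneg [DecidableEq n] (M : Matrix m n ℝ) : 0 ≤ specNorm M := by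
  let _ := Matrix.instL2OpNormedAddCommGroup (m := m) (n := n) (𝕜 := ℝ)
  exact norm_nonneg M

theorem dotProduct_mulVec_le [DecidableEq n] (M : Matrix m n ℝ) (x : n → ℝ) :
    (M *ᵥ x) ⬝ᵥ (M *ᵥ x) ≤ specNorm M ^ 2 * (x ⬝ᵥ x) := by
  let _ := Matrix.instL2OpNormedAddCommGroup (m := m) (n := n) (𝕜 := ℝ)
  have h := Matrix.l2_opNorm_mulVec M (WithLp.toLp 2 x)
  have h1 : ∀ {k : Type _} [Fintype k] (y : k → ℝ), y ⬝ᵥ y = ‖WithLp.toLp 2 y‖ ^ 2 := by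
    intro k _ y
    rw [EuclideanSpace.norm_sq_eq]
    simp [dotProduct, sq]
  have h2 := pow_le_pow_left₀ (norm_nonneg _) h 2
  rw [mul_pow] at h2
  rw [h1 x]
  refine le_trans (le_of_eq ?_) h2
  rw [EuclideanSpace.norm_sq_eq]
  simp [dotProduct, sq]

theorem posSemidef_specNorm_sq_sub [DecidableEq n] (M : Matrix m n ℝ) :
    (specNorm M ^ 2 • (1 : Matrix n n ℝ) - Mᵀ * M).PosSemidef := by
  refine posSemidef_of_quadratic (by simp) fun x => ?_
  rw [sub_mulVec, dotProduct_sub, smul_mulVec, one_mulVec, dotProduct_smul, ← mulVec_mulVec,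
    dotProduct_mulVec, vecMul_transpose]
  have := dotProduct_mulVec_le M x
  simp only [smul_eq_mul]
  linarith

theorem posSemidef_specNorm_sub [DecidableEq n] {X : Matrix n n ℝ} (hX : Xᵀ = X) :
    (specNorm X • (1 : Matrix n n ℝ) - X).PosSemidef := by
  refine posSemidef_of_quadratic (by simp [hX]) fun x => ?_
  rw [sub_mulVec, dotProduct_sub, smul_mulVec, one_mulVec, dotProduct_smul, smul_eq_mul, sub_nonneg]
  have h1 := dotProduct_mulVec_le X x
  have hx : 0 ≤ x ⬝ᵥ x := by simpa using dotProduct_star_self_nonneg x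
  have h2 : (x ⬝ᵥ X *ᵥ x) ^ 2 ≤ (x ⬝ᵥ x) * ((X *ᵥ x) ⬝ᵥ (X *ᵥ x)) := by
    have := Finset.sum_mul_sq_le_sq_mul_sq (Finset.univ : Finset n) x (X *ᵥ x)
    simpa [dotProduct, sq] using this
  refine le_trans (le_abs_self _) (abs_le_of_sq_le_sq' (b := specNorm X * (x ⬝ᵥ x)) ?_
    (mul_nonneg (specNorm_nonneg X) hx) |> abs_le.2)
  calc _ ≤ _ := h2
    _ ≤ (x ⬝ᵥ x) * (specNorm X ^ 2 * (x ⬝ᵥ x)) := mul_le_mul_of_nonneg_left h1 hx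
    _ = _ := by ring

theorem minSing_nonneg {k : ℕ} (M : Matrix (Fin k) (Fin k) ℝ) : 0 ≤ minSing M :=
  LinearMap.singularValues_nonneg _ _

theorem minSing_eq_zero_of_dim_zero (M : Matrix (Fin 0) (Fin 0) ℝ) : minSing M = 0 :=
  LinearMap.singularValues_of_finrank_le _ (by simp)

/-- In an orthonormal eigenbasis of MᵀM, the right side weights the squared coordinates of x by the
squared singular values. These are sorted in decreasing order, so the weight of index k - 1 is the
smallest. -/
theorem minSing_sq_mul_le {k : ℕ} (M : Matrix (Fin k) (Fin k) ℝ) (x : Fin k → ℝ) :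
    minSing M ^ 2 * (x ⬝ᵥ x) ≤ (M *ᵥ x) ⬝ᵥ (M *ᵥ x) := by
  rcases Nat.eq_zero_or_pos k with rfl | hk
  · simp
  set T := Matrix.toEuclideanLin M with hT
  have hfr : Module.finrank ℝ (EuclideanSpace ℝ (Fin k)) = k := by simp
  set hS := T.isSymmetric_adjoint_comp_self
  set b := hS.eigenvectorBasis hfr
  have hsq : minSing M ^ 2 = hS.eigenvalues hfr ⟨k - 1, by omega⟩ :=
    T.sq_singularValues_of_lt hfr (by omega)
  set y : EuclideanSpace ℝ (Fin k) := WithLp.toLp 2 x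
  have hx : x ⬝ᵥ x = ∑ i, inner ℝ (b i) y ^ 2 := by
    have h1 := b.sum_sq_norm_inner_right y
    simp only [Real.norm_eq_abs, sq_abs] at h1
    rw [h1, EuclideanSpace.norm_sq_eq]
    simp [y, dotProduct, sq]
  have hMx : (M *ᵥ x) ⬝ᵥ (M *ᵥ x) = ∑ i, hS.eigenvalues hfr i * inner ℝ (b i) y ^ 2 := by
    have h1 : (M *ᵥ x) ⬝ᵥ (M *ᵥ x) = inner ℝ (T y) (T y) := by
      rw [real_inner_self_eq_norm_sq, EuclideanSpace.norm_sq_eq]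
      simp [T, y, dotProduct, sq, Matrix.toLpLin_apply]
    rw [h1, ← LinearMap.adjoint_inner_right, ← b.sum_inner_mul_inner]
    refine Finset.sum_congr rfl fun i _ => ?_
    have h2 : inner ℝ (b i) ((LinearMap.adjoint T) (T y)) =
        inner ℝ ((LinearMap.adjoint T ∘ₗ T) (b i)) y := (hS (b i) y).symm
    rw [h2, hS.apply_eigenvectorBasis hfr i, real_inner_comm (b i) y]
    simp only [RCLike.ofReal_real_eq_id, id_eq, inner_smul_left, conj_trivial]
    ring
  rw [hsq, hx, hMx, Finset.mul_sum]
  refine Finset.sum_le_sum fun i _ => mul_le_mul_of_nonneg_right ?_ (sq_nonneg _)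
  exact hS.eigenvalues_antitone hfr (Fin.mk_le_mk.2 (by omega) : i ≤ ⟨k - 1, by omega⟩)

theorem posSemidef_sub_minSing_sq {k : ℕ} (M : Matrix (Fin k) (Fin k) ℝ) :
    (Mᵀ * M - minSing M ^ 2 • (1 : Matrix (Fin k) (Fin k) ℝ)).PosSemidef := by
  refine posSemidef_of_quadratic (by simp) fun x => ?_
  rw [sub_mulVec, dotProduct_sub, smul_mulVec, one_mulVec, dotProduct_smul, ← mulVec_mulVec,
    dotProduct_mulVec, vecMul_transpose]
  have := minSing_sq_mul_le M x
  simp only [smul_eq_mul]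
  linarith

/-- Testing the singular value bound on unit eigenvectors gives σ² ≤ λ², hence σ ≤ λ because λ ≥ 0;
diagonalization does the rest. -/
theorem posSemidef_sub_minSing {k : ℕ} {X : Matrix (Fin k) (Fin k) ℝ} (hX : X.PosSemidef) :
    (X - minSing X • (1 : Matrix (Fin k) (Fin k) ℝ)).PosSemidef := by
  have hH := hX.1
  have hd : ∀ i, minSing X ≤ hH.eigenvalues i := fun i => by
    refine le_of_sq_le_sq ?_ (hX.eigenvalues_nonneg i)
    have h1 := minSing_sq_mul_le X (hH.eigenvectorBasis i)
    have h2 : (hH.eigenvectorBasis i).ofLp ⬝ᵥ (hH.eigenvectorBasis i).ofLp = 1 := by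
      have h3 := hH.eigenvectorBasis.orthonormal.1 i
      have h4 := EuclideanSpace.norm_sq_eq (hH.eigenvectorBasis i)
      rw [h3] at h4
      simpa [dotProduct, sq] using h4.symm
    rw [hH.mulVec_eigenvectorBasis, smul_dotProduct, dotProduct_smul, h2] at h1
    simpa [sq] using h1
  have hU : hH.eigenvectorUnitary.1 * star hH.eigenvectorUnitary.1 = 1 :=
    Unitary.coe_mul_star_self _
  have hspec := hH.spectral_theorem
  simp only [Unitary.conjStarAlgAut_apply] at hspec
  set U : Matrix (Fin k) (Fin k) ℝ := hH.eigenvectorUnitary.1 with hUdef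
  have key : X - minSing X • (1 : Matrix (Fin k) (Fin k) ℝ) =
      U * diagonal (fun i => hH.eigenvalues i - minSing X) * Uᴴ := by
    have h1 : diagonal (fun i => hH.eigenvalues i - minSing X) =
        diagonal (RCLike.ofReal ∘ hH.eigenvalues) - minSing X • (1 : Matrix (Fin k) (Fin k) ℝ) := by
      rw [smul_one_eq_diagonal, diagonal_sub]; rfl
    rw [h1, Matrix.mul_sub, Matrix.sub_mul, Matrix.mul_smul, Matrix.mul_one, Matrix.smul_mul,
      ← star_eq_conjTranspose, hU, ← hspec]
  rw [key]
  exact (PosSemidef.diagonal fun i => sub_nonneg.2 (hd i)).mul_mul_conjTranspose_same U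

theorem minSing_pos {k : ℕ} (hk : 0 < k) {X : Matrix (Fin k) (Fin k) ℝ} (hX : X.PosDef) :
    0 < minSing X := by
  have hinj : Function.Injective (Matrix.toEuclideanLin X) := by
    rw [← LinearMap.ker_eq_bot, LinearMap.ker_eq_bot']
    intro x hx
    by_contra hne
    have hne' : x.ofLp ≠ 0 := fun h => hne (by ext i; exact congrFun h i)
    have h1 := hX.dotProduct_mulVec_pos hne'
    have h2 : X *ᵥ x.ofLp = 0 := by
      ext i
      have := congrFun (congrArg WithLp.ofLp hx) i
      simpa [Matrix.toLpLin_apply] using this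
    simp [h2] at h1
  exact LinearMap.injective_iff_forall_lt_finrank_singularValues_pos _ |>.1 hinj (k - 1)
    (by simp; omega)

end MatrixInequalities

end LQG

namespace LQG

open Matrix

/-! ### Algebra behind the cost difference formula. -/

section CostAlgebra

variable {k m : ℕ}

/-- Completing the increment: the one-step cost-to-go difference between two state feedbacks. -/
theorem cost_increment (A Q X : Matrix (Fin k) (Fin k) ℝ) (B : Matrix (Fin k) (Fin m) ℝ)
    (R : Matrix (Fin m) (Fin m) ℝ) (F D : Matrix (Fin m) (Fin k) ℝ) (hX : Xᵀ = X) (hR : Rᵀ = R) :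
    (Q + (F + D)ᵀ * R * (F + D) + (A + B * (F + D))ᵀ * X * (A + B * (F + D))) -
      (Q + Fᵀ * R * F + (A + B * F)ᵀ * X * (A + B * F)) =
    Dᵀ * (R + Bᵀ * X * B) * D + Dᵀ * (R * F + Bᵀ * X * (A + B * F)) +
      (R * F + Bᵀ * X * (A + B * F))ᵀ * D := by
  simp only [transpose_add, transpose_mul, transpose_transpose, hX, hR, Matrix.mul_add,
    Matrix.add_mul, Matrix.mul_assoc]
  abel

/-- The Lyapunov operators of M and Mᵀ are adjoint for the trace pairing. This rewrites a cost tr(X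
Σ_ν) as a trace against the covariance of another controller, for any X. -/
theorem trace_lyap_duality {M N S X : Matrix (Fin k) (Fin k) ℝ} (hS : S = N + M * S * Mᵀ) :
    (X * N).trace = ((X - Mᵀ * X * M) * S).trace := by
  have h1 : N = S - M * S * Mᵀ := by rw [eq_sub_iff_add_eq]; exact hS.symm
  have h2 : (X * (M * S * Mᵀ)).trace = (Mᵀ * X * M * S).trace := by
    rw [← Matrix.mul_assoc, trace_mul_comm]
    simp only [Matrix.mul_assoc]
  rw [h1, Matrix.mul_sub, Matrix.sub_mul, trace_sub, trace_sub, h2]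

theorem trace_transpose_mul_mul_of_symm {E D : Matrix (Fin m) (Fin k) ℝ}
    {S : Matrix (Fin k) (Fin k) ℝ} (hS : Sᵀ = S) : (Eᵀ * D * S).trace = (Dᵀ * E * S).trace := by
  rw [← trace_transpose]
  simp only [transpose_mul, transpose_transpose, hS]
  rw [trace_mul_comm]

end CostAlgebra

/-! ### The LQG cost, its exact difference formula and its minimum. -/

namespace System

variable {nx nu ny : ℕ} (sys : System nx nu ny)

/-- The standing assumptions on the LQG problem that enter the analysis of the cost. -/
structure Regular (p : ℕ) : Prop where
  posSemidef_Q : sys.Q.PosSemidef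
  posDef_R : sys.R.PosDef
  posDef_V : sys.V.PosDef
  exists_dare : ∃ P, IsStabilizingDARE sys.A sys.B sys.Qt sys.R P
  exists_filter_dare : ∃ S, IsStabilizingDARE sys.Aᵀ sys.Cᵀ sys.W sys.V S
  rank_Sstar : (sys.Sstar p).rank = nx

variable {sys} {p : ℕ}

theorem Regular.isStabilizing_Pstar (hr : sys.Regular p) :
    IsStabilizingDARE sys.A sys.B sys.Qt sys.R sys.Pstar := by
  rw [Pstar, dare, dif_pos hr.exists_dare]
  exact Classical.choose_spec hr.exists_dare

theorem Regular.isStabilizing_Sigt (hr : sys.Regular p) :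
    IsStabilizingDARE sys.Aᵀ sys.Cᵀ sys.W sys.V sys.Sigt := by
  rw [Sigt, dare, dif_pos hr.exists_filter_dare]
  exact Classical.choose_spec hr.exists_filter_dare

theorem Regular.posSemidef_SigNu (hr : sys.Regular p) : sys.SigNu.PosSemidef := by
  have h1 : (sys.C * sys.Sigt * sys.Cᵀ + sys.V).PosSemidef := by
    have := posSemidef_conj hr.isStabilizing_Sigt.posSemidef sys.Cᵀ
    rw [transpose_transpose] at this
    exact this.add hr.posDef_V.posSemidef
  have := posSemidef_conj h1 sys.Lᵀ
  rwa [transpose_transpose] at this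

theorem Regular.posSemidef_Qt (hr : sys.Regular p) : sys.Qt.PosSemidef :=
  posSemidef_conj hr.posSemidef_Q sys.C

/-- Full row rank makes the Gram matrix invertible. Hence every state feedback H is realised by a
lifted gain, namely H S⋆, so lifting loses no freedom. -/
theorem Regular.Sstar_mul_Sdag (hr : sys.Regular p) : sys.Sstar p * sys.Sdag p = 1 := by
  have h1 : (sys.Sstar p * (sys.Sstar p)ᵀ).rank = nx := by
    rw [rank_self_mul_transpose, hr.rank_Sstar]
  have h2 : IsUnit (sys.Sstar p * (sys.Sstar p)ᵀ) := by
    rw [← mulVec_surjective_iff_isUnit]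
    rw [rank] at h1
    have h3 := Submodule.eq_top_of_finrank_eq (h1.trans (by simp :
      nx = Module.finrank ℝ (Fin nx → ℝ)))
    exact LinearMap.range_eq_top.1 h3
  rw [Sdag, ← Matrix.mul_assoc]
  exact mul_nonsing_inv _ ((isUnit_iff_isUnit_det _).1 h2)

theorem Regular.KtStar_mul_Sdag (hr : sys.Regular p) :
    sys.KtStar p * sys.Sdag p = sys.Kstar := by
  rw [KtStar, Matrix.mul_assoc, hr.Sstar_mul_Sdag, Matrix.mul_one]

theorem closedLoop_eq (K : Gain nu ny p) :
    sys.closedLoop K = sys.A + sys.B * (K * sys.Sdag p) := by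
  rw [closedLoop, Matrix.mul_assoc]

/-- The weight `R + Bᵀ P⋆ B` at the optimum. -/
noncomputable def Rhat (sys : System nx nu ny) : Matrix (Fin nu) (Fin nu) ℝ :=
  sys.R + sys.Bᵀ * sys.Pstar * sys.B

theorem Regular.posDef_Rhat (hr : sys.Regular p) : sys.Rhat.PosDef :=
  hr.posDef_R.add_posSemidef (posSemidef_conj hr.isStabilizing_Pstar.posSemidef sys.B)

theorem Regular.R_transpose (hr : sys.Regular p) : sys.Rᵀ = sys.R :=
  posSemidef_transpose_eq hr.posDef_R.posSemidef

theorem Regular.Rhat_mul_Kstar (hr : sys.Regular p) :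
    sys.Rhat * sys.Kstar = -(sys.Bᵀ * sys.Pstar * sys.A) := by
  have h := (isUnit_iff_isUnit_det _).1 hr.posDef_Rhat.isUnit
  rw [Kstar, Matrix.mul_neg]
  change -(sys.Rhat * (sys.Rhat⁻¹ * sys.Bᵀ * sys.Pstar * sys.A)) = _
  simp only [← Matrix.mul_assoc]
  rw [mul_nonsing_inv _ h, Matrix.one_mul]

theorem Regular.gradient_Kstar (hr : sys.Regular p) :
    sys.R * sys.Kstar + sys.Bᵀ * sys.Pstar * (sys.A + sys.B * sys.Kstar) = 0 := by
  have h := hr.Rhat_mul_Kstar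
  rw [Rhat, Matrix.add_mul] at h
  rw [Matrix.mul_add, add_comm (sys.Bᵀ * sys.Pstar * sys.A), ← add_assoc,
    ← Matrix.mul_assoc _ sys.B, h, neg_add_cancel]

theorem Regular.isSchurStable_Kstar (hr : sys.Regular p) :
    IsSchurStable (sys.A + sys.B * sys.Kstar) := by
  have := hr.isStabilizing_Pstar.stable
  rwa [sub_eq_add_neg, ← Matrix.mul_neg] at this

/-- The Riccati equation in closed-loop form: expanding leaves a term K⋆ᵀ(R K⋆ + Bᵀ P (A + B K⋆)),
which vanishes by stationarity of K⋆. -/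
theorem Regular.Pstar_eq (hr : sys.Regular p) :
    sys.Pstar = sys.Qt + sys.Kstarᵀ * sys.R * sys.Kstar +
      (sys.A + sys.B * sys.Kstar)ᵀ * sys.Pstar * (sys.A + sys.B * sys.Kstar) := by
  have hd := hr.isStabilizing_Pstar.equation
  have hg := hr.gradient_Kstar
  have h1 : sys.Kstarᵀ * sys.R * sys.Kstar +
      (sys.A + sys.B * sys.Kstar)ᵀ * sys.Pstar * (sys.A + sys.B * sys.Kstar) =
      sys.Aᵀ * sys.Pstar * (sys.A + sys.B * sys.Kstar) + sys.Kstarᵀ *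
        (sys.R * sys.Kstar + sys.Bᵀ * sys.Pstar * (sys.A + sys.B * sys.Kstar)) := by
    simp only [transpose_add, transpose_mul, Matrix.mul_add, Matrix.add_mul, Matrix.mul_assoc]
    abel
  rw [add_assoc, h1, hg, Matrix.mul_zero, add_zero]
  conv_lhs => rw [hd]
  rw [Kstar]
  simp only [Matrix.mul_add, Matrix.mul_neg, Matrix.mul_assoc]
  abel

theorem P_eq {K : Gain nu ny p} (hK : K ∈ sys.stabilizing p) :
    sys.P K = sys.Qt + (K * sys.Sdag p)ᵀ * sys.R * (K * sys.Sdag p) +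
      (sys.closedLoop K)ᵀ * sys.P K * sys.closedLoop K := by
  have h := IsSchurStable.dlyap_eq hK
    (sys.Qt + (sys.Sdag p).transpose * K.transpose * sys.R * K * sys.Sdag p)
  rw [transpose_mul, ← Matrix.mul_assoc _ K]
  exact h

theorem Sig_eq {K : Gain nu ny p} (hK : K ∈ sys.stabilizing p) :
    sys.Sig K = sys.SigNu + sys.closedLoop K * sys.Sig K * (sys.closedLoop K)ᵀ := by
  have h := (IsSchurStable.transpose hK).dlyap_eq sys.SigNu
  rw [transpose_transpose] at h
  exact h

theorem Regular.posSemidef_Sig (hr : sys.Regular p) {K : Gain nu ny p}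
    (hK : K ∈ sys.stabilizing p) : (sys.Sig K).PosSemidef :=
  (IsSchurStable.transpose hK).posSemidef_dlyap hr.posSemidef_SigNu

theorem Regular.posSemidef_P (hr : sys.Regular p) {K : Gain nu ny p}
    (hK : K ∈ sys.stabilizing p) : (sys.P K).PosSemidef := by
  refine IsSchurStable.posSemidef_dlyap hK (hr.posSemidef_Qt.add ?_)
  have := posSemidef_conj hr.posDef_R.posSemidef (K * sys.Sdag p)
  rwa [transpose_mul, ← Matrix.mul_assoc _ K] at this

theorem Regular.KtStar_mem (hr : sys.Regular p) : sys.KtStar p ∈ sys.stabilizing p := by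
  change IsSchurStable _
  rw [closedLoop_eq, hr.KtStar_mul_Sdag]
  exact hr.isSchurStable_Kstar

theorem Regular.P_KtStar (hr : sys.Regular p) : sys.P (sys.KtStar p) = sys.Pstar := by
  refine (IsSchurStable.eq_dlyap hr.KtStar_mem ?_).symm
  have := hr.Pstar_eq
  rwa [← hr.KtStar_mul_Sdag, ← closedLoop_eq, transpose_mul, ← Matrix.mul_assoc _ (sys.KtStar p)]
    at this

/-- The natural gradient factor `E = R F + Bᵀ P M` at the state feedback `F = K̃ S⋆†`. -/
noncomputable def natGrad (sys : System nx nu ny) (K : Gain nu ny p) :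
    Matrix (Fin nu) (Fin nx) ℝ :=
  sys.R * (K * sys.Sdag p) + sys.Bᵀ * sys.P K * sys.closedLoop K

theorem Regular.natGrad_KtStar (hr : sys.Regular p) : sys.natGrad (sys.KtStar p) = 0 := by
  rw [natGrad, hr.P_KtStar, closedLoop_eq, hr.KtStar_mul_Sdag]
  exact hr.gradient_Kstar

/-- By duality both costs become traces against Σ_{K'}, and the difference is the one-step increment
of `cost_increment` weighted by Σ_{K'}. No remainder occurs. The formula is used with K optimal
(gap), with K' optimal (gradient domination) and with K' near K (gradient). -/
theorem Regular.J_sub_J (hr : sys.Regular p) {K K' : Gain nu ny p} (hK : K ∈ sys.stabilizing p)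
    (hK' : K' ∈ sys.stabilizing p) :
    sys.J K' - sys.J K =
      (((K' - K) * sys.Sdag p)ᵀ * (sys.R + sys.Bᵀ * sys.P K * sys.B) *
        ((K' - K) * sys.Sdag p) * sys.Sig K').trace +
      2 * (((K' - K) * sys.Sdag p)ᵀ * sys.natGrad K * sys.Sig K').trace := by
  have hP := posSemidef_transpose_eq (hr.posSemidef_P hK)
  have hS := posSemidef_transpose_eq (hr.posSemidef_Sig hK')
  have h1 := trace_lyap_duality (X := sys.P K') (sys.Sig_eq hK')
  have h2 := trace_lyap_duality (X := sys.P K) (sys.Sig_eq hK')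
  have h3 : sys.J K' - sys.J K = (sys.P K' * sys.SigNu).trace - (sys.P K * sys.SigNu).trace := by
    simp only [J]; ring
  have h4 : sys.P K' - (sys.closedLoop K')ᵀ * sys.P K' * sys.closedLoop K' =
      sys.Qt + (K' * sys.Sdag p)ᵀ * sys.R * (K' * sys.Sdag p) := by
    rw [sub_eq_iff_eq_add]; exact P_eq hK'
  have hF : K' * sys.Sdag p = K * sys.Sdag p + (K' - K) * sys.Sdag p := by
    rw [← Matrix.add_mul, add_sub_cancel]
  have h5 := cost_increment sys.A sys.Qt (sys.P K) sys.B sys.R (K * sys.Sdag p)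
    ((K' - K) * sys.Sdag p) hP hr.R_transpose
  rw [← hF, ← closedLoop_eq, ← closedLoop_eq, ← P_eq hK] at h5
  rw [h3, h1, h2, h4, ← trace_sub, ← Matrix.sub_mul, sub_sub_eq_add_sub, ← natGrad] at *
  rw [h5, Matrix.add_mul, Matrix.add_mul, trace_add, trace_add,
    trace_transpose_mul_mul_of_symm (E := sys.natGrad K) hS]
  ring

theorem Regular.J_sub_J_KtStar (hr : sys.Regular p) {K : Gain nu ny p}
    (hK : K ∈ sys.stabilizing p) :
    sys.J K - sys.J (sys.KtStar p) = ((K * sys.Sdag p - sys.Kstar)ᵀ * sys.Rhat *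
      (K * sys.Sdag p - sys.Kstar) * sys.Sig K).trace := by
  rw [hr.J_sub_J hr.KtStar_mem hK, hr.natGrad_KtStar, hr.P_KtStar, Matrix.sub_mul,
    hr.KtStar_mul_Sdag]
  simp [Rhat]

theorem Regular.J_KtStar_le (hr : sys.Regular p) {K : Gain nu ny p}
    (hK : K ∈ sys.stabilizing p) : sys.J (sys.KtStar p) ≤ sys.J K := by
  rw [← sub_nonneg, hr.J_sub_J_KtStar hK]
  exact trace_mul_nonneg (posSemidef_conj hr.posDef_Rhat.posSemidef _) (hr.posSemidef_Sig hK)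

end System

end LQG

/-! ### The gradient, gradient domination and a covariance bound. -/

namespace LQG

open Matrix

/-- The difference quotient is g itself, so continuity of g suffices. The covariance therefore never
has to be differentiated. -/
theorem hasDerivAt_of_eq_add_mul {f g : ℝ → ℝ} (hg : ContinuousAt g 0)
    (h : ∀ᶠ t in 𝓝 (0 : ℝ), f t = f 0 + t * g t) : HasDerivAt f (g 0) 0 := by
  rw [hasDerivAt_iff_tendsto_slope]
  refine (hg.tendsto.mono_left nhdsWithin_le_nhds).congr' ?_
  filter_upwards [nhdsWithin_le_nhds h, self_mem_nhdsWithin] with t ht ht0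
  rw [slope_def_field, ht]
  have : t ≠ 0 := ht0
  field_simp
  ring

theorem frobNorm_mul_transpose_sq_le {m n l : Type*} [Fintype m] [Fintype n] [Fintype l]
    [DecidableEq n] [DecidableEq l] (X : Matrix m n ℝ) (S : Matrix l n ℝ) :
    frobNorm (X * Sᵀ) ^ 2 ≤ specNorm S ^ 2 * frobNorm X ^ 2 := by
  have h1 := trace_mul_le_trace_mul (posSemidef_specNorm_sq_sub S) (posSemidef_gram X)
  rw [Matrix.smul_mul, Matrix.one_mul, trace_smul, trace_transpose_mul, ← frobNorm_sq] at h1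
  refine le_trans (le_of_eq ?_) h1
  rw [frobNorm_sq, ← trace_transpose_mul, trace_mul_comm, transpose_mul, transpose_transpose,
    Matrix.mul_assoc, trace_mul_comm]
  simp only [Matrix.mul_assoc]

theorem minSing_sq_mul_frobNorm_sq_le {m : Type*} [Fintype m] {k : ℕ} (E : Matrix m (Fin k) ℝ)
    {X : Matrix (Fin k) (Fin k) ℝ} (hX : Xᵀ = X) :
    minSing X ^ 2 * frobNorm E ^ 2 ≤ frobNorm (E * X) ^ 2 := by
  have h1 := trace_mul_le_trace_mul (posSemidef_sub_minSing_sq X) (posSemidef_gram E)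
  rw [Matrix.smul_mul, Matrix.one_mul, trace_smul, trace_transpose_mul, ← frobNorm_sq] at h1
  refine h1.trans (le_of_eq ?_)
  rw [frobNorm_sq, ← trace_transpose_mul, trace_mul_comm (E * X)ᵀ, transpose_mul, hX,
    Matrix.mul_assoc E, trace_mul_comm E]
  simp only [Matrix.mul_assoc]

theorem frobInner_single {m n : Type*} [Fintype m] [Fintype n] [DecidableEq m] [DecidableEq n]
    (i : m) (j : n) (X : Matrix m n ℝ) : frobInner (Matrix.single i j 1) X = X i j := by
  simp [frobInner, Matrix.single_apply, ite_and, Finset.sum_ite_eq]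

theorem trace_transpose_mul_mul_eq_frobInner {m n l : Type*} [Fintype m] [Fintype n] [Fintype l]
    (D : Matrix m n ℝ) (S : Matrix n l ℝ) (E : Matrix m l ℝ) (X : Matrix l l ℝ) :
    ((D * S)ᵀ * E * X).trace = frobInner D (E * X * Sᵀ) := by
  rw [← trace_transpose_mul, transpose_mul, Matrix.mul_assoc, Matrix.mul_assoc, trace_mul_comm]
  simp only [Matrix.mul_assoc]

theorem frobInner_smul {m n : Type*} [Fintype m] [Fintype n] (c : ℝ) (X Y : Matrix m n ℝ) :
    frobInner X (c • Y) = c * frobInner X Y := by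
  simp only [frobInner, Matrix.smul_apply, smul_eq_mul, Finset.mul_sum]
  exact Finset.sum_congr rfl fun i _ => Finset.sum_congr rfl fun j _ => by ring

namespace System

variable {nx nu ny : ℕ} {sys : System nx nu ny} {p : ℕ}

theorem continuous_closedLoop :
    Continuous (sys.closedLoop : Gain nu ny p → Matrix (Fin nx) (Fin nx) ℝ) := by
  unfold closedLoop
  fun_prop

theorem isOpen_stabilizing : IsOpen (sys.stabilizing p) :=
  isOpen_isSchurStable.preimage continuous_closedLoop

theorem continuousAt_Sig {K : Gain nu ny p} (hK : K ∈ sys.stabilizing p) :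
    ContinuousAt (fun K : Gain nu ny p => sys.Sig K) K :=
  ContinuousAt.comp (f := fun K : Gain nu ny p => (sys.closedLoop K)ᵀ)
    (g := fun M => dlyap M sys.SigNu)
    ((IsSchurStable.transpose hK).continuousAt_dlyap sys.SigNu)
    (continuous_closedLoop.matrix_transpose.continuousAt)

/-- The exact difference formula between K and K + tD has the form t g(t), where g involves only
Σ_{K+tD}, which is continuous in t. -/
theorem Regular.hasDerivAt_J_aux (hr : sys.Regular p) {K : Gain nu ny p}
    (hK : K ∈ sys.stabilizing p) (D : Gain nu ny p) :
    HasDerivAt (fun t : ℝ => sys.J (K + t • D))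
      (2 * ((D * sys.Sdag p)ᵀ * sys.natGrad K * sys.Sig K).trace) 0 := by
  have hcl : Continuous fun t : ℝ => K + t • D := by fun_prop
  have h0 : K + (0 : ℝ) • D = K := by simp
  have hS : ContinuousAt (fun t : ℝ => sys.Sig (K + t • D)) 0 :=
    ContinuousAt.comp (g := fun K : Gain nu ny p => sys.Sig K) (by rw [h0]; exact continuousAt_Sig hK)
      hcl.continuousAt
  set T := (D * sys.Sdag p)ᵀ * (sys.R + sys.Bᵀ * sys.P K * sys.B) * (D * sys.Sdag p)
  have hm : ∀ X : Matrix (Fin nx) (Fin nx) ℝ,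
      ContinuousAt (fun t : ℝ => (X * sys.Sig (K + t • D)).trace) 0 := fun X => by
    have : Continuous fun Z : Matrix (Fin nx) (Fin nx) ℝ => (X * Z).trace := by fun_prop
    exact this.continuousAt.comp hS
  have hg : ContinuousAt (fun t : ℝ => t * (T * sys.Sig (K + t • D)).trace +
      2 * ((D * sys.Sdag p)ᵀ * sys.natGrad K * sys.Sig (K + t • D)).trace) 0 :=
    (continuousAt_id.mul (hm T)).add (continuousAt_const.mul (hm _))
  have := hasDerivAt_of_eq_add_mul (f := fun t : ℝ => sys.J (K + t • D)) hg ?_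
  · simpa using this
  · have hev : ∀ᶠ t in 𝓝 (0 : ℝ), K + t • D ∈ sys.stabilizing p :=
      hcl.continuousAt.eventually_mem (isOpen_stabilizing.mem_nhds (by rwa [h0]))
    filter_upwards [hev] with t ht
    have h1 := hr.J_sub_J hK ht
    rw [add_sub_cancel_left, sub_eq_iff_eq_add] at h1
    rw [h1, h0]
    simp only [Matrix.smul_mul, Matrix.mul_smul, transpose_smul, trace_smul, smul_eq_mul, T]
    ring

theorem Regular.gradJ_eq (hr : sys.Regular p) {K : Gain nu ny p} (hK : K ∈ sys.stabilizing p) :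
    sys.gradJ K = (2 : ℝ) • (sys.natGrad K * sys.Sig K * (sys.Sdag p)ᵀ) := by
  ext i j
  have h := HasLineDerivAt.lineDeriv (𝕜 := ℝ) (f := fun X : Gain nu ny p => sys.J X)
    (hr.hasDerivAt_J_aux hK (Matrix.single i j 1))
  rw [gradJ, Matrix.of_apply, h, trace_transpose_mul_mul_eq_frobInner, frobInner_single,
    Matrix.smul_apply, smul_eq_mul]

theorem Regular.hasDerivAt_J (hr : sys.Regular p) {K : Gain nu ny p}
    (hK : K ∈ sys.stabilizing p) (D : Gain nu ny p) :
    HasDerivAt (fun t : ℝ => sys.J (K + t • D)) (frobInner D (sys.gradJ K)) 0 := by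
  convert hr.hasDerivAt_J_aux hK D using 1
  rw [hr.gradJ_eq hK, trace_transpose_mul_mul_eq_frobInner, frobInner_smul]

theorem Regular.hasDerivAt_J_line (hr : sys.Regular p) {K D : Gain nu ny p} {s : ℝ}
    (hK : K + s • D ∈ sys.stabilizing p) :
    HasDerivAt (fun t : ℝ => sys.J (K + t • D)) (frobInner D (sys.gradJ (K + s • D))) s := by
  have h := hr.hasDerivAt_J hK D
  have h2 : HasDerivAt (fun t : ℝ => t - s) 1 s := (hasDerivAt_id s).sub_const s
  have h3 := HasDerivAt.comp s (by rwa [← sub_self s] at h) h2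
  rw [mul_one] at h3
  refine h3.congr_of_eventuallyEq (Eventually.of_forall fun t => ?_)
  simp only [Function.comp]
  congr 1
  rw [add_assoc, ← add_smul, add_sub_cancel]

/-- Let E be the natural gradient factor. The difference formula towards the optimum, with R + Bᵀ P
B ≥ σ(R), bounds σ(R) times the gap by tr(EᵀE Σ⋆) after completing the square. Then E is recovered
from the gradient by inverting S⋆†ᵀ and Σ_K. Multiplying by σ(R) and σ(Σ_K)² instead of dividing
admits their being zero. -/
theorem Regular.gradient_domination (hr : sys.Regular p) {K : Gain nu ny p}
    (hK : K ∈ sys.stabilizing p) :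
    4 * minSing sys.R * minSing (sys.Sig K) ^ 2 * (sys.J K - sys.J (sys.KtStar p)) ≤
      specNorm (sys.Sig (sys.KtStar p)) * specNorm (sys.Sstar p) ^ 2 *
        frobNorm (sys.gradJ K) ^ 2 := by
  set r := minSing sys.R with hrdef
  set E := sys.natGrad K with hE
  set Ss := sys.Sig (sys.KtStar p) with hSs
  have hr0 : 0 ≤ r := minSing_nonneg _
  have hSsp : Ss.PosSemidef := hr.posSemidef_Sig hr.KtStar_mem
  -- the gap is controlled by the natural gradient
  have h1 : r * (sys.J K - sys.J (sys.KtStar p)) ≤ specNorm Ss * frobNorm E ^ 2 := by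
    have h2 := hr.J_sub_J hK hr.KtStar_mem
    set D := (sys.KtStar p - K) * sys.Sdag p
    have h3 : (sys.R + sys.Bᵀ * sys.P K * sys.B - r • 1).PosSemidef := by
      have := (posSemidef_sub_minSing hr.posDef_R.posSemidef).add
        (posSemidef_conj (hr.posSemidef_P hK) sys.B)
      rwa [sub_add_eq_add_sub] at this
    have h4 := trace_mul_nonneg (posSemidef_conj h3 D) hSsp
    -- This square is the completion: it bounds -r² tr(DᵀDΣ⋆) - 2r tr(DᵀEΣ⋆) by tr(EᵀEΣ⋆).
    have h5 := trace_mul_nonneg (posSemidef_gram (r • D + E)) hSsp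
    have h6 := trace_mul_le_trace_mul
      (posSemidef_specNorm_sub (posSemidef_transpose_eq hSsp)) (posSemidef_gram E)
    rw [Matrix.smul_mul, Matrix.one_mul, trace_smul, trace_transpose_mul, ← frobNorm_sq,
      smul_eq_mul, trace_mul_comm] at h6
    have h7 := trace_transpose_mul_mul_of_symm (E := E) (D := D) (posSemidef_transpose_eq hSsp)
    simp only [Matrix.mul_sub, Matrix.sub_mul, Matrix.mul_smul, Matrix.smul_mul, Matrix.mul_one,
      trace_sub, trace_smul, smul_eq_mul] at h4
    simp only [transpose_add, transpose_smul, Matrix.add_mul, Matrix.mul_add, Matrix.mul_smul,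
      Matrix.smul_mul, trace_add, trace_smul, smul_eq_mul] at h5
    rw [h7] at h5
    nlinarith [mul_le_mul_of_nonneg_left h4 hr0]
  -- Since S⋆ S⋆† = 1, right multiplication by S⋆ᵀ undoes the factor S⋆†ᵀ of the gradient, at the
  -- price of ‖S⋆‖².
  have h8 : E * sys.Sig K = (E * sys.Sig K * (sys.Sdag p)ᵀ) * (sys.Sstar p)ᵀ := by
    rw [Matrix.mul_assoc _ (sys.Sdag p)ᵀ, ← transpose_mul, hr.Sstar_mul_Sdag, transpose_one,
      Matrix.mul_one]
  have h9 := frobNorm_mul_transpose_sq_le (E * sys.Sig K * (sys.Sdag p)ᵀ) (sys.Sstar p)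
  rw [← h8] at h9
  have h10 := minSing_sq_mul_frobNorm_sq_le E (posSemidef_transpose_eq (hr.posSemidef_Sig hK))
  rw [hr.gradJ_eq hK, frobNorm_smul, mul_pow]
  norm_num
  calc 4 * r * minSing (sys.Sig K) ^ 2 * (sys.J K - sys.J (sys.KtStar p))
      = 4 * minSing (sys.Sig K) ^ 2 * (r * (sys.J K - sys.J (sys.KtStar p))) := by ring
    _ ≤ 4 * minSing (sys.Sig K) ^ 2 * (specNorm Ss * frobNorm E ^ 2) :=
        mul_le_mul_of_nonneg_left h1 (by positivity)
    _ = 4 * specNorm Ss * (minSing (sys.Sig K) ^ 2 * frobNorm E ^ 2) := by ring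
    _ ≤ 4 * specNorm Ss * (specNorm (sys.Sstar p) ^ 2 *
          frobNorm (E * sys.Sig K * (sys.Sdag p)ᵀ) ^ 2) :=
        mul_le_mul_of_nonneg_left (h10.trans h9)
          (mul_nonneg (by norm_num) (specNorm_nonneg _))
    _ = _ := by ring

/-- The state covariance is bounded on sublevel sets of the cost. -/
theorem Regular.exists_trace_Sig_le (hr : sys.Regular p) : ∃ a b : ℝ, 0 ≤ b ∧
    ∀ K ∈ sys.stabilizing p,
      (sys.Sig K).trace ≤ a + b * (sys.J K - sys.J (sys.KtStar p)) := by
  set As := sys.A + sys.B * sys.Kstar with hAs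
  have hst : IsSchurStable As := hr.isSchurStable_Kstar
  set X := dlyap As 1 with hX
  have hXeq : X = 1 + Asᵀ * X * As := hst.dlyap_eq 1
  have hXp : X.PosSemidef := hst.posSemidef_dlyap PosSemidef.one
  have hXt := posSemidef_transpose_eq hXp
  -- X is a Lyapunov function of the optimal loop with unit decrease. With εX ≤ 1/2, half of that
  -- decrease absorbs the ε-part of Young's inequality below.
  obtain ⟨ε, hε, hεX⟩ : ∃ ε : ℝ, 0 < ε ∧ ((1 / 2 : ℝ) • 1 - ε • X).PosSemidef := by
    have h0 := specNorm_nonneg X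
    refine ⟨(2 * (specNorm X + 1))⁻¹, by positivity, ?_⟩
    have h1 : ((specNorm X + 1) • (1 : Matrix (Fin nx) (Fin nx) ℝ) - X).PosSemidef := by
      have := (posSemidef_specNorm_sub hXt).add PosSemidef.one
      rw [add_smul, one_smul, add_sub_right_comm]
      exact this
    have h2 := h1.smul (show (0 : ℝ) ≤ (2 * (specNorm X + 1))⁻¹ by positivity)
    rw [smul_sub, smul_smul] at h2
    convert h2 using 3
    field_simp
  -- R̂ weights the deviation D in the gap formula, so this comparison turns the BᵀXB cost of D into
  -- a multiple of the gap.
  obtain ⟨c, hc, hcR⟩ : ∃ c : ℝ, 0 ≤ c ∧ (c • sys.Rhat - sys.Bᵀ * X * sys.B).PosSemidef := by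
    have hY := posSemidef_conj hXp sys.B
    set Y := sys.Bᵀ * X * sys.B
    have h1 := posSemidef_specNorm_sub (posSemidef_transpose_eq hY)
    have h2 := posSemidef_sub_minSing hr.posDef_Rhat.posSemidef
    rcases Nat.eq_zero_or_pos nu with rfl | hnu
    · refine ⟨0, le_rfl, ?_⟩
      convert (PosSemidef.zero : (0 : Matrix (Fin 0) (Fin 0) ℝ).PosSemidef) using 1
      exact Subsingleton.elim _ _
    · have h3 := minSing_pos hnu hr.posDef_Rhat
      have h4 : 0 ≤ specNorm Y / minSing sys.Rhat := div_nonneg (specNorm_nonneg _) h3.le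
      refine ⟨_, h4, ?_⟩
      have h5 := (h2.smul h4).add h1
      rw [smul_sub, smul_smul, div_mul_cancel₀ _ h3.ne', sub_add_sub_cancel] at h5
      exact h5
  refine ⟨2 * (X * sys.SigNu).trace, 2 * ((1 + ε⁻¹) * c), by positivity, fun K hK => ?_⟩
  have hS := hr.posSemidef_Sig hK
  set D := K * sys.Sdag p - sys.Kstar with hD
  have hM : sys.closedLoop K = As + sys.B * D := by
    rw [closedLoop_eq, hAs, hD, Matrix.mul_sub]; abel
  have h1 := trace_lyap_duality (X := X) (sys.Sig_eq hK)
  -- Positivity of this square is Young's inequality for the cross terms of (As + BD)ᵀ X (As + BD).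
  have h2 := trace_mul_nonneg (posSemidef_conj hXp (ε • As - sys.B * D)) hS
  have h3 := trace_mul_nonneg hεX hS
  have h4 := trace_mul_nonneg (posSemidef_conj hcR D) hS
  have h5 := hr.J_sub_J_KtStar hK
  rw [← hD] at h5
  have hXX : (X * sys.Sig K).trace = (sys.Sig K).trace + (Asᵀ * X * As * sys.Sig K).trace := by
    conv_lhs => rw [hXeq]
    rw [Matrix.add_mul, Matrix.one_mul, trace_add]
  rw [hM] at h1
  simp only [transpose_add, transpose_sub, transpose_smul, transpose_mul, Matrix.mul_sub,
    Matrix.sub_mul, Matrix.add_mul, Matrix.mul_add, Matrix.mul_smul, Matrix.smul_mul,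
    Matrix.one_mul, trace_sub, trace_add, trace_smul, smul_eq_mul, Matrix.mul_assoc] at h1 h2 h3 h4 h5 hXX
  set J' := sys.J K - sys.J (sys.KtStar p)
  set t := (sys.Sig K).trace
  set q := (Asᵀ * (X * (As * sys.Sig K))).trace
  set u := (Asᵀ * (X * (sys.B * (D * sys.Sig K)))).trace
  set v := (Dᵀ * (sys.Bᵀ * (X * (As * sys.Sig K)))).trace
  set w := (Dᵀ * (sys.Bᵀ * (X * (sys.B * (D * sys.Sig K))))).trace
  rw [← h5] at h4
  have h6 : u + v ≤ ε * q + ε⁻¹ * w := by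
    have : 0 ≤ ε⁻¹ * (ε * (ε * q) - ε * v - (ε * u - w)) := mul_nonneg (by positivity) (by linarith)
    have e1 : ε⁻¹ * (ε * (ε * q) - ε * v - (ε * u - w)) = ε * q - v - u + ε⁻¹ * w := by
      field_simp; ring
    linarith
  have h7 : (1 + ε⁻¹) * w ≤ (1 + ε⁻¹) * (c * J') :=
    mul_le_mul_of_nonneg_left (by linarith) (by positivity)
  have h8 : 0 ≤ ε * t := mul_nonneg hε.le hS.trace_nonneg
  rw [hXX, mul_add] at h3
  rw [hXX] at h1
  linarith

end System

end LQG

namespace LQG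

open Matrix

/-! ### Controllability, excitation of modes and Heymann's lemma. -/

section Controllability

variable {n m : ℕ}

/-- The complexification of a real vector. -/
noncomputable abbrev cvec {ι : Type*} (b : ι → ℝ) : ι → ℂ := fun i => (b i : ℂ)

theorem IsControllable.eq_top {A : Matrix (Fin n) (Fin n) ℝ} {B : Matrix (Fin n) (Fin m) ℝ}
    (h : IsControllable A B) (W : Submodule ℝ (Fin n → ℝ))
    (hW : ∀ (k : ℕ) (u : Fin m → ℝ), (A ^ k * B) *ᵥ u ∈ W) : W = ⊤ := by
  rw [IsControllable, rank] at h
  have h3 := LinearMap.range_eq_top.1 (Submodule.eq_top_of_finrank_eq (h.trans (by simp :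
      n = Module.finrank ℝ (Fin n → ℝ))))
  refine Submodule.eq_top_iff'.2 fun y => ?_
  obtain ⟨w, rfl⟩ := h3 y
  have : (Matrix.of fun (i : Fin n) (kj : Fin n × Fin m) => (A ^ (kj.1 : ℕ) * B) i kj.2) *ᵥ w =
      ∑ k : Fin n, (A ^ (k : ℕ) * B) *ᵥ fun j => w (k, j) := by
    ext i
    simp [mulVec, dotProduct, Fintype.sum_prod_type]
  rw [mulVecLin_apply, this]
  exact Submodule.sum_mem _ fun k _ => hW k _

theorem cmat_mul {l : ℕ} (X : Matrix (Fin n) (Fin m) ℝ) (Y : Matrix (Fin m) (Fin l) ℝ) :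
    cmat (X * Y) = cmat X * cmat Y := Matrix.map_mul

theorem cmat_add (X Y : Matrix (Fin n) (Fin m) ℝ) : cmat (X + Y) = cmat X + cmat Y :=
  by
  ext i j; simp

/-- Popov–Belevitch–Hautus: no left eigenvector of a closed loop is annihilated by `B`. -/
theorem IsControllable.vecMul_ne_zero {A : Matrix (Fin n) (Fin n) ℝ}
    {B : Matrix (Fin n) (Fin m) ℝ} (h : IsControllable A B) {F : Matrix (Fin m) (Fin n) ℝ} {μ : ℂ}
    {v : Fin n → ℂ} (hv : IsLeftEigen (A + B * F) μ v) : v ᵥ* cmat B ≠ 0 := by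
  intro h0
  have hA : IsLeftEigen A μ v := by
    refine ⟨hv.1, ?_⟩
    have := hv.2
    rwa [cmat_add, cmat_mul, vecMul_add, ← vecMul_vecMul, h0, zero_vecMul, add_zero] at this
  have hk : ∀ k : ℕ, v ᵥ* cmat (A ^ k * B) = 0 := fun k => by
    rw [cmat_mul, ← vecMul_vecMul, (isLeftEigen_pow hA k).2, smul_vecMul, h0, smul_zero]
  -- Pairing with v is taken as a real-linear map on real vectors. Its kernel contains the reachable
  -- space, hence everything, which forces v = 0.
  let φ : (Fin n → ℝ) →ₗ[ℝ] ℂ :=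
    { toFun := fun y => v ⬝ᵥ cvec y
      map_add' := fun y z => by
        rw [← dotProduct_add]; congr 1; ext i; simp [cvec]
      map_smul' := fun c y => by
        simp only [RingHom.id_apply, dotProduct, Finset.smul_sum, Complex.real_smul]
        refine Finset.sum_congr rfl fun i _ => ?_
        simp only [cvec, Pi.smul_apply, smul_eq_mul, Complex.ofReal_mul]; ring }
  have htop := h.eq_top (LinearMap.ker φ) fun k u => by
    rw [LinearMap.mem_ker]
    change v ⬝ᵥ cvec ((A ^ k * B) *ᵥ u) = 0
    have : cvec ((A ^ k * B) *ᵥ u) = cmat (A ^ k * B) *ᵥ cvec u := by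
      ext i; simp [cvec, mulVec, dotProduct]
    rw [this, dotProduct_mulVec, hk, zero_dotProduct]
  refine hv.1 (funext fun i => ?_)
  have h1 : (Pi.single i 1 : Fin n → ℝ) ∈ LinearMap.ker φ := by rw [htop]; trivial
  have h2 : v ⬝ᵥ cvec (Pi.single i 1 : Fin n → ℝ) = 0 := h1
  have h3 : cvec (Pi.single i 1 : Fin n → ℝ) = Pi.single i 1 := by
    ext j; by_cases hj : j = i
    · subst hj; simp [cvec]
    · simp [cvec, Pi.single_eq_of_ne hj]
  rw [h3] at h2
  simpa using h2

/-- The Krylov matrix `[b  Mb  ⋯  M^{n-1}b]`. -/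
def krylov {R : Type*} [CommRing R] (M : Matrix (Fin n) (Fin n) R) (b : Fin n → R) :
    Matrix (Fin n) (Fin n) R :=
  Matrix.of fun i k => (M ^ (k : ℕ) *ᵥ b) i

/-- Noise entering along `b` excites every mode of `M`. -/
def Excites (M : Matrix (Fin n) (Fin n) ℝ) (b : Fin n → ℝ) : Prop :=
  ∀ μ v, IsLeftEigen M μ v → v ⬝ᵥ cvec b ≠ 0

/-- A left eigenvector orthogonal to b is orthogonal to every M^k b, hence annihilates the Krylov
matrix. -/
theorem excites_of_det_krylov_ne_zero {M : Matrix (Fin n) (Fin n) ℝ} {b : Fin n → ℝ}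
    (h : (krylov M b).det ≠ 0) : Excites M b := by
  intro μ v hv h0
  refine h ?_
  have h1 : (cmat (krylov M b)).det = 0 := by
    refine exists_vecMul_eq_zero_iff.1 ⟨v, hv.1, ?_⟩
    ext k
    have h2 : v ⬝ᵥ (cmat (M ^ (k : ℕ)) *ᵥ cvec b) = 0 := by
      rw [dotProduct_mulVec, (isLeftEigen_pow hv k).2, smul_dotProduct, h0, smul_zero]
    refine Eq.trans ?_ h2
    simp [cvec, vecMul, dotProduct, krylov, mulVec]
  have h3 : (cmat (krylov M b)).det = ((krylov M b).det : ℂ) :=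
    (RingHom.map_det (algebraMap ℝ ℂ) (krylov M b)).symm
  rw [h3] at h1
  exact_mod_cast h1

/-- The determinant is a polynomial in s that is nonzero at s = 1, so it has finitely many roots; s
= 0 may be one of them, whence the punctured neighbourhood. -/
theorem eventually_det_krylov_ne_zero {M N : Matrix (Fin n) (Fin n) ℝ} {b : Fin n → ℝ}
    (h : (krylov (M + N) b).det ≠ 0) : ∀ᶠ s in 𝓝[≠] (0 : ℝ), (krylov (M + s • N) b).det ≠ 0 := by
  let Mp : Matrix (Fin n) (Fin n) (Polynomial ℝ) :=
    M.map Polynomial.C + (Polynomial.X : Polynomial ℝ) • N.map Polynomial.C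
  let q : Polynomial ℝ := (krylov Mp fun i => Polynomial.C (b i)).det
  have hq : ∀ s : ℝ, q.eval s = (krylov (M + s • N) b).det := fun s => by
    have h1 : (Polynomial.evalRingHom s).mapMatrix Mp = M + s • N := by
      ext i j; simp [Mp]; ring
    have h2 : (Polynomial.evalRingHom s).mapMatrix (krylov Mp fun i => Polynomial.C (b i)) =
        krylov (M + s • N) b := by
      ext i k
      rw [← h1, krylov, krylov, of_apply, ← map_pow]
      simp [mulVec, dotProduct, Polynomial.eval_finsetSum]
    rw [← h2, ← RingHom.map_det]
    rfl
  have hq0 : q ≠ 0 := by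
    intro h0
    have := hq 1
    rw [h0, one_smul] at this
    exact h (by simpa using this.symm)
  have hfin : ({s : ℝ | q.eval s = 0} \ {0}).Finite := by
    refine (q.roots.toFinset.finite_toSet.subset ?_).sdiff
    intro s hs
    simpa [hq0] using hs
  filter_upwards [nhdsWithin_le_nhds (hfin.isClosed.isOpen_compl.mem_nhds (by simp)),
    self_mem_nhdsWithin] with s hs hs0
  rw [← hq]
  intro h0
  exact hs ⟨h0, hs0⟩

/-- The inputs are chosen one at a time. If no input led out of the span W of the earlier states, W
would contain the range of B and be A-invariant, hence be the whole space by controllability,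
although its dimension is below n. -/
theorem IsControllable.exists_independent_trajectory {A : Matrix (Fin n) (Fin n) ℝ}
    {B : Matrix (Fin n) (Fin m) ℝ} (h : IsControllable A B) {b : Fin n → ℝ} (hb : b ≠ 0) (k : ℕ)
    (hk : k + 1 ≤ n) : ∃ x : ℕ → Fin n → ℝ, x 0 = b ∧
      (∀ i, i < k → ∃ u, x (i + 1) = A *ᵥ x i + B *ᵥ u) ∧
      LinearIndependent ℝ fun i : Fin (k + 1) => x i := by
  induction k with
  | zero =>
    refine ⟨fun _ => b, rfl, fun i hi => absurd hi (Nat.not_lt_zero i), ?_⟩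
    have : Subsingleton (Fin (0 + 1)) := inferInstanceAs (Subsingleton (Fin 1))
    exact LinearIndependent.of_subsingleton (⟨0, by omega⟩ : Fin (0 + 1)) hb
  | succ k ih =>
    obtain ⟨x, hx0, hx, hli⟩ := ih (by omega)
    set W := Submodule.span ℝ (Set.range fun i : Fin (k + 1) => x i) with hW
    have hxW : ∀ i, i < k + 1 → x i ∈ W := fun i hi =>
      Submodule.subset_span ⟨⟨i, hi⟩, rfl⟩
    obtain ⟨u, hu⟩ : ∃ u, A *ᵥ x k + B *ᵥ u ∉ W := by
      by_contra! hcon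
      have hAk : A *ᵥ x k ∈ W := by simpa using hcon 0
      have hB : ∀ u, B *ᵥ u ∈ W := fun u => by
        have := W.sub_mem (hcon u) hAk
        rwa [add_sub_cancel_left] at this
      have hA : ∀ y ∈ W, A *ᵥ y ∈ W := fun y hy => by
        have : W ≤ W.comap A.mulVecLin := by
          refine Submodule.span_le.2 ?_
          rintro _ ⟨i, rfl⟩
          change A *ᵥ x i ∈ W
          rcases Nat.lt_succ_iff_lt_or_eq.1 i.2 with hi | hi
          · obtain ⟨u, hu⟩ := hx i hi
            have := W.sub_mem (hxW (i + 1) (by omega)) (hB u)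
            rwa [hu, add_sub_cancel_right] at this
          · rw [hi]; exact hAk
        exact this hy
      have htop := h.eq_top W fun j u => by
        induction j with
        | zero => simpa using hB u
        | succ j ih => rw [pow_succ', Matrix.mul_assoc, ← mulVec_mulVec]; exact hA _ ih
      have h1 : Module.finrank ℝ W = k + 1 := by
        rw [hW, finrank_span_eq_card hli, Fintype.card_fin]
      rw [htop, finrank_top] at h1
      simp at h1
      omega
    refine ⟨Function.update x (k + 1) (A *ᵥ x k + B *ᵥ u), ?_, fun i hi => ?_, ?_⟩
    · rw [Function.update_of_ne (by omega), hx0]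
    · rw [Function.update_of_ne (by omega : i ≠ k + 1)]
      rcases Nat.lt_succ_iff_lt_or_eq.1 hi with hi' | rfl
      · obtain ⟨u', hu'⟩ := hx i hi'
        exact ⟨u', by rw [Function.update_of_ne (by omega), hu']⟩
      · exact ⟨u, by rw [Function.update_self]⟩
    · have h1 : (fun i : Fin (k + 1 + 1) =>
          Function.update x (k + 1) (A *ᵥ x k + B *ᵥ u) (i : ℕ)) =
          Fin.snoc (fun i : Fin (k + 1) => x i) (A *ᵥ x k + B *ᵥ u) := by
        funext i
        refine Fin.lastCases ?_ (fun j => ?_) i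
        · simp
        · rw [Fin.snoc_castSucc, Fin.val_castSucc, Function.update_of_ne (by omega)]
      rw [h1, linearIndependent_finSnoc]
      exact ⟨hli, hu⟩

/-- Heymann's lemma: the trajectory is a basis, so a linear feedback can reproduce its inputs, and
the trajectory becomes the Krylov sequence of the closed loop. -/
theorem IsControllable.exists_det_krylov_ne_zero {A : Matrix (Fin n) (Fin n) ℝ}
    {B : Matrix (Fin n) (Fin m) ℝ} (h : IsControllable A B) {b : Fin n → ℝ} (hb : b ≠ 0) :
    ∃ F : Matrix (Fin m) (Fin n) ℝ, (krylov (A + B * F) b).det ≠ 0 := by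
  obtain ⟨k, rfl⟩ : ∃ k, n = k + 1 := by
    refine Nat.exists_eq_succ_of_ne_zero ?_
    rintro rfl
    exact hb (Subsingleton.elim _ _)
  obtain ⟨x, hx0, hx, hli⟩ := h.exists_independent_trajectory hb k le_rfl
  choose! u hu using hx
  let e := basisOfLinearIndependentOfCardEqFinrank hli (by simp)
  let f : (Fin (k + 1) → ℝ) →ₗ[ℝ] (Fin m → ℝ) := e.constr ℝ fun i => u i
  have hf : ∀ i, i < k + 1 → f (x i) = u i := fun i hi => by
    have := e.constr_basis ℝ (fun i : Fin (k + 1) => u i) ⟨i, hi⟩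
    rwa [coe_basisOfLinearIndependentOfCardEqFinrank] at this
  refine ⟨LinearMap.toMatrix' f, ?_⟩
  have hstep : ∀ i, i < k → (A + B * LinearMap.toMatrix' f) *ᵥ x i = x (i + 1) := fun i hi => by
    rw [add_mulVec, ← mulVec_mulVec, LinearMap.toMatrix'_mulVec, hf i (by omega), hu i hi]
  have hpow : ∀ i, i < k + 1 → (A + B * LinearMap.toMatrix' f) ^ i *ᵥ b = x i := fun i => by
    induction i with
    | zero => intro _; simp [hx0]
    | succ i ih =>
      intro hi
      rw [pow_succ', ← mulVec_mulVec, ih (by omega), hstep i (by omega)]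
  have hcol : (krylov (A + B * LinearMap.toMatrix' f) b).col = fun i : Fin (k + 1) => x i := by
    funext i
    rw [← hpow i i.2]
    rfl
  have : IsUnit (krylov (A + B * LinearMap.toMatrix' f) b) := by
    rw [← linearIndependent_cols_iff_isUnit, hcol]
    exact hli
  exact ((isUnit_iff_isUnit_det _).1 this).ne_zero

end Controllability

end LQG

namespace LQG

open Matrix

/-! ### Rank-one perturbations moving an eigenvalue out of the open unit disc. -/

section RankOne

variable {n : ℕ}

/-- The real part of a complex vector. -/
noncomputable def reVec (w : Fin n → ℂ) : Fin n → ℝ := fun i => (w i).re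

theorem cvec_reVec (w : Fin n → ℂ) : cvec (reVec w) = (1 / 2 : ℂ) • (w + star w) := by
  funext i
  simp only [cvec, reVec, Pi.smul_apply, Pi.add_apply, Pi.star_apply, smul_eq_mul,
    RCLike.star_def, Complex.re_eq_add_conj]
  ring

theorem star_vecMul_cmat {M : Matrix (Fin n) (Fin n) ℝ} {μ : ℂ} {w : Fin n → ℂ}
    (h : w ᵥ* cmat M = μ • w) : star w ᵥ* cmat M = star μ • star w := by
  funext j
  have := congrArg star (congrFun h j)
  simpa [vecMul, dotProduct] using this

theorem star_dotProduct_cvec (w : Fin n → ℂ) (b : Fin n → ℝ) :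
    star w ⬝ᵥ cvec b = star (w ⬝ᵥ cvec b) := by
  simp [dotProduct, cvec]

theorem vecMul_cmat_rank_one (M : Matrix (Fin n) (Fin n) ℝ) (β h : Fin n → ℝ) (s : ℝ)
    (q : Fin n → ℂ) : q ᵥ* cmat (M + s • vecMulVec β h) =
      q ᵥ* cmat M + ((s : ℂ) * (q ⬝ᵥ cvec β)) • cvec h := by
  funext j
  simp only [vecMul, dotProduct, Pi.add_apply, Pi.smul_apply, smul_eq_mul, Finset.mul_sum,
    Finset.sum_mul, ← Finset.sum_add_distrib]
  refine Finset.sum_congr rfl fun i _ => ?_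
  simp [cmat, cvec, vecMulVec_apply]
  ring

theorem IsSchurStable.eq_of_resolvent_eq {M : Matrix (Fin n) (Fin n) ℝ} (hM : IsSchurStable M)
    {μ : ℂ} (hμ : ‖μ‖ = 1) {y z : Fin n → ℂ} (h : μ • y - y ᵥ* cmat M = μ • z - z ᵥ* cmat M) :
    y = z := by
  by_contra hne
  have : IsLeftEigen M μ (y - z) := by
    refine ⟨sub_ne_zero.2 hne, ?_⟩
    rw [sub_vecMul, smul_sub]
    have h2 := sub_eq_zero.2 h
    rw [← sub_eq_zero, ← neg_eq_zero, ← h2]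
    abel
  exact absurd ((isSchurStable_iff M).1 hM μ _ this) (by rw [hμ]; exact lt_irrefl _)

/-- Along a rank-one perturbation in the direction `h`, eigenvectors reaching the unit circle are
excited by `b` as soon as `hᵀ (μ - M)⁻¹ b ≠ 0` on the circle. -/
theorem IsSchurStable.dotProduct_ne_zero_of_rank_one {M : Matrix (Fin n) (Fin n) ℝ}
    (hM : IsSchurStable M) {β h b : Fin n → ℝ}
    (hh : ∀ μ : ℂ, ‖μ‖ = 1 → ∀ y, μ • y - y ᵥ* cmat M = cvec h → y ⬝ᵥ cvec b ≠ 0) {s : ℝ} {μ : ℂ}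
    {q : Fin n → ℂ} (hq : IsLeftEigen (M + s • vecMulVec β h) μ q) (hμ : ‖μ‖ = 1) :
    q ⬝ᵥ cvec b ≠ 0 := by
  have h1 := hq.2
  rw [vecMul_cmat_rank_one] at h1
  set c := (s : ℂ) * (q ⬝ᵥ cvec β)
  -- If c = 0, then q would be an eigenvector of the stable M with |μ| = 1. Otherwise c⁻¹ q solves
  -- the resolvent equation for h.
  have hc : c ≠ 0 := by
    intro hc
    rw [hc, zero_smul, add_zero] at h1
    exact absurd ((isSchurStable_iff M).1 hM μ q ⟨hq.1, h1⟩) (by rw [hμ]; exact lt_irrefl _)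
  have h2 := hh μ hμ (c⁻¹ • q) (by
    rw [smul_vecMul, smul_comm, ← smul_sub, ← h1, add_sub_cancel_left, smul_smul,
      inv_mul_cancel₀ hc, one_smul])
  intro h0
  rw [smul_dotProduct, h0, smul_zero] at h2
  exact h2 rfl

theorem IsSchurStable.ne_of_norm_eq_one {M : Matrix (Fin n) (Fin n) ℝ} (hM : IsSchurStable M)
    {μ l : ℂ} {w : Fin n → ℂ} (hw : IsLeftEigen M l w) (hμ : ‖μ‖ = 1) : μ - l ≠ 0 := by
  intro h
  rw [← sub_eq_zero.1 h, ] at hw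
  exact absurd ((isSchurStable_iff M).1 hM μ w hw) (by rw [hμ]; exact lt_irrefl _)

/-- For real l the vector h = Re w is again a left eigenvector, and h·β = σ - l moves its eigenvalue
to σ = ±1. The resolvent applied to h is h/(μ - l), whose pairing with b is nonzero by excitation.
-/
theorem push_real_eigenvalue {M : Matrix (Fin n) (Fin n) ℝ} (hM : IsSchurStable M)
    {β b : Fin n → ℝ} (hb : Excites M b) {l : ℂ} (hl : l.im = 0) {w : Fin n → ℂ}
    (hw : IsLeftEigen M l w) {σ : ℝ} (hσ : |σ| = 1) (hω : w ⬝ᵥ cvec β = σ - l) :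
    ¬ IsSchurStable (M + vecMulVec β (reVec w)) ∧ ∀ μ : ℂ, ‖μ‖ = 1 →
      ∀ y, μ • y - y ᵥ* cmat M = cvec (reVec w) → y ⬝ᵥ cvec b ≠ 0 := by
  have hl' : star l = l := Complex.conj_eq_iff_im.2 hl
  have hσ' : ‖(σ : ℂ)‖ = 1 := by simpa using hσ
  have hne := hM.ne_of_norm_eq_one hw hσ'
  set h := cvec (reVec w) with hdef
  have hM1 : h ᵥ* cmat M = l • h := by
    rw [hdef, cvec_reVec, smul_vecMul, add_vecMul, hw.2, star_vecMul_cmat hw.2, hl', ← smul_add,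
      smul_comm]
  have hβ : h ⬝ᵥ cvec β = σ - l := by
    rw [hdef, cvec_reVec, smul_dotProduct, add_dotProduct, star_dotProduct_cvec, hω, star_sub, hl',
      smul_eq_mul]
    simp only [RCLike.star_def, Complex.conj_ofReal]; ring
  have hh0 : h ≠ 0 := by
    intro h0
    rw [h0, zero_dotProduct] at hβ
    exact hne hβ.symm
  refine ⟨fun hst => ?_, fun μ hμ y hy => ?_⟩
  · have h1 : IsLeftEigen (M + vecMulVec β (reVec w)) σ h := by
      refine ⟨hh0, ?_⟩
      have := vecMul_cmat_rank_one M β (reVec w) 1 h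
      rw [one_smul] at this
      rw [this, hM1, hβ, Complex.ofReal_one, one_mul, ← add_smul, add_sub_cancel]
    exact absurd ((isSchurStable_iff _).1 hst _ _ h1) (by rw [hσ']; exact lt_irrefl _)
  · have hμl := hM.ne_of_norm_eq_one hw hμ
    have h1 : y = (μ - l)⁻¹ • h := by
      refine hM.eq_of_resolvent_eq hμ ?_
      rw [hy, smul_vecMul, hM1, smul_comm, ← smul_sub, ← sub_smul, smul_smul, inv_mul_cancel₀ hμl,
        one_smul]
    rw [h1, smul_dotProduct, smul_eq_mul]
    exact mul_ne_zero (inv_ne_zero hμl) (hb l h ⟨hh0, hM1⟩)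

/-- The two roots have product 1. -/
theorem exists_root_norm_ge_one (t : ℂ) : ∃ μ : ℂ, μ ^ 2 - t * μ + 1 = 0 ∧ 1 ≤ ‖μ‖ := by
  obtain ⟨δ, hδ⟩ := IsAlgClosed.exists_pow_nat_eq (t ^ 2 - 4) (n := 2) (by norm_num)
  have hprod : ((t + δ) / 2) * ((t - δ) / 2) = 1 := by linear_combination -(1 / 4) * hδ
  have hn := congrArg norm hprod
  rw [norm_mul, norm_one] at hn
  rcases le_total 1 ‖(t + δ) / 2‖ with h | h
  · exact ⟨_, by linear_combination (1 / 4) * hδ, h⟩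
  · refine ⟨(t - δ) / 2, by linear_combination (1 / 4) * hδ, ?_⟩
    nlinarith [norm_nonneg ((t + δ) / 2), norm_nonneg ((t - δ) / 2)]

/-- The perturbation along Re w = (w + w̄)/2 preserves the span of w and w̄. There its determinant
is |l|² + Re(l̄ω), which the prescribed ω makes equal to 1, so some eigenvalue has modulus at least
1. The parameter t drops out of the determinant and remains free to secure `h1` and `h2`. -/
theorem push_nonreal_eigenvalue {M : Matrix (Fin n) (Fin n) ℝ} (hM : IsSchurStable M)
    {β b : Fin n → ℝ} {l : ℂ} (hl : l.im ≠ 0) {w : Fin n → ℂ}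
    (hw : IsLeftEigen M l w) {t : ℝ}
    (hω : w ⬝ᵥ cvec β = (1 + t * Complex.I) * ((1 - ‖l‖ ^ 2) / ‖l‖ ^ 2 : ℝ) * l)
    (hω0 : w ⬝ᵥ cvec β ≠ 0)
    (h1 : ((w ⬝ᵥ cvec b) * (1 - star l)).re ≠ 0) (h2 : ((w ⬝ᵥ cvec b) * (1 + star l)).re ≠ 0) :
    ¬ IsSchurStable (M + vecMulVec β (reVec w)) ∧ ∀ μ : ℂ, ‖μ‖ = 1 →
      ∀ y, μ • y - y ᵥ* cmat M = cvec (reVec w) → y ⬝ᵥ cvec b ≠ 0 := by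
  set ω := w ⬝ᵥ cvec β with hωdef
  set ν := w ⬝ᵥ cvec b with hν
  have hl0 : l ≠ 0 := by rintro rfl; exact hl rfl
  have hw' := star_vecMul_cmat hw.2
  refine ⟨fun hst => ?_, fun μ hμ y hy => ?_⟩
  · set α := l + ω / 2 with hα
    obtain ⟨μ, hμ, hμ1⟩ := exists_root_norm_ge_one (α + star α)
    have hdet : α * star α - ω * star ω / 4 = 1 := by
      have e1 : α * star α - ω * star ω / 4 = l * star l + (l * star ω + ω * star l) / 2 := by
        rw [hα]; simp only [RCLike.star_def, map_add, map_div₀, map_ofNat]; ring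
      have e2 : l * star l = (‖l‖ ^ 2 : ℝ) := by
        rw [RCLike.star_def, Complex.mul_conj, Complex.normSq_eq_norm_sq]
      have e3 : (l * star ω + ω * star l) / 2 = ((1 - ‖l‖ ^ 2) / ‖l‖ ^ 2 : ℝ) * (l * star l) := by
        rw [hω]
        simp only [RCLike.star_def, map_mul, map_add, map_one, Complex.conj_ofReal, Complex.conj_I]
        ring
      have hn : ‖l‖ ^ 2 ≠ 0 := by positivity
      rw [e1, e3, e2, ← Complex.ofReal_mul, div_mul_cancel₀ _ hn, ← Complex.ofReal_add]
      simp
    have hchar : (μ - α) * (μ - star α) = ω * star ω / 4 := by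
      linear_combination hμ + hdet
    set q : Fin n → ℂ := (star ω / 2) • w + (μ - α) • star w with hq
    have hqM : q ᵥ* cmat M = (star ω / 2 * l) • w + ((μ - α) * star l) • star w := by
      rw [hq, add_vecMul, smul_vecMul, smul_vecMul, hw.2, hw', smul_smul, smul_smul]
    have hωs : star ω ≠ 0 := star_ne_zero.2 hω0
    have hq0 : q ≠ 0 := by
      intro h0
      have h3 := hqM
      rw [h0, zero_vecMul] at h3
      have h4 : (star ω / 2 * (l - star l)) • w = 0 := by
        have h5 : star l • q = 0 := by rw [h0, smul_zero]
        rw [hq, smul_add, smul_smul, smul_smul] at h5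
        have h6 := h3.symm.trans h5.symm
        rw [mul_comm (μ - α), add_left_inj, mul_comm (star l)] at h6
        rw [mul_sub, sub_smul, h6, sub_self]
      rcases smul_eq_zero.1 h4 with h5 | h5
      · rcases mul_eq_zero.1 h5 with h6 | h6
        · exact hωs (by simpa using h6)
        · exact hl (Complex.conj_eq_iff_im.1 (sub_eq_zero.1 h6).symm)
      · exact hw.1 h5
    have heig : IsLeftEigen (M + vecMulVec β (reVec w)) μ q := by
      refine ⟨hq0, ?_⟩
      have h3 := vecMul_cmat_rank_one M β (reVec w) 1 q
      rw [one_smul, Complex.ofReal_one, one_mul] at h3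
      have h4 : q ⬝ᵥ cvec β = star ω / 2 * ω + (μ - α) * star ω := by
        rw [hq, add_dotProduct, smul_dotProduct, smul_dotProduct, star_dotProduct_cvec, ← hωdef,
          smul_eq_mul, smul_eq_mul]
      rw [h3, h4, hqM, cvec_reVec]
      funext i
      simp only [Pi.add_apply, Pi.smul_apply, smul_eq_mul, hq]
      have hαs : star α = star l + star ω / 2 := by
        rw [hα]; simp only [RCLike.star_def, map_add, map_div₀, map_ofNat]
      rw [hαs] at hchar
      rw [hα] at hchar ⊢
      linear_combination (-star w i) * hchar
    exact absurd ((isSchurStable_iff _).1 hst _ _ heig) (not_lt.2 hμ1)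
  · have hμl := hM.ne_of_norm_eq_one hw hμ
    have hμl' := hM.ne_of_norm_eq_one (w := star w) ⟨star_ne_zero.2 hw.1, hw'⟩ hμ
    have hy1 : y = (1 / 2 : ℂ) • ((μ - l)⁻¹ • w + (μ - star l)⁻¹ • star w) := by
      refine hM.eq_of_resolvent_eq hμ ?_
      rw [hy, cvec_reVec, smul_vecMul, add_vecMul, smul_vecMul, smul_vecMul, hw.2, hw']
      funext i
      simp only [Pi.add_apply, Pi.sub_apply, Pi.smul_apply, smul_eq_mul]
      field_simp
      ring
    have hyb : y ⬝ᵥ cvec b = (1 / 2 : ℂ) * ((μ - l)⁻¹ * ν + (μ - star l)⁻¹ * star ν) := by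
      rw [hy1, smul_dotProduct, add_dotProduct, smul_dotProduct, smul_dotProduct,
        star_dotProduct_cvec]
      rfl
    intro h0
    rw [hyb] at h0
    have h3 : ν * (μ - star l) + star ν * (μ - l) = 0 := by
      field_simp at h0
      linear_combination h0
    -- Vanishing of y·b reads μ Re ν = Re(ν l̄). Taking moduli with |μ| = 1 gives Re ν = ± Re(ν l̄),
    -- which `h1` and `h2` exclude.
    have h4 : μ * (ν.re : ℂ) = ((ν * star l).re : ℂ) := by
      rw [Complex.re_eq_add_conj, Complex.re_eq_add_conj]
      simp only [RCLike.star_def, map_mul, Complex.conj_conj] at h3 ⊢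
      linear_combination (1 / 2) * h3
    rw [mul_sub, mul_one, Complex.sub_re] at h1
    rw [mul_add, mul_one, Complex.add_re] at h2
    have h5 := congrArg norm h4
    rw [norm_mul, hμ, one_mul, Complex.norm_real, Complex.norm_real, Real.norm_eq_abs,
      Real.norm_eq_abs] at h5
    rcases abs_eq_abs.1 h5 with h6 | h6
    · exact h1 (sub_eq_zero.2 h6)
    · exact h2 (by rw [h6, neg_add_cancel])

/-- Each expression is a nonzero affine function of t, so it vanishes for at most one t; one of 0,
1, 2 avoids both zeros. -/
theorem exists_re_ne_zero {z₁ z₂ : ℂ} (h₁ : z₁ ≠ 0) (h₂ : z₂ ≠ 0) :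
    ∃ t : ℝ, 0 ≤ t ∧ t ≤ 2 ∧ ((1 + t * Complex.I) * z₁).re ≠ 0 ∧
      ((1 + t * Complex.I) * z₂).re ≠ 0 := by
  have key : ∀ z : ℂ, z ≠ 0 → ∀ s t : ℝ, s ≠ t → ((1 + s * Complex.I) * z).re = 0 →
      ((1 + t * Complex.I) * z).re ≠ 0 := by
    intro z hz s t hst h1 h2
    simp at h1 h2
    have h3 : z.im = 0 := by
      have : (t - s) * z.im = 0 := by linarith
      rcases mul_eq_zero.1 this with h | h
      · exact absurd (sub_eq_zero.1 h).symm hst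
      · exact h
    rw [h3] at h1
    exact hz (Complex.ext (by simpa using h1) h3)
  by_contra! hcon
  have a0 := hcon 0 le_rfl (by norm_num)
  have a1 := hcon 1 (by norm_num) (by norm_num)
  have a2 := hcon 2 (by norm_num) (by norm_num)
  have k1 := key z₁ h₁
  have k2 := key z₂ h₂
  have n01 : (0 : ℝ) ≠ 1 := by norm_num
  have n02 : (0 : ℝ) ≠ 2 := by norm_num
  have n12 : (1 : ℝ) ≠ 2 := by norm_num
  have b01 := k1 0 1 n01
  have b02 := k1 0 2 n02
  have b12 := k1 1 2 n12
  have c01 := k2 0 1 n01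
  have c02 := k2 0 2 n02
  have c12 := k2 1 2 n12
  tauto

/-- A stable matrix with an eigenvalue close to the unit circle is destabilized by a small rank-one
perturbation along which the mode that becomes unstable is excited by `b`. -/
theorem exists_destabilizing {M : Matrix (Fin n) (Fin n) ℝ} (hM : IsSchurStable M)
    {β b : Fin n → ℝ} (hb : Excites M b) {l : ℂ} (hl0 : l ≠ 0) {v : Fin n → ℂ}
    (hv : IsLeftEigen M l v) (hω : v ⬝ᵥ cvec β ≠ 0) :
    ∃ h : Fin n → ℝ,
      (∀ i, |h i| ≤ 3 * ((1 - ‖l‖ ^ 2) / (‖l‖ * ‖v ⬝ᵥ cvec β‖)) * ‖v‖) ∧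
      ¬ IsSchurStable (M + vecMulVec β h) ∧ ∀ μ : ℂ, ‖μ‖ = 1 →
        ∀ y, μ • y - y ᵥ* cmat M = cvec h → y ⬝ᵥ cvec b ≠ 0 := by
  set ω := v ⬝ᵥ cvec β with hωdef
  have hln : 0 < ‖l‖ := norm_pos_iff.2 hl0
  have hωn : 0 < ‖ω‖ := norm_pos_iff.2 hω
  have hl1 : ‖l‖ < 1 := (isSchurStable_iff M).1 hM l v hv
  have hsmul : ∀ κ : ℂ, κ ≠ 0 → IsLeftEigen M l (κ • v) := fun κ hκ =>
    ⟨smul_ne_zero hκ hv.1, by rw [smul_vecMul, hv.2, smul_comm]⟩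
  have hbound : ∀ κ : ℂ, ‖κ‖ ≤ 3 * ((1 - ‖l‖ ^ 2) / (‖l‖ * ‖ω‖)) → ∀ i, |reVec (κ • v) i| ≤
      3 * ((1 - ‖l‖ ^ 2) / (‖l‖ * ‖ω‖)) * ‖v‖ := fun κ hκ i => by
    refine (Complex.abs_re_le_norm _).trans ?_
    rw [Pi.smul_apply, smul_eq_mul, norm_mul]
    exact mul_le_mul hκ (norm_le_pi_norm v i) (norm_nonneg _) ((norm_nonneg _).trans hκ)
  have hpos : 0 < 1 - ‖l‖ ^ 2 := by nlinarith
  by_cases him : l.im = 0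
  · obtain ⟨σ, hσ, hσl⟩ : ∃ σ : ℝ, |σ| = 1 ∧ ‖(σ : ℂ) - l‖ = 1 - ‖l‖ := by
      have hlre : l = (l.re : ℂ) := Complex.ext rfl (by simpa using him)
      have habs : ‖l‖ = |l.re| := by rw [hlre]; simp
      rcases le_total 0 l.re with h | h
      · refine ⟨1, abs_one, ?_⟩
        rw [habs] at hl1 ⊢
        rw [hlre, ← Complex.ofReal_sub, Complex.norm_real, Real.norm_eq_abs, Complex.ofReal_re]
        rw [abs_of_nonneg h] at hl1 ⊢
        exact abs_of_nonneg (by linarith)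
      · refine ⟨-1, by simp, ?_⟩
        rw [habs] at hl1 ⊢
        rw [hlre, ← Complex.ofReal_sub, Complex.norm_real, Real.norm_eq_abs, Complex.ofReal_re]
        rw [abs_of_nonpos h] at hl1 ⊢
        rw [abs_of_nonpos (by linarith)]; ring
    have hκ : ((σ : ℂ) - l) / ω ≠ 0 := by
      refine div_ne_zero ?_ hω
      rw [← norm_pos_iff, hσl]; linarith
    refine ⟨reVec ((((σ : ℂ) - l) / ω) • v), hbound _ ?_,
      push_real_eigenvalue hM hb him (hsmul _ hκ) hσ ?_⟩
    · rw [norm_div, hσl, ← div_div, ← mul_div_assoc]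
      refine div_le_div_of_nonneg_right ?_ hωn.le
      rw [← mul_div_assoc, le_div_iff₀ hln]
      nlinarith
    · rw [smul_dotProduct, ← hωdef, smul_eq_mul, div_mul_cancel₀ _ hω]
  · set τ : ℝ := (1 - ‖l‖ ^ 2) / ‖l‖ ^ 2 with hτ
    have hτ0 : 0 < τ := by positivity
    -- Rescaling v by (1 + ti)κ gives its pairing with β the value required by
    -- `push_nonreal_eigenvalue`.
    set κ : ℂ := τ * l / ω with hκdef
    have hτc : (τ : ℂ) ≠ 0 := by exact_mod_cast hτ0.ne'
    have hκ : κ ≠ 0 := div_ne_zero (mul_ne_zero hτc hl0) hω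
    have hν := hb l v hv
    have hl1' : 1 - star l ≠ 0 := fun h => him (by
      have := congrArg Complex.im h
      simpa using this)
    have hl2' : 1 + star l ≠ 0 := fun h => him (by
      have := congrArg Complex.im h
      simpa using this)
    obtain ⟨t, ht0, ht2, h1, h2⟩ := exists_re_ne_zero (mul_ne_zero (mul_ne_zero hκ hν) hl1')
      (mul_ne_zero (mul_ne_zero hκ hν) hl2')
    have ht : (1 + t * Complex.I : ℂ) ≠ 0 := fun h => by
      have := congrArg Complex.re h
      simp at this
    have hωeq : (((1 + t * Complex.I) * κ) • v) ⬝ᵥ cvec β = (1 + t * Complex.I) * τ * l := by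
      rw [smul_dotProduct, ← hωdef, smul_eq_mul, hκdef]
      field_simp
    refine ⟨reVec (((1 + t * Complex.I) * κ) • v), hbound _ ?_,
      push_nonreal_eigenvalue hM him (hsmul _ (mul_ne_zero ht hκ)) (t := t) hωeq ?_ ?_ ?_⟩
    · have hn : ‖(1 + t * Complex.I : ℂ)‖ ≤ 3 := by
        refine (norm_add_le _ _).trans ?_
        rw [norm_mul, Complex.norm_I, Complex.norm_real, Real.norm_eq_abs, abs_of_nonneg ht0,
          norm_one]
        linarith
      have hκn : ‖κ‖ = (1 - ‖l‖ ^ 2) / (‖l‖ * ‖ω‖) := by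
        rw [hκdef, norm_div, norm_mul, Complex.norm_real, Real.norm_eq_abs, abs_of_pos hτ0, hτ]
        field_simp
      rw [norm_mul, hκn]
      exact mul_le_mul_of_nonneg_right hn (by positivity)
    · rw [hωeq]
      exact mul_ne_zero (mul_ne_zero ht hτc) hl0
    · rw [smul_dotProduct, smul_eq_mul]
      convert h1 using 2
      ring
    · rw [smul_dotProduct, smul_eq_mul]
      convert h2 using 2
      ring

end RankOne

end LQG

namespace LQG

open Matrix

/-! ### Limits of covariances at the boundary of the stabilizing set. -/

section LimitCovariance

variable {n : ℕ}

theorem abs_entry_le_trace {X : Matrix (Fin n) (Fin n) ℝ} (hX : X.PosSemidef) (i j : Fin n) :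
    |X i j| ≤ X.trace := by
  have hs : X j i = X i j := congrFun (congrFun (posSemidef_transpose_eq hX) i) j
  have hd : ∀ i, X i i ≤ X.trace := fun i =>
    Finset.single_le_sum (f := fun i => X i i) (fun i _ => hX.diag_nonneg) (Finset.mem_univ i)
  have h1 := hX.dotProduct_mulVec_nonneg (Pi.single i 1 + Pi.single j 1)
  have h2 := hX.dotProduct_mulVec_nonneg (Pi.single i 1 - Pi.single j 1)
  simp only [star_trivial, mulVec_add, mulVec_sub, add_dotProduct, sub_dotProduct,
    mulVec_single_one, single_one_dotProduct, Pi.add_apply, Pi.sub_apply, col_apply, hs] at h1 h2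
  rw [abs_le]
  have := hd i
  have := hd j
  constructor <;> linarith

theorem reVec_vecMul (q : Fin n → ℂ) (M : Matrix (Fin n) (Fin n) ℝ) :
    reVec (q ᵥ* cmat M) = reVec q ᵥ* M := by
  funext j
  simp [reVec, vecMul, dotProduct]

theorem quadratic_conj (M X : Matrix (Fin n) (Fin n) ℝ) (x : Fin n → ℝ) :
    x ⬝ᵥ (M * X * Mᵀ) *ᵥ x = (x ᵥ* M) ⬝ᵥ X *ᵥ (x ᵥ* M) := by
  rw [Matrix.mul_assoc, ← mulVec_mulVec, dotProduct_mulVec, ← mulVec_mulVec, mulVec_transpose]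

/-- Marginally stable or unstable modes of a system with a stationary covariance are not excited. -/
theorem vecMul_eq_zero_of_lyap {M N X : Matrix (Fin n) (Fin n) ℝ} (hN : N.PosSemidef)
    (hX : X.PosSemidef) (h : X = N + M * X * Mᵀ) {μ : ℂ} {q : Fin n → ℂ} (hq : IsLeftEigen M μ q)
    (hμ : 1 ≤ ‖μ‖) : q ᵥ* cmat N = 0 := by
  set a := reVec q with ha
  set d := reVec (-Complex.I • q) with hd
  have hqa : ∀ i, q i = a i + d i * Complex.I := fun i => by
    refine Complex.ext ?_ ?_ <;> simp [ha, hd, reVec]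
  have ha1 : a ᵥ* M = μ.re • a - μ.im • d := by
    rw [ha, ← reVec_vecMul, hq.2]
    funext i; simp [reVec, hd]
  have hd1 : d ᵥ* M = μ.im • a + μ.re • d := by
    rw [hd, ← reVec_vecMul, smul_vecMul, hq.2]
    funext i; simp [reVec, ha]; ring
  have hs : d ⬝ᵥ X *ᵥ a = a ⬝ᵥ X *ᵥ d := by
    rw [dotProduct_mulVec, dotProduct_comm, ← mulVec_transpose, posSemidef_transpose_eq hX]
  have e1 : ∀ x, x ⬝ᵥ X *ᵥ x = x ⬝ᵥ N *ᵥ x + (x ᵥ* M) ⬝ᵥ X *ᵥ (x ᵥ* M) := fun x => by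
    conv_lhs => rw [h]
    rw [add_mulVec, dotProduct_add, quadratic_conj]
  have ea := e1 a
  have ed := e1 d
  rw [ha1] at ea
  rw [hd1] at ed
  simp only [mulVec_add, mulVec_sub, mulVec_smul, dotProduct_add, dotProduct_sub, add_dotProduct,
    sub_dotProduct, dotProduct_smul, smul_dotProduct, smul_eq_mul, hs] at ea ed
  have hNa := hN.dotProduct_mulVec_nonneg a
  have hNd := hN.dotProduct_mulVec_nonneg d
  have hXa := hX.dotProduct_mulVec_nonneg a
  have hXd := hX.dotProduct_mulVec_nonneg d
  rw [star_trivial] at hNa hNd hXa hXd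
  have hn : 1 ≤ μ.re ^ 2 + μ.im ^ 2 := by
    have h1 := Complex.normSq_eq_norm_sq μ
    rw [Complex.normSq_apply] at h1
    nlinarith
  -- This is q*Nq = (1 - |μ|²) q*Xq written with q = a + id; for |μ| ≥ 1 the right side is
  -- nonpositive.
  have hsum : a ⬝ᵥ N *ᵥ a + d ⬝ᵥ N *ᵥ d =
      (1 - (μ.re ^ 2 + μ.im ^ 2)) * (a ⬝ᵥ X *ᵥ a + d ⬝ᵥ X *ᵥ d) := by
    linear_combination -ea - ed
  have hle : a ⬝ᵥ N *ᵥ a + d ⬝ᵥ N *ᵥ d ≤ 0 := by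
    rw [hsum]
    exact mul_nonpos_of_nonpos_of_nonneg (by linarith) (by linarith)
  have hNa0 : N *ᵥ a = 0 := (hN.dotProduct_mulVec_zero_iff a).1 (by rw [star_trivial]; linarith)
  have hNd0 : N *ᵥ d = 0 := (hN.dotProduct_mulVec_zero_iff d).1 (by rw [star_trivial]; linarith)
  have hNt := posSemidef_transpose_eq hN
  have key : ∀ x, N *ᵥ x = 0 → ∀ j, ∑ i, (x i : ℂ) * (N i j : ℂ) = 0 := fun x hx j => by
    have h1 : x ᵥ* N = 0 := by rw [← mulVec_transpose, hNt, hx]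
    have h2 := congrFun h1 j
    simp only [vecMul, dotProduct, Pi.zero_apply] at h2
    exact_mod_cast h2
  funext j
  have h1 := key a hNa0 j
  have h2 := key d hNd0 j
  simp only [vecMul, dotProduct, map_apply, Complex.coe_algebraMap, Pi.zero_apply, hqa, add_mul,
    Finset.sum_add_distrib]
  rw [h1, zero_add]
  calc _ = Complex.I * ∑ i, (d i : ℂ) * (N i j : ℂ) := by
        rw [Finset.mul_sum]; exact Finset.sum_congr rfl fun i _ => by ring
    _ = 0 := by rw [h2, mul_zero]

/-- The trace bounds every entry of a positive semidefinite matrix, so the sequence lies in a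
compact box. An ultrafilter finer than `atTop` plays the role of a subsequence. -/
theorem exists_limit_of_trace_le {X : ℕ → Matrix (Fin n) (Fin n) ℝ} (hX : ∀ k, (X k).PosSemidef)
    {C : ℝ} (hC : ∀ k, (X k).trace ≤ C) : ∃ (l : Filter ℕ) (Y : Matrix (Fin n) (Fin n) ℝ),
      l.NeBot ∧ l ≤ atTop ∧ Tendsto X l (𝓝 Y) := by
  have hcomp : IsCompact {Z : Matrix (Fin n) (Fin n) ℝ | ∀ i j, Z i j ∈ Set.Icc (-C) C} := by
    have h1 : IsCompact {Z : Fin n → Fin n → ℝ | ∀ i, Z i ∈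
        {z : Fin n → ℝ | ∀ j, z j ∈ Set.Icc (-C) C}} :=
      isCompact_pi_infinite fun i => isCompact_pi_infinite fun j => isCompact_Icc
    exact h1
  have hmem : ∀ k, X k ∈ {Z : Matrix (Fin n) (Fin n) ℝ | ∀ i j, Z i j ∈ Set.Icc (-C) C} :=
    fun k i j => abs_le.1 ((abs_entry_le_trace (hX k) i j).trans (hC k))
  obtain ⟨Y, -, hY⟩ := hcomp.ultrafilter_le_nhds ((Ultrafilter.of (atTop : Filter ℕ)).map X)
    (by
      rw [Ultrafilter.coe_map, le_principal_iff, mem_map]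
      exact univ_mem' hmem)
  exact ⟨Ultrafilter.of (atTop : Filter ℕ), Y, inferInstance, Ultrafilter.of_le _, hY⟩

theorem tendsto_of_frobNorm_tendsto {ι m l : Type*} [Fintype m] [Fintype l] {f : Filter ι}
    {X : ι → Matrix m l ℝ} {Y : Matrix m l ℝ}
    (h : Tendsto (fun k => frobNorm (X k - Y)) f (𝓝 0)) : Tendsto X f (𝓝 Y) := by
  refine tendsto_pi_nhds.2 fun i => tendsto_pi_nhds.2 fun j => ?_
  rw [tendsto_iff_norm_sub_tendsto_zero]
  exact squeeze_zero (fun _ => norm_nonneg _) (fun k => abs_entry_le_frobNorm (X k - Y) i j) h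

end LimitCovariance

namespace System

variable {nx nu ny : ℕ} {sys : System nx nu ny} {p : ℕ}

/-- The Lyapunov equation is closed under limits, so it survives at Kb even if Kb is not
stabilizing. -/
theorem Regular.exists_limit_covariance (hr : sys.Regular p) {K : ℕ → Gain nu ny p}
    {Kb : Gain nu ny p} (hK : Tendsto K atTop (𝓝 Kb)) (hst : ∀ k, K k ∈ sys.stabilizing p) {C : ℝ}
    (hC : ∀ k, (sys.Sig (K k)).trace ≤ C) : ∃ X : Matrix (Fin nx) (Fin nx) ℝ, X.PosSemidef ∧
      X = sys.SigNu + sys.closedLoop Kb * X * (sys.closedLoop Kb)ᵀ := by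
  obtain ⟨l, X, hl, hle, hX⟩ := exists_limit_of_trace_le (fun k => hr.posSemidef_Sig (hst k)) hC
  refine ⟨X, posSemidef_of_tendsto hX (Eventually.of_forall fun k => hr.posSemidef_Sig (hst k)), ?_⟩
  have hM : Tendsto (fun k => sys.closedLoop (K k)) l (𝓝 (sys.closedLoop Kb)) :=
    (continuous_closedLoop.tendsto Kb).comp (hK.mono_left hle)
  have hc : Continuous fun Z : Matrix (Fin nx) (Fin nx) ℝ × Matrix (Fin nx) (Fin nx) ℝ =>
      sys.SigNu + Z.1 * Z.2 * Z.1ᵀ := by fun_prop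
  have h1 := (hc.tendsto (sys.closedLoop Kb, X)).comp (hM.prodMk_nhds hX)
  refine tendsto_nhds_unique hX (h1.congr fun k => ?_)
  exact (Sig_eq (hst k)).symm

/-- A bootstrap: the slope bound is known only where J ≤ c, and it is needed only where J meets the
line c - κ + κs, which lies below c on [0, 1]. -/
theorem Regular.J_le_of_gradient_bound (hr : sys.Regular p) {X D : Gain nu ny p} {c κ s₁ : ℝ}
    (hκ : 0 < κ) (hs1 : s₁ ≤ 1) (hst : ∀ s ∈ Set.Icc 0 s₁, X + s • D ∈ sys.stabilizing p)
    (h0 : sys.J X ≤ c - κ)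
    (hgrad : ∀ s ∈ Set.Icc 0 s₁, sys.J (X + s • D) ≤ c →
      frobInner D (sys.gradJ (X + s • D)) < κ) :
    ∀ s ∈ Set.Icc 0 s₁, sys.J (X + s • D) ≤ c := by
  have hB : ∀ s, HasDerivAt (fun s : ℝ => c - κ + κ * s) κ s := fun s => by
    simpa using ((hasDerivAt_id s).const_mul κ).const_add (c - κ)
  have hd : ∀ s ∈ Set.Icc 0 s₁, HasDerivAt (fun t : ℝ => sys.J (X + t • D))
      (frobInner D (sys.gradJ (X + s • D))) s := fun s hs => hr.hasDerivAt_J_line (hst s hs)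
  intro s hs
  have := image_le_of_deriv_right_lt_deriv_boundary (f := fun t : ℝ => sys.J (X + t • D))
    (fun x hx => (hd x hx).continuousAt.continuousWithinAt)
    (fun x hx => (hd x ⟨hx.1, hx.2.le⟩).hasDerivWithinAt) (by simpa using h0) hB
    (fun x hx hxe => hgrad x ⟨hx.1, hx.2.le⟩ (by
      rw [hxe]; nlinarith [hx.2, mul_le_mul_of_nonneg_left (hx.2.le.trans hs1) hκ.le])) hs
  refine this.trans ?_
  nlinarith [mul_le_mul_of_nonneg_left (hs.2.trans hs1) hκ.le]

/-- A segment that leaves the stabilizing set has a first exit point. -/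
theorem exists_first_exit {X D : Gain nu ny p} (hX : X ∈ sys.stabilizing p) {s₀ : ℝ}
    (hs₀ : s₀ ∈ Set.Icc (0 : ℝ) 1) (hD : X + s₀ • D ∉ sys.stabilizing p) :
    ∃ s ∈ Set.Ioc (0 : ℝ) 1, X + s • D ∉ sys.stabilizing p ∧
      ∀ t ∈ Set.Ico 0 s, X + t • D ∈ sys.stabilizing p := by
  have hc : Continuous fun t : ℝ => X + t • D := by fun_prop
  have hcl : IsClosed {t : ℝ | X + t • D ∉ sys.stabilizing p} :=
    (isOpen_stabilizing.preimage hc).isClosed_compl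
  obtain ⟨s, ⟨hs, hsD⟩, hleast⟩ := (isCompact_Icc.inter_right hcl).exists_isLeast ⟨s₀, hs₀, hD⟩
  have hs0 : s ≠ 0 := by
    rintro rfl
    exact hsD (by simpa using hX)
  refine ⟨s, ⟨lt_of_le_of_ne hs.1 hs0.symm, hs.2⟩, hsD, fun t ht => ?_⟩
  by_contra hcon
  exact absurd (hleast ⟨⟨ht.1, ht.2.le.trans hs.2⟩, hcon⟩) (not_le.2 ht.2)

/-- Before the first exit of the segment the cost is at most c, so the covariances are bounded and a
limit covariance exists at the exit. A mode there lies on the unit circle and is annihilated by Σ_ν,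
hence by b, against the resolvent condition `hh`. -/
theorem Regular.not_small_destabilizing (hr : sys.Regular p) {X D : Gain nu ny p}
    (hX : X ∈ sys.stabilizing p) {β h b : Fin nx → ℝ}
    (hcl : ∀ s : ℝ, sys.closedLoop (X + s • D) = sys.closedLoop X + s • vecMulVec β h)
    (hun : ¬ IsSchurStable (sys.closedLoop X + vecMulVec β h))
    (hh : ∀ μ : ℂ, ‖μ‖ = 1 → ∀ y, μ • y - y ᵥ* cmat (sys.closedLoop X) = cvec h →
      y ⬝ᵥ cvec b ≠ 0)
    (hb : ∀ q : Fin nx → ℂ, q ᵥ* cmat sys.SigNu = 0 → q ⬝ᵥ cvec b = 0) {c κ : ℝ} (hκ : 0 < κ)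
    (h0 : sys.J X ≤ c - κ)
    (hgrad : ∀ s ∈ Set.Icc (0 : ℝ) 1, X + s • D ∈ sys.stabilizing p → sys.J (X + s • D) ≤ c →
      frobInner D (sys.gradJ (X + s • D)) < κ) : False := by
  obtain ⟨s, hs, hsD, hst⟩ := exists_first_exit hX (s₀ := 1) (D := D) (by simp) (by
    intro hcon
    have h1 := hcl 1
    rw [one_smul (M := ℝ) (b := vecMulVec β h)] at h1
    exact hun (by rw [← h1]; exact hcon))
  obtain ⟨a, b', hb', htr⟩ := hr.exists_trace_Sig_le
  let t : ℕ → ℝ := fun k => s - s * (1 / ((k : ℝ) + 1))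
  have ht : ∀ k, t k ∈ Set.Ico 0 s := fun k => by
    have h1 : (0 : ℝ) < 1 / ((k : ℝ) + 1) := by positivity
    have h2 : 1 / ((k : ℝ) + 1) ≤ 1 := by
      rw [div_le_one (by positivity)]; linarith [(Nat.cast_nonneg k : (0 : ℝ) ≤ k)]
    have hs0 := hs.1
    constructor
    · simp only [t]; nlinarith
    · simp only [t]; nlinarith
  have htlim : Tendsto t atTop (𝓝 s) := by
    have := (tendsto_const_nhds (x := s)).sub
      ((tendsto_const_nhds (x := s)).mul (tendsto_one_div_add_atTop_nhds_zero_nat (𝕜 := ℝ)))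
    simpa [t] using this
  have hJ : ∀ k, sys.J (X + t k • D) ≤ c := fun k =>
    hr.J_le_of_gradient_bound hκ ((ht k).2.le.trans hs.2)
      (fun r hr' => hst r ⟨hr'.1, hr'.2.trans_lt (ht k).2⟩) h0
      (fun r hr' => hgrad r ⟨hr'.1, hr'.2.trans ((ht k).2.le.trans hs.2)⟩
        (hst r ⟨hr'.1, hr'.2.trans_lt (ht k).2⟩)) (t k) ⟨(ht k).1, le_rfl⟩
  have hc : Continuous fun t : ℝ => X + t • D := by fun_prop
  have hKlim : Tendsto (fun k => X + t k • D) atTop (𝓝 (X + s • D)) := (hc.tendsto s).comp htlim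
  have hstk : ∀ k, X + t k • D ∈ sys.stabilizing p := fun k => hst _ (ht k)
  obtain ⟨Y, hY, hYeq⟩ := hr.exists_limit_covariance hKlim hstk
    (C := a + b' * (c - sys.J (sys.KtStar p))) (fun k => (htr _ (hstk k)).trans (by
      have := mul_le_mul_of_nonneg_left (sub_le_sub_right (hJ k) (sys.J (sys.KtStar p))) hb'
      linarith))
  obtain ⟨μ, q, hq, hμ⟩ : ∃ μ q, IsLeftEigen (sys.closedLoop (X + s • D)) μ q ∧ 1 ≤ ‖μ‖ := by
    by_contra! hcon
    exact hsD ((isSchurStable_iff _).2 hcon)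
  have hμ1 : ‖μ‖ ≤ 1 := hq.norm_le_one_of_tendsto
    (((continuous_closedLoop (sys := sys)).tendsto _).comp hKlim) (Eventually.of_forall hstk)
  have h1 := vecMul_eq_zero_of_lyap hr.posSemidef_SigNu hY hYeq hq hμ
  rw [hcl] at hq
  exact IsSchurStable.dotProduct_ne_zero_of_rank_one hX hh hq (le_antisymm hμ1 hμ) (hb q h1)

end System

end LQG

/-! ### No approach to the boundary below a level with bounded gradient. -/

namespace LQG

open Matrix

namespace System

variable {nx nu ny : ℕ} {sys : System nx nu ny} {p : ℕ}

theorem Regular.closedLoop_add_smul_mul_Sstar (hr : sys.Regular p) (X : Gain nu ny p)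
    (H : Matrix (Fin nu) (Fin nx) ℝ) (s : ℝ) :
    sys.closedLoop (X + s • (H * sys.Sstar p)) = sys.closedLoop X + s • (sys.B * H) := by
  rw [closedLoop_eq, closedLoop_eq, Matrix.add_mul, Matrix.smul_mul, Matrix.mul_assoc H,
    hr.Sstar_mul_Sdag, Matrix.mul_one, Matrix.mul_add, Matrix.mul_smul, add_assoc]

theorem Regular.exists_excited_near (hr : sys.Regular p) (hctrb : IsControllable sys.A sys.B)
    {b : Fin nx → ℝ} (hb : b ≠ 0) {X : Gain nu ny p} (hX : X ∈ sys.stabilizing p) {c : ℝ}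
    (hJ : sys.J X < c) {ε : ℝ} (hε : 0 < ε) : ∃ Y ∈ sys.stabilizing p, frobNorm (Y - X) < ε ∧
      sys.J Y < c ∧ Excites (sys.closedLoop Y) b := by
  obtain ⟨F, hF⟩ := hctrb.exists_det_krylov_ne_zero hb
  -- The line X + sD reaches the closed loop A + BF at s = 1, where the Krylov determinant is
  -- nonzero.
  set D : Gain nu ny p := (F - X * sys.Sdag p) * sys.Sstar p with hD
  have hcl : ∀ s : ℝ, sys.closedLoop (X + s • D) =
      sys.closedLoop X + s • (sys.B * (F - X * sys.Sdag p)) :=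
    hr.closedLoop_add_smul_mul_Sstar X _
  have h1 : sys.closedLoop X + sys.B * (F - X * sys.Sdag p) = sys.A + sys.B * F := by
    rw [closedLoop_eq, Matrix.mul_sub]; abel
  have hc : Continuous fun t : ℝ => X + t • D := by fun_prop
  have e1 : ∀ᶠ s in 𝓝 (0 : ℝ), X + s • D ∈ sys.stabilizing p :=
    hc.continuousAt.eventually_mem (isOpen_stabilizing.mem_nhds (by simpa using hX))
  have e2 : ∀ᶠ s in 𝓝 (0 : ℝ), sys.J (X + s • D) < c :=
    (hr.hasDerivAt_J hX D).continuousAt.eventually_lt_const (by simpa using hJ)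
  have e3 : ∀ᶠ s in 𝓝 (0 : ℝ), frobNorm (X + s • D - X) < ε := by
    have : Continuous fun s : ℝ => frobNorm (X + s • D - X) :=
      continuous_frobNorm.comp (hc.sub continuous_const)
    exact this.continuousAt.eventually_lt_const (by simpa [frobNorm_zero] using hε)
  have e4 := eventually_det_krylov_ne_zero (M := sys.closedLoop X)
    (N := sys.B * (F - X * sys.Sdag p)) (b := b) (by rwa [h1])
  obtain ⟨s, ⟨⟨h1, h2⟩, h3⟩, h4⟩ := ((((e1.and e2).and e3).filter_mono
    nhdsWithin_le_nhds).and e4).exists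
  exact ⟨X + s • D, h1, h3, h2, excites_of_det_krylov_ne_zero (by rwa [hcl])⟩

/-- Near a boundary point of the stabilizing set there are low-cost, fully excited controllers with
an almost critical eigenvalue. -/
theorem Regular.exists_nearly_critical (hr : sys.Regular p) (hctrb : IsControllable sys.A sys.B)
    {b : Fin nx → ℝ} (hb : b ≠ 0) {K : ℕ → Gain nu ny p} {Kb : Gain nu ny p}
    (hK : Tendsto K atTop (𝓝 Kb)) (hst : ∀ k, K k ∈ sys.stabilizing p)
    (hKb : Kb ∉ sys.stabilizing p) {c : ℝ} (hJ : ∀ k, sys.J (K k) < c) {ε : ℝ} (hε : 0 < ε) :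
    ∃ Y ∈ sys.stabilizing p, frobNorm (Y - Kb) < ε ∧ sys.J Y < c ∧
      Excites (sys.closedLoop Y) b ∧
      ∃ l v, IsLeftEigen (sys.closedLoop Y) l v ∧ ‖v‖ = 1 ∧ 1 - ε < ‖l‖ := by
  choose Y hY1 hY2 hY3 hY4 using fun k : ℕ => hr.exists_excited_near hctrb hb (hst k) (hJ k)
    (show (0 : ℝ) < 1 / ((k : ℝ) + 1) by positivity)
  have hKf : Tendsto (fun k => frobNorm (K k - Kb)) atTop (𝓝 0) := by
    have : Continuous fun Z : Gain nu ny p => frobNorm (Z - Kb) :=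
      continuous_frobNorm.comp (continuous_id.sub continuous_const)
    simpa [frobNorm_zero, Function.comp_def] using (this.tendsto Kb).comp hK
  have hYf : Tendsto (fun k => frobNorm (Y k - Kb)) atTop (𝓝 0) := by
    have h0 := tendsto_one_div_add_atTop_nhds_zero_nat (𝕜 := ℝ) |>.add hKf
    rw [add_zero] at h0
    refine squeeze_zero (fun _ => frobNorm_nonneg _) (fun k => ?_) h0
    have := frobNorm_add_le (Y k - K k) (K k - Kb)
    rw [sub_add_sub_cancel] at this
    exact this.trans (add_le_add_left (hY2 k).le _)
  have hYM : Tendsto (fun k => sys.closedLoop (Y k)) atTop (𝓝 (sys.closedLoop Kb)) :=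
    (continuous_closedLoop.tendsto Kb).comp (tendsto_of_frobNorm_tendsto hYf)
  obtain ⟨μ, q, hq, hμ⟩ : ∃ μ q, IsLeftEigen (sys.closedLoop Kb) μ q ∧ 1 ≤ ‖μ‖ := by
    by_contra! hcon
    exact hKb ((isSchurStable_iff _).2 hcon)
  obtain ⟨k, ⟨l, v, hv, hl⟩, hk⟩ := ((eventually_exists_isLeftEigen hYM hq
    (show 1 - ε < ‖μ‖ by linarith)).and (hYf.eventually_lt_const hε)).exists
  have hv0 : (‖v‖ : ℂ) ≠ 0 := by exact_mod_cast (norm_ne_zero_iff.2 hv.1)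
  refine ⟨Y k, hY1 k, hk, hY3 k, hY4 k, l, (‖v‖ : ℂ)⁻¹ • v,
    ⟨smul_ne_zero (inv_ne_zero hv0) hv.1, by rw [smul_vecMul, hv.2, smul_comm]⟩, ?_, hl⟩
  rw [norm_smul, norm_inv, Complex.norm_real, norm_norm, inv_mul_cancel₀]
  exact norm_ne_zero_iff.2 hv.1

/-- If the cost stays strictly below the level `c` along stabilizing controllers that approach a
point outside the stabilizing set, then its gradient is unbounded on the part of the sublevel set
near that point. -/
theorem Regular.not_tendsto_boundary (hr : sys.Regular p) (hctrb : IsControllable sys.A sys.B)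
    (hN : sys.SigNu ≠ 0) {K : ℕ → Gain nu ny p} {Kb : Gain nu ny p}
    (hK : Tendsto K atTop (𝓝 Kb)) (hst : ∀ k, K k ∈ sys.stabilizing p)
    (hKb : Kb ∉ sys.stabilizing p) {c κ G r : ℝ} (hκ : 0 < κ) (hr0 : 0 < r)
    (hJ : ∀ k, sys.J (K k) < c - κ)
    (hgrad : ∀ X ∈ sys.stabilizing p, frobNorm (X - Kb) < r → sys.J X ≤ c →
      frobNorm (sys.gradJ X) ≤ G) : False := by
  -- Any nonzero column of Σ_ν serves as b.
  obtain ⟨b, hb0, hb⟩ : ∃ b : Fin nx → ℝ, b ≠ 0 ∧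
      ∀ q : Fin nx → ℂ, q ᵥ* cmat sys.SigNu = 0 → q ⬝ᵥ cvec b = 0 := by
    obtain ⟨j, hj⟩ : ∃ j, (fun i => sys.SigNu i j) ≠ 0 := by
      by_contra! hcon
      exact hN (by ext i j; exact congrFun (hcon j) i)
    exact ⟨_, hj, fun q hq => congrFun hq j⟩
  choose Y hY1 hY2 hY3 hY4 l v hv hvn hl using fun k : ℕ =>
    hr.exists_nearly_critical hctrb hb0 hK hst hKb hJ
      (show (0 : ℝ) < 1 / ((k : ℝ) + 1) by positivity)
  have hl1 : ∀ k, ‖l k‖ < 1 := fun k => (isSchurStable_iff _).1 (hY1 k) _ _ (hv k)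
  have hlim0 := tendsto_one_div_add_atTop_nhds_zero_nat (𝕜 := ℝ)
  have hYf : Tendsto (fun k => frobNorm (Y k - Kb)) atTop (𝓝 0) :=
    squeeze_zero (fun _ => frobNorm_nonneg _) (fun k => (hY2 k).le) hlim0
  have hln : Tendsto (fun k => ‖l k‖) atTop (𝓝 1) := by
    have h1 := (tendsto_const_nhds (x := (1 : ℝ))).sub hlim0
    rw [sub_zero] at h1
    exact tendsto_of_tendsto_of_tendsto_of_le_of_le h1 tendsto_const_nhds (fun k => (hl k).le)
      (fun k => (hl1 k).le)
  set f : Ultrafilter ℕ := Ultrafilter.of (atTop : Filter ℕ)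
  have hf : (f : Filter ℕ) ≤ atTop := Ultrafilter.of_le _
  obtain ⟨vb, hvb, hvlim⟩ := (isCompact_sphere (0 : Fin nx → ℂ) 1).ultrafilter_le_nhds (f.map v) (by
    rw [Ultrafilter.coe_map, le_principal_iff, mem_map]
    exact univ_mem' fun k => by simpa using hvn k)
  obtain ⟨lb, -, hllim⟩ := (isCompact_closedBall (0 : ℂ) 1).ultrafilter_le_nhds (f.map l) (by
    rw [Ultrafilter.coe_map, le_principal_iff, mem_map]
    exact univ_mem' fun k => by simpa using (hl1 k).le)
  replace hvlim : Tendsto v f (𝓝 vb) := hvlim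
  replace hllim : Tendsto l f (𝓝 lb) := hllim
  have hMlim : Tendsto (fun k => sys.closedLoop (Y k)) f (𝓝 (sys.closedLoop Kb)) :=
    ((continuous_closedLoop.tendsto Kb).comp (tendsto_of_frobNorm_tendsto hYf)).mono_left hf
  have hvbe : IsLeftEigen (sys.closedLoop Kb) lb vb := by
    refine ⟨fun h0 => by simp [h0] at hvb, ?_⟩
    have hc : Continuous fun Z : Matrix (Fin nx) (Fin nx) ℝ × (Fin nx → ℂ) => Z.2 ᵥ* cmat Z.1 := by
      have : Continuous fun Z : Matrix (Fin nx) (Fin nx) ℝ × (Fin nx → ℂ) => cmat Z.1 :=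
        continuous_fst.matrix_map (by exact Complex.continuous_ofReal)
      exact continuous_snd.matrix_vecMul this
    have h1 := (hc.tendsto (sys.closedLoop Kb, vb)).comp (hMlim.prodMk_nhds hvlim)
    refine tendsto_nhds_unique h1 ((hllim.smul hvlim).congr fun k => ?_)
    exact (hv k).2.symm
  rw [closedLoop_eq] at hvbe
  -- By the Hautus test some input channel j acts on the limiting mode, so |v·β| stays away from 0
  -- along the ultrafilter.
  obtain ⟨j, hj⟩ := Function.ne_iff.1 (hctrb.vecMul_ne_zero hvbe)
  set β : Fin nx → ℝ := fun i => sys.B i j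
  have hωb : vb ⬝ᵥ cvec β ≠ 0 := hj
  have hωlim : Tendsto (fun k => v k ⬝ᵥ cvec β) f (𝓝 (vb ⬝ᵥ cvec β)) := by
    have : Continuous fun w : Fin nx → ℂ => w ⬝ᵥ cvec β := by fun_prop
    exact (this.tendsto vb).comp hvlim
  have hstep : ∀ k, ∃ h : Fin nx → ℝ, v k ⬝ᵥ cvec β ≠ 0 → l k ≠ 0 →
      (∀ i, |h i| ≤ 3 * ((1 - ‖l k‖ ^ 2) / (‖l k‖ * ‖v k ⬝ᵥ cvec β‖)) * ‖v k‖) ∧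
      ¬ IsSchurStable (sys.closedLoop (Y k) + vecMulVec β h) ∧ ∀ μ : ℂ, ‖μ‖ = 1 →
        ∀ y, μ • y - y ᵥ* cmat (sys.closedLoop (Y k)) = cvec h → y ⬝ᵥ cvec b ≠ 0 := fun k => by
    by_cases h : v k ⬝ᵥ cvec β ≠ 0 ∧ l k ≠ 0
    · obtain ⟨g, hg⟩ := exists_destabilizing (hY1 k) (hY4 k) h.2 (hv k) h.1
      exact ⟨g, fun _ _ => hg⟩
    · exact ⟨0, fun h1 h2 => absurd ⟨h1, h2⟩ h⟩
  choose h hh using hstep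
  have hev : ∀ᶠ k in (f : Filter ℕ), v k ⬝ᵥ cvec β ≠ 0 ∧ l k ≠ 0 := by
    filter_upwards [hωlim.eventually_ne hωb, (hln.mono_left hf).eventually_ne one_ne_zero]
      with k h1 h2 using ⟨h1, norm_ne_zero_iff.1 h2⟩
  -- The size of h is controlled by 1 - |l|², which tends to 0 as the eigenvalues become critical.
  have hhlim : Tendsto h f (𝓝 0) := by
    refine tendsto_pi_nhds.2 fun i => ?_
    have hbd : Tendsto (fun k => 3 * ((1 - ‖l k‖ ^ 2) / (‖l k‖ * ‖v k ⬝ᵥ cvec β‖)) * ‖v k‖) f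
        (𝓝 0) := by
      have hln' := hln.mono_left hf
      have h1 := ((((tendsto_const_nhds (x := (1 : ℝ))).sub (hln'.pow 2)).div
        (hln'.mul hωlim.norm) (by simpa using hωb)).const_mul 3).mul hvlim.norm
      simpa using h1
    refine squeeze_zero_norm' ?_ hbd
    filter_upwards [hev] with k hk
    exact (hh k hk.1 hk.2).1 i
  let D : ℕ → Gain nu ny p := fun k => vecMulVec (Pi.single j 1) (h k) * sys.Sstar p
  have hDlim : Tendsto (fun k => frobNorm (D k)) f (𝓝 0) := by
    have : Continuous fun g : Fin nx → ℝ =>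
        frobNorm (vecMulVec (Pi.single j 1 : Fin nu → ℝ) g * sys.Sstar p) :=
      continuous_frobNorm.comp (by fun_prop)
    have h1 := (this.tendsto 0).comp hhlim
    have h0 : vecMulVec (Pi.single j 1 : Fin nu → ℝ) (0 : Fin nx → ℝ) = 0 := by
      ext; simp [vecMulVec_apply]
    simpa [h0, frobNorm_zero, Function.comp_def] using h1
  have hDG : Tendsto (fun k => frobNorm (D k) * |G|) f (𝓝 0) := by
    simpa using hDlim.mul_const |G|
  obtain ⟨k, ⟨⟨hk1, hk2⟩, hk3⟩, hk4⟩ := (((hev.and (hDlim.eventually_lt_const (half_pos hr0))).and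
    (hDG.eventually_lt_const hκ)).and
    ((hYf.mono_left hf).eventually_lt_const (half_pos hr0))).exists
  obtain ⟨-, hun, hexc⟩ := hh k hk1.1 hk1.2
  refine hr.not_small_destabilizing (hY1 k) (D := D k) (β := β) (h := h k) (fun s => ?_) hun hexc hb
    hκ (hY3 k).le (fun s hs hsst hsJ => ?_)
  · rw [hr.closedLoop_add_smul_mul_Sstar, mul_vecMulVec, mulVec_single_one]
    rfl
  · have h1 : frobNorm (Y k + s • D k - Kb) < r := by
      have h2 := frobNorm_add_le (Y k - Kb) (s • D k)
      rw [frobNorm_smul, abs_of_nonneg hs.1] at h2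
      have h3 := mul_le_mul_of_nonneg_right hs.2 (frobNorm_nonneg (D k))
      rw [sub_add_eq_add_sub] at h2
      linarith
    have h2 := hgrad _ hsst h1 hsJ
    refine lt_of_le_of_lt ((le_abs_self _).trans ((frobInner_le _ _).trans ?_)) hk3
    exact mul_le_mul_of_nonneg_left (h2.trans (le_abs_self G)) (frobNorm_nonneg _)

end System

end LQG

/-! ### The descent estimate and one gradient step. -/

namespace LQG

open Matrix

theorem frobInner_add {m n : Type*} [Fintype m] [Fintype n] (X Y Z : Matrix m n ℝ) :
    frobInner X (Y + Z) = frobInner X Y + frobInner X Z := by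
  simp only [← trace_transpose_mul, Matrix.mul_add, trace_add]

theorem frobInner_comm {m n : Type*} [Fintype m] [Fintype n] (X Y : Matrix m n ℝ) :
    frobInner X Y = frobInner Y X := by
  rw [← trace_transpose_mul, ← trace_transpose_mul, ← trace_transpose, transpose_mul,
    transpose_transpose]

namespace System

variable {nx nu ny : ℕ} {sys : System nx nu ny} {p : ℕ}

theorem frobNorm_gradJ_sub_le {s : Set (Gain nu ny p)} {η : ℝ} (hη0 : 0 < η)
    (hη : ENNReal.ofReal η ≤ 1 / sys.gradLip s) {X Y : Gain nu ny p} (hX : X ∈ s) (hY : Y ∈ s) :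
    frobNorm (sys.gradJ X - sys.gradJ Y) ≤ η⁻¹ * frobNorm (X - Y) := by
  rcases eq_or_ne (frobNorm (X - Y)) 0 with h0 | h0
  · have h1 : X = Y := sub_eq_zero.1 (frobNorm_eq_zero h0)
    simp [h1, frobNorm_zero]
  have hpos : 0 < frobNorm (X - Y) := lt_of_le_of_ne (frobNorm_nonneg _) h0.symm
  have h1 : ENNReal.ofReal (frobNorm (sys.gradJ X - sys.gradJ Y)) /
      ENNReal.ofReal (frobNorm (X - Y)) ≤ sys.gradLip s :=
    le_iSup₂_of_le X hX (le_iSup₂_of_le Y hY le_rfl)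
  -- In `ℝ≥0∞` the inverse of ∞ is 0, so a positive η forces a finite Lipschitz constant.
  have h2 : sys.gradLip s ≤ ENNReal.ofReal η⁻¹ := by
    rw [one_div, ENNReal.le_inv_iff_le_inv] at hη
    rwa [ENNReal.ofReal_inv_of_pos hη0]
  have h3 := h1.trans h2
  rw [← ENNReal.ofReal_div_of_pos hpos, ENNReal.ofReal_le_ofReal_iff (by positivity),
    div_le_iff₀ hpos] at h3
  exact h3

/-- The descent lemma, with the Lipschitz bound available only where J ≤ J(X). J is compared with
the parabola raised by εs. Where they meet, s - s²/2 ≥ s/2 keeps the barrier below J(X), so the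
Lipschitz bound applies and gives a smaller slope. Small ε finishes the argument. -/
theorem Regular.J_segment_le (hr : sys.Regular p) {X : Gain nu ny p} {η : ℝ} (hη : 0 < η)
    (hg : sys.gradJ X ≠ 0)
    (hlip : ∀ Y ∈ sys.stabilizing p, sys.J Y ≤ sys.J X →
      frobNorm (sys.gradJ Y - sys.gradJ X) ≤ η⁻¹ * frobNorm (Y - X)) {s : ℝ} (hs1 : s ≤ 1)
    (hs0 : 0 ≤ s) (hst : ∀ t ∈ Set.Icc 0 s, X + t • (-(η • sys.gradJ X)) ∈ sys.stabilizing p) :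
    sys.J (X + s • (-(η • sys.gradJ X))) ≤
      sys.J X - η * (s - s ^ 2 / 2) * frobNorm (sys.gradJ X) ^ 2 := by
  set g := sys.gradJ X with hgdef
  set D := -(η • g) with hD
  set G := frobNorm g with hG
  have hGpos : 0 < G := lt_of_le_of_ne (frobNorm_nonneg _) fun h => hg (frobNorm_eq_zero h.symm)
  have hslope : ∀ t ∈ Set.Icc 0 s, sys.J (X + t • D) ≤ sys.J X →
      frobInner D (sys.gradJ (X + t • D)) ≤ -(η * (1 - t) * G ^ 2) := fun t ht hJ => by
    have h1 := hlip _ (hst t ht) hJ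
    have h2 : frobNorm (X + t • D - X) = t * (η * G) := by
      rw [add_sub_cancel_left, hD, ← neg_one_smul ℝ (η • g), smul_smul, smul_smul, frobNorm_smul,
        abs_mul, abs_mul, abs_of_nonneg ht.1, abs_of_pos hη]
      simp [mul_assoc, hG]
    rw [h2] at h1
    have h3 : η⁻¹ * (t * (η * G)) = t * G := by field_simp
    rw [h3] at h1
    have h4 : frobInner D (sys.gradJ (X + t • D)) =
        -η * (G ^ 2 + frobInner g (sys.gradJ (X + t • D) - g)) := by
      rw [hG, frobNorm_sq, ← frobInner_add, add_sub_cancel, hD, frobInner_comm,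
        ← neg_smul, frobInner_smul, frobInner_comm]
    have h5 := (abs_le.1 (frobInner_le g (sys.gradJ (X + t • D) - g))).1
    have h6 := mul_le_mul_of_nonneg_left h1 hGpos.le
    rw [h4]
    have h7 : η * (G ^ 2 - t * G ^ 2) ≤ η * (G ^ 2 + frobInner g (sys.gradJ (X + t • D) - g)) :=
      mul_le_mul_of_nonneg_left (by nlinarith) hη.le
    linarith
  have hd : ∀ t ∈ Set.Icc 0 s, HasDerivAt (fun t : ℝ => sys.J (X + t • D))
      (frobInner D (sys.gradJ (X + t • D))) t := fun t ht => hr.hasDerivAt_J_line (hst t ht)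
  have key : ∀ ε, 0 < ε → ε ≤ η * G ^ 2 / 2 →
      sys.J (X + s • D) ≤ sys.J X - η * (s - s ^ 2 / 2) * G ^ 2 + ε * s := fun ε hε hε' => by
    have hB : ∀ t, HasDerivAt (fun t : ℝ => sys.J X - η * (t - t ^ 2 / 2) * G ^ 2 + ε * t)
        (-(η * (1 - t) * G ^ 2) + ε) t := fun t => by
      have h1 := (((((hasDerivAt_id t).sub (((hasDerivAt_id t).pow 2).div_const 2)).const_mul
        η).mul_const (G ^ 2)).const_sub (sys.J X)).add ((hasDerivAt_id t).const_mul ε)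
      refine (h1.congr_deriv ?_)
      simp
    refine image_le_of_deriv_right_lt_deriv_boundary (f := fun t : ℝ => sys.J (X + t • D))
      (fun x hx => (hd x hx).continuousAt.continuousWithinAt)
      (fun x hx => (hd x ⟨hx.1, hx.2.le⟩).hasDerivWithinAt) (by simp) hB
      (fun t ht he => ?_) ⟨hs0, le_rfl⟩
    have hle : sys.J (X + t • D) ≤ sys.J X := by
      rw [he]
      have h1 : ε * t ≤ η * G ^ 2 / 2 * t := mul_le_mul_of_nonneg_right hε' ht.1
      have h2 : 0 ≤ η * G ^ 2 / 2 * (t * (1 - t)) :=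
        mul_nonneg (by positivity) (mul_nonneg ht.1 (by linarith [ht.2]))
      nlinarith
    linarith [hslope t ⟨ht.1, ht.2.le⟩ hle]
  by_contra! hcon
  set b := sys.J X - η * (s - s ^ 2 / 2) * G ^ 2
  have hε : 0 < min (η * G ^ 2 / 2) ((sys.J (X + s • D) - b) / 2) :=
    lt_min (by positivity) (by linarith)
  have h1 := key _ hε (min_le_left _ _)
  have h2 := mul_le_mul_of_nonneg_left hs1 hε.le
  have h3 := min_le_right (η * G ^ 2 / 2) ((sys.J (X + s • D) - b) / 2)
  linarith

theorem Sig_eq_zero {K : Gain nu ny p} (hK : K ∈ sys.stabilizing p) (h : sys.SigNu = 0) :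
    sys.Sig K = 0 := by
  have h1 : IsSchurStable (sys.closedLoop K)ᵀ := IsSchurStable.transpose hK
  exact (h1.eq_dlyap (by simp [h])).symm

/-- If the segment left the stabilizing set, J would lie a fixed margin below J(X) just before the
exit, while the Lipschitz bound keeps the gradient bounded near the exit point;
`Regular.not_tendsto_boundary` forbids this. -/
theorem Regular.gradient_step (hr : sys.Regular p) (hctrb : IsControllable sys.A sys.B)
    {X : Gain nu ny p} (hX : X ∈ sys.stabilizing p) {η : ℝ} (hη : 0 < η)
    (hlip : ∀ Y ∈ sys.stabilizing p, sys.J Y ≤ sys.J X →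
      frobNorm (sys.gradJ Y - sys.gradJ X) ≤ η⁻¹ * frobNorm (Y - X)) :
    X - η • sys.gradJ X ∈ sys.stabilizing p ∧
      sys.J (X - η • sys.gradJ X) ≤ sys.J X - η / 2 * frobNorm (sys.gradJ X) ^ 2 := by
  by_cases hg : sys.gradJ X = 0
  · simpa [hg, frobNorm_zero] using hX
  have hN : sys.SigNu ≠ 0 := fun h => hg (by rw [hr.gradJ_eq hX, Sig_eq_zero hX h]; simp)
  have hGpos : 0 < frobNorm (sys.gradJ X) :=
    lt_of_le_of_ne (frobNorm_nonneg _) fun h => hg (frobNorm_eq_zero h.symm)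
  have hst : ∀ t ∈ Set.Icc (0 : ℝ) 1, X + t • (-(η • sys.gradJ X)) ∈ sys.stabilizing p := by
    by_contra! hcon
    obtain ⟨s₀, hs₀, hD⟩ := hcon
    obtain ⟨s, hs, hsD, hst⟩ := exists_first_exit hX hs₀ hD
    -- Times in [s/2, s) tending to the exit time s. There t - t²/2 ≥ s/4 > s/8, which supplies the
    -- margin.
    let t : ℕ → ℝ := fun k => s - s / 2 * (1 / ((k : ℝ) + 1))
    have ht : ∀ k, t k ∈ Set.Ico (s / 2) s := fun k => by
      have h1 : (0 : ℝ) < 1 / ((k : ℝ) + 1) := by positivity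
      have h2 : 1 / ((k : ℝ) + 1) ≤ 1 := by
        rw [div_le_one (by positivity)]; linarith [(Nat.cast_nonneg k : (0 : ℝ) ≤ k)]
      have hs0 := hs.1
      constructor
      · simp only [t]; nlinarith
      · simp only [t]; nlinarith
    have htlim : Tendsto t atTop (𝓝 s) := by
      have := (tendsto_const_nhds (x := s)).sub
        ((tendsto_const_nhds (x := s / 2)).mul
          (tendsto_one_div_add_atTop_nhds_zero_nat (𝕜 := ℝ)))
      simpa [t] using this
    have ht0 : ∀ k, 0 ≤ t k := fun k => (half_pos hs.1).le.trans (ht k).1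
    have hc : Continuous fun t : ℝ => X + t • (-(η • sys.gradJ X)) := by fun_prop
    have hJ : ∀ k, sys.J (X + t k • (-(η • sys.gradJ X))) <
        sys.J X - η * (s / 8) * frobNorm (sys.gradJ X) ^ 2 := fun k => by
      refine (hr.J_segment_le hη hg hlip ((ht k).2.le.trans hs.2) (ht0 k)
        (fun r hr' => hst r ⟨hr'.1, hr'.2.trans_lt (ht k).2⟩)).trans_lt ?_
      have h1 : s / 8 < t k - t k ^ 2 / 2 := by
        have h2 := (ht k).1
        have h3 := ((ht k).2.trans_le hs.2).le
        nlinarith [hs.1, mul_nonneg (ht0 k) (sub_nonneg.2 h3)]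
      have h2 : 0 < η * frobNorm (sys.gradJ X) ^ 2 := by positivity
      nlinarith
    refine hr.not_tendsto_boundary hctrb hN
      (K := fun k => X + t k • (-(η • sys.gradJ X))) ((hc.tendsto s).comp htlim)
      (fun k => hst _ ⟨ht0 k, (ht k).2⟩) hsD
      (mul_pos (mul_pos hη (by linarith [hs.1] : (0 : ℝ) < s / 8)) (pow_pos hGpos 2))
      one_pos hJ (G := frobNorm (sys.gradJ X) + η⁻¹ * (1 +
        frobNorm (X + s • (-(η • sys.gradJ X)) - X))) (fun Y hY hYn hYJ => ?_)
    have h1 := hlip Y hY hYJ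
    have h2 := frobNorm_add_le (sys.gradJ X) (sys.gradJ Y - sys.gradJ X)
    have h3 := frobNorm_add_le (Y - (X + s • (-(η • sys.gradJ X))))
      (X + s • (-(η • sys.gradJ X)) - X)
    rw [add_sub_cancel] at h2
    rw [sub_add_sub_cancel] at h3
    have h4 := mul_le_mul_of_nonneg_left (h3.trans (add_le_add_left hYn.le _))
      (inv_pos.2 hη).le
    linarith
  have h1 := hr.J_segment_le hη hg hlip le_rfl zero_le_one hst
  have h2 := hst 1 (by simp)
  have h3 : X + (1 : ℝ) • (-(η • sys.gradJ X)) = X - η • sys.gradJ X := by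
    rw [one_smul, sub_eq_add_neg]
  rw [h3] at h1 h2
  refine ⟨h2, h1.trans (le_of_eq (by ring))⟩

end System

end LQG

/-! ### Linear rate and convergence of the iterates. -/

namespace LQG

open Matrix

theorem eq_zero_of_specNorm_eq_zero {m n : Type*} [Fintype m] [Fintype n] [DecidableEq n]
    {M : Matrix m n ℝ} (h : specNorm M = 0) : M = 0 := by
  let _ := Matrix.instL2OpNormedAddCommGroup (m := m) (n := n) (𝕜 := ℝ)
  exact norm_eq_zero.1 h

theorem exists_tendsto_of_frobNorm_le_geometric {m n : Type*} [Fintype m] [Fintype n]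
    {X : ℕ → Matrix m n ℝ} {c r : ℝ} (hr : r < 1)
    (h : ∀ k, frobNorm (X (k + 1) - X k) ≤ c * r ^ k) :
    ∃ Y, Tendsto X atTop (𝓝 Y) := by
  have h1 : ∀ i j, ∃ y, Tendsto (fun k => X k i j) atTop (𝓝 y) := fun i j =>
    cauchySeq_tendsto_of_complete (cauchySeq_of_le_geometric r c hr fun k => by
      rw [dist_comm, Real.dist_eq]
      exact (abs_entry_le_frobNorm (X (k + 1) - X k) i j).trans (h k))
  choose Y hY using h1
  exact ⟨Matrix.of Y, tendsto_pi_nhds.2 fun i => tendsto_pi_nhds.2 fun j => hY i j⟩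

/-- For q < 0 a nonnegative sequence satisfying the recursion is identically zero, so the sign of
q^N does not matter. -/
theorem le_pow_mul_of_le_mul {a : ℕ → ℝ} (ha : ∀ n, 0 ≤ a n) {q : ℝ}
    (h : ∀ n, a (n + 1) ≤ q * a n) (N : ℕ) : a N ≤ q ^ N * a 0 := by
  rcases le_or_gt 0 q with hq | hq
  · induction N with
    | zero => simp
    | succ k ih =>
      calc _ ≤ q * a k := h k
        _ ≤ q * (q ^ k * a 0) := mul_le_mul_of_nonneg_left ih hq
        _ = _ := by ring
  · have h0 : ∀ n, a n = 0 := fun n => by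
      have := (ha (n + 1)).trans (h n)
      exact le_antisymm (by nlinarith) (ha n)
    simp [h0]

namespace System

variable {nx nu ny : ℕ} {sys : System nx nu ny} {p : ℕ}

/-- Gradient descent with an admissible step size stays in the sublevel set and decreases the cost. -/
theorem Regular.gradient_descent (hr : sys.Regular p) (hctrb : IsControllable sys.A sys.B)
    {K : ℕ → Gain nu ny p} (hK0 : K 0 ∈ sys.stabilizing p) {α : ℝ} (hα : 1 ≤ α) {η : ℝ}
    (hη0 : 0 < η) (hη : ENNReal.ofReal η ≤ 1 / sys.gradLip (sys.sublevel (K 0) α))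
    (hstep : ∀ n, K (n + 1) = K n - η • sys.gradJ (K n)) (n : ℕ) :
    K n ∈ sys.sublevel (K 0) α ∧
      sys.J (K (n + 1)) ≤ sys.J (K n) - η / 2 * frobNorm (sys.gradJ (K n)) ^ 2 := by
  have hnext : ∀ n, K n ∈ sys.sublevel (K 0) α → K (n + 1) ∈ sys.stabilizing p ∧
      sys.J (K (n + 1)) ≤ sys.J (K n) - η / 2 * frobNorm (sys.gradJ (K n)) ^ 2 := fun n hn => by
    rw [hstep n]
    exact hr.gradient_step hctrb hn.1 hη0 fun Y hY hYJ =>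
      frobNorm_gradJ_sub_le hη0 hη ⟨hY, (sub_le_sub_right hYJ _).trans hn.2⟩ hn
  have hmem : ∀ n, K n ∈ sys.sublevel (K 0) α := fun n => by
    induction n with
    | zero =>
      refine ⟨hK0, ?_⟩
      have := hr.J_KtStar_le hK0
      -- Here α ≥ 1 is used: the initial gap is nonnegative, hence at most α times itself.
      nlinarith
    | succ n ih =>
      obtain ⟨h1, h2⟩ := hnext n ih
      have h3 : 0 ≤ η / 2 * frobNorm (sys.gradJ (K n)) ^ 2 := by positivity
      exact ⟨h1, le_trans (by linarith) ih.2⟩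
  exact ⟨hmem n, (hnext n (hmem n)).2⟩

/-- Descent combined with gradient domination. A lower bound s in place of the singular value serves
both the stepwise and the uniform rate. -/
theorem Regular.gap_step_le (hr : sys.Regular p) {K : Gain nu ny p}
    (hK : K ∈ sys.stabilizing p) {η j s : ℝ} (hη : 0 ≤ η) (hs : 0 ≤ s)
    (hsm : s ≤ minSing (sys.Sig K))
    (hj : j ≤ sys.J K - η / 2 * frobNorm (sys.gradJ K) ^ 2) :
    j - sys.J (sys.KtStar p) ≤ (1 - 2 * η * s ^ 2 * minSing sys.R /
      (specNorm (sys.Sig (sys.KtStar p)) * specNorm (sys.Sstar p) ^ 2)) *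
        (sys.J K - sys.J (sys.KtStar p)) := by
  set d := specNorm (sys.Sig (sys.KtStar p)) * specNorm (sys.Sstar p) ^ 2 with hd
  set a := sys.J K - sys.J (sys.KtStar p) with ha
  have ha0 : 0 ≤ a := sub_nonneg.2 (hr.J_KtStar_le hK)
  have hd0 : 0 ≤ d := mul_nonneg (specNorm_nonneg _) (sq_nonneg _)
  have h1 : 4 * minSing sys.R * s ^ 2 * a ≤ d * frobNorm (sys.gradJ K) ^ 2 := by
    refine le_trans ?_ (hr.gradient_domination hK)
    have := minSing_nonneg sys.R
    gcongr
  have h2 : 2 * η * s ^ 2 * minSing sys.R / d * a ≤ η / 2 * frobNorm (sys.gradJ K) ^ 2 := by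
    rcases hd0.eq_or_lt with h0 | h0
    · rw [← h0, div_zero, zero_mul]
      positivity
    · rw [div_mul_eq_mul_div, div_le_iff₀ h0]
      nlinarith [mul_le_mul_of_nonneg_left h1 hη]
  linarith

/-- The denominator does not vanish: Σ⋆ = 0 would give Σ_ν = 0 and hence Σ_K = 0, against m > 0, and
S⋆ has a right inverse in nonzero dimension. -/
theorem Regular.rate_pos (hr : sys.Regular p) (hu : 0 < nu) {K : Gain nu ny p}
    (hK : K ∈ sys.stabilizing p) {η m : ℝ} (hη : 0 < η) (hm : 0 < m)
    (hmK : m ≤ minSing (sys.Sig K)) :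
    0 < 2 * η * m ^ 2 * minSing sys.R /
      (specNorm (sys.Sig (sys.KtStar p)) * specNorm (sys.Sstar p) ^ 2) := by
  have hx : nx ≠ 0 := by
    rintro rfl
    rw [minSing_eq_zero_of_dim_zero] at hmK
    linarith
  have : NeZero nx := ⟨hx⟩
  have h1 : specNorm (sys.Sig (sys.KtStar p)) ≠ 0 := fun h => by
    have h2 := eq_zero_of_specNorm_eq_zero h
    have h3 := Sig_eq (sys := sys) hr.KtStar_mem
    rw [h2, Matrix.mul_zero, Matrix.zero_mul, add_zero] at h3
    have h4 := (posSemidef_sub_minSing (hr.posSemidef_Sig hK)).diag_nonneg (i := 0)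
    rw [Matrix.sub_apply, Matrix.smul_apply, Sig_eq_zero hK h3.symm] at h4
    simp at h4
    rw [Sig_eq_zero hK h3.symm] at hmK
    linarith
  have h2 : specNorm (sys.Sstar p) ≠ 0 := fun h => by
    have h2 := hr.Sstar_mul_Sdag
    rw [eq_zero_of_specNorm_eq_zero h, Matrix.zero_mul] at h2
    exact zero_ne_one h2
  have h3 := (specNorm_nonneg (sys.Sig (sys.KtStar p))).lt_of_ne' h1
  have h4 := (specNorm_nonneg (sys.Sstar p)).lt_of_ne' h2
  have h5 := minSing_pos hu hr.posDef_R
  positivity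

theorem Regular.frobNorm_sq_le_gap (hr : sys.Regular p) {K : Gain nu ny p}
    (hK : K ∈ sys.stabilizing p) {m : ℝ} (hm : 0 ≤ m) (hmK : m ≤ minSing (sys.Sig K)) :
    m * minSing sys.Rhat * frobNorm (K * sys.Sdag p - sys.Kstar) ^ 2 ≤
      sys.J K - sys.J (sys.KtStar p) := by
  set E := K * sys.Sdag p - sys.Kstar with hE
  have h1 : (sys.Sig K - m • (1 : Matrix (Fin nx) (Fin nx) ℝ)).PosSemidef := by
    have := (posSemidef_sub_minSing (hr.posSemidef_Sig hK)).add
      (PosSemidef.one (n := Fin nx) (R := ℝ) |>.smul (sub_nonneg.2 hmK))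
    rwa [sub_smul, sub_add_sub_cancel] at this
  have h2 := trace_mul_le_trace_mul h1 (posSemidef_conj hr.posDef_Rhat.posSemidef E)
  have h3 := trace_mul_le_trace_mul (posSemidef_sub_minSing hr.posDef_Rhat.posSemidef)
    (posSemidef_gram Eᵀ)
  rw [hr.J_sub_J_KtStar hK, trace_mul_comm]
  refine le_trans ?_ h2
  rw [Matrix.smul_mul, Matrix.one_mul, trace_smul, smul_eq_mul] at h3 ⊢
  rw [transpose_transpose, ← Matrix.mul_assoc, trace_mul_comm (sys.Rhat * E), trace_mul_comm E,
    trace_transpose_mul, ← frobNorm_sq, ← Matrix.mul_assoc] at h3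
  rw [mul_assoc]
  exact mul_le_mul_of_nonneg_left h3 hm

/-- The descent bounds each squared step by 2η times the gap, so the steps decay geometrically.
Optimality of the limit comes from quadratic growth of the gap (`Regular.frobNorm_sq_le_gap`), which
passes to the limit without knowing that the limit is stabilizing. -/
theorem Regular.exists_optimal_limit (hr : sys.Regular p) {K : ℕ → Gain nu ny p}
    (hK : ∀ n, K n ∈ sys.stabilizing p) {η : ℝ} (hη : 0 < η)
    (hstep : ∀ n, K (n + 1) = K n - η • sys.gradJ (K n))
    (hdesc : ∀ n, sys.J (K (n + 1)) ≤ sys.J (K n) - η / 2 * frobNorm (sys.gradJ (K n)) ^ 2)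
    {m : ℝ} (hm : 0 < m) (hmK : ∀ n, m ≤ minSing (sys.Sig (K n))) :
    ∃ Kinf : Gain nu ny p, Kinf * sys.Sdag p = sys.Kstar ∧ Tendsto K atTop (𝓝 Kinf) := by
  -- Without inputs σ(R) = 0 and the rate is trivial, but all gains are empty and equal.
  rcases Nat.eq_zero_or_pos nu with rfl | hu
  · refine ⟨0, ?_, ?_⟩
    · ext i; exact i.elim0
    · rw [show K = fun _ => 0 from funext fun n => by ext i; exact i.elim0]
      exact tendsto_const_nhds
  set c := 2 * η * m ^ 2 * minSing sys.R /
    (specNorm (sys.Sig (sys.KtStar p)) * specNorm (sys.Sstar p) ^ 2) with hc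
  have hc0 : 0 < c := hr.rate_pos hu (hK 0) hη hm (hmK 0)
  set a := fun n => sys.J (K n) - sys.J (sys.KtStar p) with ha
  have ha0 : ∀ n, 0 ≤ a n := fun n => sub_nonneg.2 (hr.J_KtStar_le (hK n))
  -- Truncation at 0 allows √ρ, the ratio of the step lengths.
  set ρ := max (1 - c) 0 with hρ
  have hρ0 : 0 ≤ ρ := le_max_right _ _
  have hρ1 : ρ < 1 := max_lt (by linarith) one_pos
  have hrate : ∀ n, a n ≤ ρ ^ n * a 0 := le_pow_mul_of_le_mul ha0 fun n =>
    (hr.gap_step_le (hK n) hη.le hm.le (hmK n) (hdesc n)).trans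
      (mul_le_mul_of_nonneg_right (le_max_left _ _) (ha0 n))
  obtain ⟨Y, hY⟩ := exists_tendsto_of_frobNorm_le_geometric (X := K) (r := √ρ)
    (c := √(2 * η * a 0)) ((Real.sqrt_lt_sqrt hρ0 hρ1).trans_eq Real.sqrt_one) fun n => by
      have h1 : η / 2 * frobNorm (sys.gradJ (K n)) ^ 2 ≤ ρ ^ n * a 0 := by
        have := hdesc n
        have := hr.J_KtStar_le (hK (n + 1))
        have := hrate n
        simp only [ha] at this ⊢
        linarith
      rw [hstep n, sub_sub_cancel_left, ← neg_smul, frobNorm_smul, abs_neg, abs_of_pos hη]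
      refine le_of_sq_le_sq ?_ (by positivity)
      rw [mul_pow, mul_pow, ← pow_mul, mul_comm n 2, pow_mul, Real.sq_sqrt hρ0,
        Real.sq_sqrt (mul_nonneg (by linarith) (ha0 0))]
      have := mul_le_mul_of_nonneg_left h1 (by linarith : 0 ≤ 2 * η)
      linarith
  refine ⟨Y, ?_, hY⟩
  have hR := minSing_pos hu hr.posDef_Rhat
  have hlim : Tendsto a atTop (𝓝 0) := by
    have h1 := (tendsto_pow_atTop_nhds_zero_of_lt_one hρ0 hρ1).mul_const (a 0)
    rw [zero_mul] at h1
    exact squeeze_zero ha0 hrate h1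
  have hcont : Continuous fun X : Gain nu ny p =>
      m * minSing sys.Rhat * frobNorm (X * sys.Sdag p - sys.Kstar) ^ 2 :=
    continuous_const.mul ((continuous_frobNorm.comp (by fun_prop)).pow 2)
  have h1 := le_of_tendsto_of_tendsto' ((hcont.tendsto Y).comp hY) hlim
    fun n => hr.frobNorm_sq_le_gap (hK n) hm.le (hmK n)
  have h2 : frobNorm (Y * sys.Sdag p - sys.Kstar) ^ 2 ≤ 0 := by
    by_contra! hcon
    exact absurd h1 (not_le.2 (by positivity))
  exact sub_eq_zero.1 (frobNorm_eq_zero (pow_eq_zero_iff two_ne_zero |>.1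
    (le_antisymm h2 (sq_nonneg _))))

end System

end LQG

theorem mainTheorem5 {nx nu ny : ℕ} (sys : LQG.System nx nu ny) (p : ℕ) (hp : ny ≤ p)
    (hQ : sys.Q.PosSemidef) (hR : sys.R.PosDef) (hW : sys.W.PosSemidef) (hV : sys.V.PosDef)
    (hctrb : LQG.IsControllable sys.A sys.B) (hobsv : LQG.IsObservable sys.A sys.C)
    (hP : ∃ P, LQG.IsStabilizingDARE sys.A sys.B sys.Qt sys.R P)
    (hS : ∃ S, LQG.IsStabilizingDARE sys.A.transpose sys.C.transpose sys.W sys.V S)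
    (hrank : (sys.Sstar p).rank = nx)
    (K : ℕ → LQG.Gain nu ny p) (hK0 : K 0 ∈ sys.stabilizing p)
    (α : ℝ) (hα : 1 ≤ α) (η : ℝ) (hη0 : 0 < η)
    (hη : ENNReal.ofReal η ≤ 1 / sys.gradLip (sys.sublevel (K 0) α))
    (hstep : ∀ n, K (n + 1) = K n - η • sys.gradJ (K n)) :
    (∀ n, K n ∈ sys.sublevel (K 0) α ∧
      sys.J (K (n + 1)) - sys.J (sys.KtStar p) ≤
        (1 - 2 * η * LQG.minSing (sys.Sig (K n)) ^ 2 * LQG.minSing sys.R /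
            (LQG.specNorm (sys.Sig (sys.KtStar p)) * LQG.specNorm (sys.Sstar p) ^ 2)) *
          (sys.J (K n) - sys.J (sys.KtStar p))) ∧
    (∀ m : ℝ, 0 < m → (∀ n, m ≤ LQG.minSing (sys.Sig (K n))) →
      (∀ N : ℕ, sys.J (K N) - sys.J (sys.KtStar p) ≤
        (1 - 2 * η * m ^ 2 * LQG.minSing sys.R /
            (LQG.specNorm (sys.Sig (sys.KtStar p)) * LQG.specNorm (sys.Sstar p) ^ 2)) ^ N *
          (sys.J (K 0) - sys.J (sys.KtStar p))) ∧
      ∃ Kinf : LQG.Gain nu ny p, Kinf * sys.Sdag p = sys.Kstar ∧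
        Tendsto K atTop (𝓝 Kinf)) := by
  have hr : sys.Regular p := ⟨hQ, hR, hV, hP, hS, hrank⟩
  have hdesc := hr.gradient_descent hctrb hK0 hα hη0 hη hstep
  refine ⟨fun n => ⟨(hdesc n).1, hr.gap_step_le (hdesc n).1.1 hη0.le (LQG.minSing_nonneg _) le_rfl
    (hdesc n).2⟩, fun m hm hmK => ⟨fun N => ?_, ?_⟩⟩
  · exact LQG.le_pow_mul_of_le_mul (a := fun n => sys.J (K n) - sys.J (sys.KtStar p))
      (fun n => sub_nonneg.2 (hr.J_KtStar_le (hdesc n).1.1))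
      (fun n => hr.gap_step_le (hdesc n).1.1 hη0.le hm.le (hmK n) (hdesc n).2) N
  · exact hr.exists_optimal_limit (fun n => (hdesc n).1.1) hη0 hstep (fun n => (hdesc n).2) hm hmK
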